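/- Let $d\ge 1$, let $(\Omega,\mathbb P)$ be a probability space endowed with a measurable, measure-preserving action $\tau=(\tau_x)_{x\in\mathbb R^d}$ of $(\mathbb R^d,+)$ (jointly measurable in $(x,\omega)$, up to null sets), and let $V:\Omega\to\mathbb R$ be a square-integrable random variable with $\mathbb E[V]=0$ that is not almost surely zero. Write $V(x,\omega):=V(\tau_{-x}\omega)$ for the associated stationary random field and $\mathcal C(x):=\operatorname{Cov}[V(x,\cdot),V(0,\cdot)]$ for its covariance function, and assume that the $\sigma$-algebra of $\Omega$ is the one generated by $\{V(x,\cdot)\}_{x\in\mathbb R^d}$, up to null sets. Let $T_x\phi:=\phi(\tau_{-x}\,\cdot)$ on the complex space $L^2(\Omega)$. Let $\nabla^{\rm st}=(\nabla^{\rm st}_1,\dots,\nabla^{\rm st}_d)$ be the infinitesimal generator of the group $(T_x)_x$, that is, $\nabla^{\rm st}_j\phi=\frac{d}{dt}\big|_{t=0}T_{te_j}\phi$ in $L^2(\Omega)$, let $\triangle^{\rm st}=\nabla^{\rm st}\cdot\nabla^{\rm st}$, and let $H^2(\Omega)$ be the space of all $\phi\in L^2(\Omega)$ for which all $\nabla^{\rm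 st}_l\nabla^{\rm st}_j\phi$ exist in $L^2(\Omega)$. For $k\in\mathbb R^d$ consider the operator \[H^{\rm st}_{k,0}:=-\triangle^{\rm st}-2ik\cdot\nabla^{\rm st}\quad\text{on } L^2(\Omega),\text{ with domain } H^2(\Omega).\] For $*\in\{\mathrm{pp},\mathrm{sc},\mathrm{ac}\}$, $\sigma_*(H^{\rm st}_{k,0})$ denotes the closure of the union over $\phi\in L^2(\Omega)$ of the supports of the pure point, singular continuous, respectively absolutely continuous part of the spectral measure of $H^{\rm st}_{k,0}$ associated with $\phi$. For sub-$\sigma$-algebras $\mathcal A_1,\mathcal A_2$ let $\alpha(\mathcal A_1,\mathcal A_2):=\sup\{|\mathbb P(G_1\cap G_2)-\mathbb P(G_1)\mathbb P(G_2)|:G_i\in\mathcal A_i\}$, and let $\tilde\alpha(R,D;V)$ be the supremum of $\alpha(\sigma(\{V(x,\cdot)\}_{x\in S_1}),\sigma(\{V(x,\cdot)\}_{x\in S_2}))$ over Borel sets $S_1,S_2\subset\mathbb R^d$ at distance $\ge R$ and of diameters $\le D$. The field $V$ is $\alpha$-mixing if $\tilde\alpha(R,D;V)\to0$ as $R\to\infty$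 for all $D<\infty$. (i) Assume that one of the following holds: (C$_1$) $V$ is a Gaussian field and $\mathcal C$ is not periodic in any direction (there is no $v\neq0$ with $\mathcal C(\cdot+v)=\mathcal C$); or (C$_2$) $\mathcal C$ has exponential decay, that is, for some constant $C>0$, $|\mathcal C(x)|\le Ce^{-|x|/C}$ for all $x$. Then $\sigma(H^{\rm st}_{k,0})=[-|k|^2,\infty)$ for every $k\in\mathbb R^d$. (ii) Assume that one of the following holds: (C$_3$) $V$ is a Gaussian field and the (nonnegative measure) Fourier transform $\widehat{\mathcal C}$ is absolutely continuous with respect to the Lebesgue measure; or (C$_4$) $V$ is $\alpha$-mixing and $\int_{\mathbb R^d}\tilde\alpha(|x|,D;V)\,dx<\infty$ for all $D<\infty$. Then, for every $k\in\mathbb R^d$, $0$ is a simple eigenvalue of $H^{\rm st}_{k,0}$, whose eigenspace is the set $\mathbb C$ of constant functions, and \[\sigma_{\rm pp}(H^{\rm st}_{k,0})=\{0\},\qquad \sigma_{\rm sc}(H^{\rm st}_{k,0})=\varnothing,\qquad \sigma(H^{\rm st}_{k,0})=\sigma_{\rm ac}(H^{\rm st}_{k,0})=[-|k|^2,\infty).\]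 Moreover, if $\mathcal C$ is integrable, then $\widehat{\mathcal C}$ is absolutely continuous. -/

import Mathlib

open MeasureTheory ProbabilityTheory Filter Topology
open scoped ENNReal

noncomputable section

namespace StationarySpectrum

/-! ### Stationary random fields -/

/-- Euclidean space `ℝ^d`. -/
abbrev Space (d : ℕ) : Type := EuclideanSpace ℝ (Fin d)

section Action

variable {d : ℕ} {Ω : Type*} [MeasurableSpace Ω]

/-- A measurable, measure-preserving action of the group `(ℝ^d, +)` on `(Ω, P)`.
Joint measurability is understood up to null sets of `Leb ⊗ P`, so that a complete probability
space is allowed; it holds in particular when `(x, ω) ↦ τ x ω` is jointly measurable. -/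
structure IsMeasurableAction (P : Measure Ω) (τ : Space d → Ω → Ω) : Prop where
  zero : ∀ ω, τ 0 ω = ω
  add : ∀ x y ω, τ x (τ y ω) = τ (x + y) ω
  measurePreserving : ∀ x, MeasurePreserving (τ x) P P
  nullMeasurable :
    NullMeasurable (fun p : Space d × Ω => τ p.1 p.2) ((volume : Measure (Space d)).prod P)

/-- The stationary extension `V(x, ω) = V(τ_{-x} ω)` of a random variable `V`. -/
def field {α : Type*} (τ : Space d → Ω → Ω) (V : Ω → α) (x : Space d) : Ω → α :=
  fun ω => V (τ (-x) ω)

/-- The `σ`-algebra generated by the random variables `V(x, ·)`, `x ∈ S`. -/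
abbrev fieldSigma (τ : Space d → Ω → Ω) (V : Ω → ℝ) (S : Set (Space d)) : MeasurableSpace Ω :=
  ⨆ x ∈ S, MeasurableSpace.comap (field τ V x) inferInstance

/-- The `σ`-algebra of `Ω` is the one generated by the field `V`, up to `P`-null sets. -/
def IsGeneratedBy (P : Measure Ω) (τ : Space d → Ω → Ω) (V : Ω → ℝ) : Prop :=
  ∀ A : Set Ω, MeasurableSet A →
    ∃ B : Set Ω, MeasurableSet[fieldSigma τ V Set.univ] B ∧ A =ᵐ[P] B

/-- The covariance function of the stationary field generated by `V`. -/
def covFun (P : Measure Ω) (τ : Space d → Ω → Ω) (V : Ω → ℝ) (x : Space d) : ℝ :=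
  covariance (field τ V x) (field τ V 0) P

/-! ### Mixing -/

/-- Rosenblatt's `α`-mixing coefficient of two `σ`-algebras. -/
def alphaCoeff (P : Measure Ω) (A₁ A₂ : MeasurableSpace Ω) : ℝ≥0∞ :=
  ⨆ (G₁ : Set Ω) (G₂ : Set Ω) (_ : MeasurableSet[A₁] G₁) (_ : MeasurableSet[A₂] G₂),
    ENNReal.ofReal |P.real (G₁ ∩ G₂) - P.real G₁ * P.real G₂|

/-- The `α`-mixing coefficient of the field `V` at distance `R` and diameter `D`. -/
def alphaMix (P : Measure Ω) (τ : Space d → Ω → Ω) (V : Ω → ℝ) (R D : ℝ) : ℝ≥0∞ :=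
  ⨆ (S₁ : Set (Space d)) (S₂ : Set (Space d))
    (_ : MeasurableSet S₁) (_ : MeasurableSet S₂)
    (_ : ∀ x ∈ S₁, ∀ y ∈ S₂, R ≤ dist x y)
    (_ : ∀ x ∈ S₁, ∀ y ∈ S₁, dist x y ≤ D)
    (_ : ∀ x ∈ S₂, ∀ y ∈ S₂, dist x y ≤ D),
    alphaCoeff P (fieldSigma τ V S₁) (fieldSigma τ V S₂)

/-- The field `V` is `α`-mixing. -/
def IsAlphaMixing (P : Measure Ω) (τ : Space d → Ω → Ω) (V : Ω → ℝ) : Prop :=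
  ∀ D : ℝ, 0 < D → Tendsto (fun R : ℝ => alphaMix P τ V R D) atTop (𝓝 0)

/-- The mixing coefficients are integrable, for every diameter. -/
def HasIntegrableAlphaMixing (P : Measure Ω) (τ : Space d → Ω → Ω) (V : Ω → ℝ) : Prop :=
  ∀ D : ℝ, 0 < D → ∫⁻ x : Space d, alphaMix P τ V ‖x‖ D < ∞

/-! ### Conditions on the covariance function -/

/-- `C` has a period in some direction. -/
def IsPeriodicInSomeDirection (C : Space d → ℝ) : Prop :=
  ∃ v : Space d, v ≠ 0 ∧ Function.Periodic C v

/-- `C` has exponential decay. -/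
def HasExponentialDecay (C : Space d → ℝ) : Prop :=
  ∃ K : ℝ, 0 < K ∧ ∀ x, |C x| ≤ K * Real.exp (-(1 / K) * ‖x‖)

/-- The finite nonnegative measure `m` is the Fourier transform of `C`,
`m = ∫ e^{-i x·y} C(x) dx`, that is, `C(x) = (2π)^{-d} ∫ e^{i x·y} dm(y)`. -/
def IsFourierTransform (C : Space d → ℝ) (m : Measure (Space d)) : Prop :=
  IsFiniteMeasure m ∧ ∀ x, (C x : ℂ) = ((2 * Real.pi : ℝ) : ℂ)⁻¹ ^ d * charFun m x

/-- The Fourier transform of `C` is an absolutely continuous measure. -/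
def HasACFourierTransform (C : Space d → ℝ) : Prop :=
  ∃ m : Measure (Space d), IsFourierTransform C m ∧ m ≪ volume

/-! ### Stationary differential calculus and the fibered operators -/

variable {P : Measure Ω} {τ : Space d → Ω → Ω}

/-- The isometry `T_x φ = φ(τ_{-x} ·)` of `L²(Ω)`. -/
def shift (hτ : IsMeasurableAction P τ) (x : Space d) : Lp ℂ 2 P →ₗᵢ[ℂ] Lp ℂ 2 P :=
  Lp.compMeasurePreservingₗᵢ ℂ (τ (-x)) (hτ.measurePreserving (-x))

/-- The `j`-th component of the stationary gradient: the infinitesimal generator of the group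
`t ↦ T_{t e_j}` on `L²(Ω)`, with its natural domain. -/
def stGrad (hτ : IsMeasurableAction P τ) (j : Fin d) : Lp ℂ 2 P →ₗ.[ℂ] Lp ℂ 2 P where
  domain :=
    { carrier := {φ | DifferentiableAt ℝ
        (fun t : ℝ => shift hτ (t • EuclideanSpace.single j (1 : ℝ)) φ) 0}
      add_mem' := fun {φ ψ} hφ hψ => by
        simpa only [Set.mem_ofPred_eq, map_add] using DifferentiableAt.fun_add hφ hψ
      zero_mem' := by
        simp only [Set.mem_ofPred_eq, map_zero]
        exact differentiableAt_const _
      smul_mem' := fun c φ hφ => by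
        simpa only [Set.mem_ofPred_eq, map_smul] using DifferentiableAt.fun_const_smul hφ c }
  toFun :=
    { toFun := fun φ => deriv
        (fun t : ℝ => shift hτ (t • EuclideanSpace.single j (1 : ℝ)) (φ : Lp ℂ 2 P)) 0
      map_add' := fun φ ψ => by
        simp only [Submodule.coe_add, map_add]
        exact deriv_fun_add φ.2 ψ.2
      map_smul' := fun c φ => by
        simp only [Submodule.coe_smul, map_smul, RingHom.id_apply]
        exact deriv_fun_const_smul c φ.2 }

/-- The space `H²(Ω)`: all second order stationary derivatives exist in `L²(Ω)`. -/
def sobolevTwo (hτ : IsMeasurableAction P τ) : Submodule ℂ (Lp ℂ 2 P) where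
  carrier := {φ | ∀ j, ∃ h : φ ∈ (stGrad hτ j).domain,
    ∀ l, stGrad hτ j ⟨φ, h⟩ ∈ (stGrad hτ l).domain}
  add_mem' := fun {φ ψ} hφ hψ j => by
    obtain ⟨h₁, h₁'⟩ := hφ j
    obtain ⟨h₂, h₂'⟩ := hψ j
    refine ⟨Submodule.add_mem _ h₁ h₂, fun l => ?_⟩
    have := Submodule.add_mem _ (h₁' l) (h₂' l)
    rwa [← LinearPMap.map_add] at this
  zero_mem' := fun j => by
    refine ⟨Submodule.zero_mem _, fun l => ?_⟩
    have h : stGrad hτ j ⟨0, Submodule.zero_mem _⟩ = 0 := LinearPMap.map_zero _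
    rw [h]
    exact Submodule.zero_mem _
  smul_mem' := fun c φ hφ j => by
    obtain ⟨h₁, h₁'⟩ := hφ j
    refine ⟨Submodule.smul_mem _ c h₁, fun l => ?_⟩
    have := Submodule.smul_mem _ c (h₁' l)
    rwa [← LinearPMap.map_smul] at this

/-- The first stationary derivatives, as linear maps on `H²(Ω)`. -/
def gradOnSobolev (hτ : IsMeasurableAction P τ) (j : Fin d) :
    sobolevTwo hτ →ₗ[ℂ] (stGrad hτ j).domain where
  toFun φ := ⟨stGrad hτ j ⟨φ, (φ.2 j).1⟩, (φ.2 j).2 j⟩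
  map_add' φ ψ := Subtype.ext
    (LinearPMap.map_add (stGrad hτ j) ⟨φ, (φ.2 j).1⟩ ⟨ψ, (ψ.2 j).1⟩)
  map_smul' c φ := Subtype.ext (LinearPMap.map_smul (stGrad hτ j) c ⟨φ, (φ.2 j).1⟩)

/-- The fibered operator `H_{k,0} = -Δ - 2 i k·∇` on `L²(Ω)` with domain `H²(Ω)`, where `∇` and
`Δ = ∇·∇` are the stationary gradient and Laplacian. -/
def fiberedOp (hτ : IsMeasurableAction P τ) (k : Space d) : Lp ℂ 2 P →ₗ.[ℂ] Lp ℂ 2 P where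
  domain := sobolevTwo hτ
  toFun :=
    -(∑ j, (stGrad hτ j).toFun ∘ₗ gradOnSobolev hτ j)
      - (2 * Complex.I) • ∑ j, (k j : ℂ) • ((stGrad hτ j).domain.subtype ∘ₗ gradOnSobolev hτ j)

theorem fiberedOp_apply (hτ : IsMeasurableAction P τ) (k : Space d) (φ : sobolevTwo hτ) :
    fiberedOp hτ k φ =
      -(∑ j, stGrad hτ j ⟨stGrad hτ j ⟨φ, (φ.2 j).1⟩, (φ.2 j).2 j⟩)
        - (2 * Complex.I) • ∑ j, (k j : ℂ) • stGrad hτ j ⟨φ, (φ.2 j).1⟩ := by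
  change (_ : sobolevTwo hτ →ₗ[ℂ] Lp ℂ 2 P) φ = _
  simp only [fiberedOp, LinearMap.sub_apply, LinearMap.neg_apply, LinearMap.sum_apply,
    LinearMap.smul_apply, LinearMap.comp_apply]
  rfl

end Action

/-! ### Spectral theory of unbounded operators -/

section Spectral

variable {H : Type*} [NormedAddCommGroup H] [InnerProductSpace ℂ H]

/-- The resolvent set: `A - z` is a bijection from the domain of `A` onto `H`, with bounded
inverse `R`. -/
def resolventSet (A : H →ₗ.[ℂ] H) : Set ℂ :=
  {z | ∃ R : H →L[ℂ] H,
    (∀ ψ : H, ∃ h : R ψ ∈ A.domain, A ⟨R ψ, h⟩ - z • R ψ = ψ) ∧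
    (∀ φ : A.domain, R (A φ - z • (φ : H)) = φ)}

/-- The spectrum of an unbounded operator. -/
def spectrumSet (A : H →ₗ.[ℂ] H) : Set ℂ := (resolventSet A)ᶜ

/-- The eigenspace of an unbounded operator. -/
def eigenspaceSet (A : H →ₗ.[ℂ] H) (z : ℂ) : Set H :=
  {φ | ∃ h : φ ∈ A.domain, A ⟨φ, h⟩ = z • φ}

/-- `μ` is the spectral measure of the self-adjoint operator `A` associated with the vector `φ`:
`⟨φ, (A - z)⁻¹ φ⟩ = ∫ (t - z)⁻¹ dμ(t)` for all nonreal `z`. -/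
def IsSpectralMeasure (A : H →ₗ.[ℂ] H) (φ : H) (μ : Measure ℝ) : Prop :=
  IsFiniteMeasure μ ∧ ∀ z : ℂ, z.im ≠ 0 →
    ∃ ψ : A.domain, A ψ - z • (ψ : H) = φ ∧
      inner ℂ φ (ψ : H) = ∫ t : ℝ, ((t : ℂ) - z)⁻¹ ∂μ

/-- The pure point part of a measure on `ℝ`. -/
def ppPart (μ : Measure ℝ) : Measure ℝ := μ.restrict {t | μ {t} ≠ 0}

/-- The singular continuous part of a measure on `ℝ`. -/
def scPart (μ : Measure ℝ) : Measure ℝ := (μ.singularPart volume).restrict {t | μ {t} = 0}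

/-- The absolutely continuous part of a measure on `ℝ`. -/
def acPart (μ : Measure ℝ) : Measure ℝ := volume.withDensity (μ.rnDeriv volume)

/-- The pure point spectrum. -/
def spectrumPP (A : H →ₗ.[ℂ] H) : Set ℝ :=
  closure (⋃ (φ : H) (μ : Measure ℝ) (_ : IsSpectralMeasure A φ μ), (ppPart μ).support)

/-- The singular continuous spectrum. -/
def spectrumSC (A : H →ₗ.[ℂ] H) : Set ℝ :=
  closure (⋃ (φ : H) (μ : Measure ℝ) (_ : IsSpectralMeasure A φ μ), (scPart μ).support)

/-- The absolutely continuous spectrum. -/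
def spectrumAC (A : H →ₗ.[ℂ] H) : Set ℝ :=
  closure (⋃ (φ : H) (μ : Measure ℝ) (_ : IsSpectralMeasure A φ μ), (acPart μ).support)

end Spectral

end StationarySpectrum

end

set_option linter.unusedSectionVars false

/-! The shifts form a strongly continuous isometric representation of `ℝ^d` on `L²(Ω)`, so
everything can be read in frequency space. Bochner's theorem gives each vector `φ` a finite measure
`freqMeasure` whose characteristic function is `⟨φ, T_x φ⟩`, and the cyclic subspace of `φ` becomes
`L²` of that measure, with `T_x` acting as multiplication by `e^{iξ·x}`. The stationary derivatives
become multiplication by `iξ_j`, and the fibered operator becomes multiplication by `|ξ+k|² - |k|²`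
(`fiberedOp_symbolCalc`). Since a finite measure is determined by its Stieltjes transform, spectral
measures are exactly the images of frequency measures under this symbol. Two questions about
frequency measures remain.

First, if every ball is charged by some frequency measure, the spectrum is the full range `[-|k|²,
∞)` of the symbol (`spectrumSet_fiberedOp`). For a Gaussian field take `φ = e^{iV}`: its correlation
is a constant times `exp` of the covariance, so its frequency measure is a positive series of
convolution powers of that of `V`. The frequencies charged by these powers form a closed subgroup,
and if it were proper, a nonzero annihilating vector would be, up to `2π`, a period of the
covariance. Under exponential decay take `φ = V`: a frequency measure vanishing on a ball would have
a Fourier-side density that is real analytic along lines and locally zero, hence zero.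

Second, suppose all vectors orthogonal to the constants have absolutely continuous frequency measure
(`IsACOffConstants`). Then each frequency measure is a Dirac mass at `0` plus an absolutely
continuous part. The symbol sends `0` to `0` and Lebesgue-null sets pull back to null sets, so the
spectral types and the kernel follow. The property need only be tested on a total family
(`isACOffConstants_of_total`): exponentials of finite combinations of field values in the Gaussian
case, indicators of events depending on finitely many values in the mixing case. There the
correlation of a centered indicator is itself a mixing coefficient, hence integrable.

In the second situation full support needs a further idea. By Riemann-Lebesgue the action is mixing,
so the frequency measure of a product of `u` with a far translate of `v` approaches the convolution
of their measures. The charged frequencies therefore form a group; it contains a set of positive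
volume, so by Steinhaus it is open, and it is everything (`IsACOffConstants.chargedSet_eq_univ`). -/

namespace StationarySpectrum

/-! ### Lévy continuity and positivity of the Fourier transform -/

section HarmonicAnalysis

open Real FourierTransform Module
open scoped RealInnerProductSpace

variable {E : Type*} [NormedAddCommGroup E] [InnerProductSpace ℝ E] [FiniteDimensional ℝ E]
  [MeasurableSpace E] [BorelSpace E]

theorem integrable_exp_neg_mul_norm_sq {b : ℝ} (hb : 0 < b) :
    Integrable fun w : E => Real.exp (-b * ‖w‖ ^ 2) := by
  have := (GaussianFourier.integrable_cexp_neg_mul_sq_norm_add (V := E) (b := (b : ℂ))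
    (by simpa using hb) 0 0).norm
  refine this.congr (.of_forall fun w => ?_)
  simp [Complex.norm_exp, ← Complex.ofReal_pow]

theorem charFun_smul_measure (c : ℝ≥0∞) (μ : Measure E) (t : E) :
    charFun (c • μ) t = (c.toReal : ℂ) * charFun μ t := by
  rw [charFun_apply, integral_smul_measure, charFun_apply, Complex.real_smul]

/-- Normalisation of a convergent sequence of characteristic functions. -/
theorem tendsto_charFun_normalize {μ : ℕ → Measure E} [∀ n, IsFiniteMeasure (μ n)] {f : E → ℂ}
    (h : ∀ t, Tendsto (fun n => charFun (μ n) t) atTop (𝓝 (f t))) (h0 : f 0 ≠ 0) :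
    ∃ N, (∀ n, NeZero (μ (n + N))) ∧
      ∀ t, Tendsto (fun n => charFun ((μ (n + N) Set.univ)⁻¹ • μ (n + N)) t) atTop
        (𝓝 ((f 0)⁻¹ * f t)) := by
  have h1 : ∀ᶠ n in atTop, charFun (μ n) 0 ≠ 0 := (h 0).eventually_ne h0
  obtain ⟨N, hN⟩ := eventually_atTop.1 h1
  refine ⟨N, fun n => ⟨fun hz => hN (n + N) (by omega) (by simp [hz])⟩, fun t => ?_⟩
  have h2 : ∀ n, charFun ((μ (n + N) Set.univ)⁻¹ • μ (n + N)) t =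
      (charFun (μ (n + N)) 0)⁻¹ * charFun (μ (n + N)) t := fun n => by
    rw [charFun_smul_measure, charFun_zero, ENNReal.toReal_inv]
    simp [Measure.real]
  simp_rw [h2]
  exact ((tendsto_add_atTop_iff_nat N).2 ((h 0).inv₀ h0)).mul
    ((tendsto_add_atTop_iff_nat N).2 (h t))

/-- A pointwise limit of characteristic functions of finite measures which is continuous at the
origin is the characteristic function of a finite measure. -/
theorem exists_charFun_eq_of_tendsto {μ : ℕ → Measure E} [∀ n, IsFiniteMeasure (μ n)] {f : E → ℂ}
    (hf : ContinuousAt f 0) (h : ∀ t, Tendsto (fun n => charFun (μ n) t) atTop (𝓝 (f t))) :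
    ∃ m : Measure E, IsFiniteMeasure m ∧ ∀ t, charFun m t = f t := by
  have hreal : ∃ r : ℝ, 0 ≤ r ∧ f 0 = r := by
    have h1 : Tendsto (fun n => (μ n).real Set.univ) atTop (𝓝 (f 0).re) := by
      have := (Complex.continuous_re.tendsto _).comp (h 0)
      simpa [Function.comp_def] using this
    refine ⟨(f 0).re, ge_of_tendsto' h1 fun n => measureReal_nonneg, ?_⟩
    refine tendsto_nhds_unique (h 0) ?_
    simp_rw [charFun_zero]
    exact (Complex.continuous_ofReal.tendsto _).comp h1
  obtain ⟨r, hr, hfr⟩ := hreal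
  by_cases h0 : f 0 = 0
  · refine ⟨0, inferInstance, fun t => ?_⟩
    rw [charFun_zero_measure]
    refine tendsto_nhds_unique ?_ (h t)
    have h2 := (h 0).norm
    rw [h0, norm_zero] at h2
    refine squeeze_zero_norm (fun n => ?_) h2
    refine (norm_charFun_le t).trans ?_
    rw [charFun_zero, Complex.norm_real, Real.norm_of_nonneg measureReal_nonneg]
  obtain ⟨N, hN, hlim⟩ := tendsto_charFun_normalize h h0
  let ν : ℕ → ProbabilityMeasure E := fun n =>
    ⟨(μ (n + N) Set.univ)⁻¹ • μ (n + N), by have := hN n; infer_instance⟩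
  -- Continuity of the limit at the origin rules out loss of mass at infinity; Prokhorov then
  -- supplies a convergent subsequence, whose limit has the right characteristic function.
  have htight : IsTightMeasureSet (Set.range fun n => (ν n : Measure E)) :=
    isTightMeasureSet_of_tendsto_charFun (f := fun t => (f 0)⁻¹ * f t)
      (continuousAt_const.mul hf) hlim
  have hcomp : IsCompact (closure (Set.range ν)) := by
    refine isCompact_closure_of_isTightMeasureSet ?_
    convert htight using 1
    ext m
    simp
  obtain ⟨m, -, φ, hφ, hm⟩ := hcomp.tendsto_subseq
    (fun n => subset_closure (Set.mem_range_self n))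
  have hm' : ∀ t, charFun (m : Measure E) t = (f 0)⁻¹ * f t := fun t => by
    refine tendsto_nhds_unique ?_ ((hlim t).comp hφ.tendsto_atTop)
    exact ProbabilityMeasure.tendsto_iff_tendsto_charFun.1 hm t
  refine ⟨ENNReal.ofReal r • (m : Measure E), Measure.smul_finite _ ENNReal.ofReal_ne_top, fun t => ?_⟩
  rw [charFun_smul_measure, hm', ENNReal.toReal_ofReal hr, ← hfr, mul_inv_cancel_left₀ h0]

/-- If the characteristic functions converge, an open set charged by the limit is charged by some
member of the sequence. -/
theorem exists_measure_ne_zero_of_tendsto_charFun {μ : ℕ → Measure E} [∀ n, IsFiniteMeasure (μ n)]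
    {m : Measure E} [IsFiniteMeasure m]
    (h : ∀ t, Tendsto (fun n => charFun (μ n) t) atTop (𝓝 (charFun m t)))
    {U : Set E} (hU : IsOpen U) (hm : m U ≠ 0) : ∃ n, μ n U ≠ 0 := by
  by_contra! hcon
  have hm0 : m ≠ 0 := fun h => hm (by simp [h])
  have : NeZero m := ⟨hm0⟩
  have h0 : charFun m 0 ≠ 0 := by
    rw [charFun_zero]
    exact_mod_cast (measureReal_ne_zero_iff).2 (by simpa using hm0)
  obtain ⟨N, hN, hlim⟩ := tendsto_charFun_normalize h h0
  let ν : ℕ → ProbabilityMeasure E := fun n =>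
    ⟨(μ (n + N) Set.univ)⁻¹ • μ (n + N), by have := hN n; infer_instance⟩
  let ν₀ : ProbabilityMeasure E := ⟨(m Set.univ)⁻¹ • m, inferInstance⟩
  have hν : Tendsto ν atTop (𝓝 ν₀) := by
    refine ProbabilityMeasure.tendsto_iff_tendsto_charFun.2 fun t => ?_
    have : charFun (ν₀ : Measure E) t = (charFun m 0)⁻¹ * charFun m t := by
      change charFun ((m Set.univ)⁻¹ • m) t = _
      rw [charFun_smul_measure, charFun_zero, ENNReal.toReal_inv]
      simp [Measure.real]
    rw [this]
    exact hlim t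
  -- Portmanteau for open sets: the limit cannot charge `U` if no term of the sequence does.
  have hle := ProbabilityMeasure.le_liminf_measure_open_of_tendsto hν hU
  have hz : ∀ n, (ν n : Measure E) U = 0 := fun n => by
    change ((μ (n + N) Set.univ)⁻¹ • μ (n + N)) U = 0
    simp [hcon]
  simp only [hz, liminf_const, nonpos_iff_eq_zero] at hle
  change ((m Set.univ)⁻¹ • m) U = 0 at hle
  simp [hm] at hle

/-- An integrable continuous function with nonnegative Fourier transform is the characteristic
function of a finite measure. -/
theorem exists_charFun_eq_of_fourier_nonneg {F : E → ℂ} (hF : Integrable F) (hFc : Continuous F)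
    {r : E → ℝ} (hr : ∀ w, 0 ≤ r w) (hFr : ∀ w, 𝓕 F w = r w) :
    ∃ m : Measure E, IsFiniteMeasure m ∧ ∀ t, charFun m t = F t := by
  have hrc : Continuous r := by
    have h1 : Continuous (𝓕 F) :=
      VectorFourier.fourierIntegral_continuous Real.continuous_fourierChar (L := innerₗ E)
        continuous_inner hF
    have h2 : r = fun w => (𝓕 F w).re := by ext w; simp [hFr]
    rw [h2]
    exact Complex.continuous_re.comp h1
  have hrb : ∀ w, r w ≤ ∫ v, ‖F v‖ := fun w => by
    have : ‖𝓕 F w‖ ≤ ∫ v, ‖F v‖ := VectorFourier.norm_fourierIntegral_le_integral_norm _ _ _ _ _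
    rwa [hFr, Complex.norm_real, Real.norm_of_nonneg (hr w)] at this
  let g : ℕ → E → ℝ := fun n w => Real.exp (-((n : ℝ) + 1)⁻¹ * ‖w‖ ^ 2) * r w
  have hgc : ∀ n, Continuous (g n) := fun n => by fun_prop
  have hg0 : ∀ n w, 0 ≤ g n w := fun n w => mul_nonneg (Real.exp_pos _).le (hr w)
  have hgi : ∀ n, Integrable (g n) := fun n => by
    refine (integrable_exp_neg_mul_norm_sq (by positivity : (0 : ℝ) < ((n : ℝ) + 1)⁻¹)).mul_bdd
      (c := ∫ v, ‖F v‖) hrc.aestronglyMeasurable (.of_forall fun w => ?_)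
    rw [Real.norm_of_nonneg (hr w)]
    exact hrb w
  -- The density need not be known to be integrable, so it is damped by Gaussians that widen with
  -- `n`. The dilation by `2π` converts the `e^{2πi}` convention of `𝓕` into the `e^{i}` convention
  -- of `charFun`.
  let μ : ℕ → Measure E := fun n =>
    (volume.withDensity fun w => ENNReal.ofReal (g n w)).map fun w => (2 * π) • w
  have hμ : ∀ n, IsFiniteMeasure (μ n) := fun n => by
    have := isFiniteMeasure_withDensity_ofReal (hgi n).2
    exact Measure.isFiniteMeasure_map _ _
  have hchar : ∀ n t, charFun (μ n) t =
      ∫ w : E, Complex.exp (-(((n : ℝ) + 1 : ℝ) : ℂ)⁻¹ * ‖w‖ ^ 2 + 2 * π * Complex.I * ⟪t, w⟫)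
        • 𝓕 F w := fun n t => by
    rw [charFun_apply, integral_map (by fun_prop) (by fun_prop),
      integral_withDensity_eq_integral_toReal_smul (by fun_prop) (by simp)]
    congr 1 with w
    rw [ENNReal.toReal_ofReal (hg0 n w), hFr, Complex.real_smul, smul_eq_mul, Complex.exp_add,
      inner_smul_left, real_inner_comm]
    simp only [g]
    push_cast
    simp only [map_mul, conj_trivial]
    push_cast
    ring_nf
  refine exists_charFun_eq_of_tendsto (μ := μ) hFc.continuousAt fun t => ?_
  simp_rw [hchar]
  have key : Tendsto (fun c : ℝ =>
      ∫ w : E, Complex.exp (-(c : ℂ)⁻¹ * ‖w‖ ^ 2 + 2 * π * Complex.I * ⟪t, w⟫) • 𝓕 F w)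
      atTop (𝓝 (F t)) := by
    have B := Real.tendsto_integral_gaussian_smul' hF (v := t) hFc.continuousAt
    refine B.congr' ?_
    filter_upwards [Ioi_mem_atTop 0] with c (hc : 0 < c)
    have J : Integrable
        (fun w => Complex.exp (-(c : ℂ)⁻¹ * ‖w‖ ^ 2 + 2 * π * Complex.I * ⟪t, w⟫)) :=
      GaussianFourier.integrable_cexp_neg_mul_sq_norm_add (by simpa) _ _
    have := (VectorFourier.integral_fourierIntegral_smul_eq_flip (L := innerₗ E)
      Real.continuous_fourierChar continuous_inner J hF)
    refine Eq.trans ?_ (this.trans ?_)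
    · congr 1 with w
      congr 1
      have h3 := fourier_gaussian_innerProductSpace' (V := E) (b := (c : ℂ)⁻¹) (by simpa) t w
      change _ = 𝓕 (fun v : E => Complex.exp (-(c : ℂ)⁻¹ * ‖v‖ ^ 2
        + 2 * π * Complex.I * ⟪t, v⟫)) w
      rw [h3]
      simp
      left
      congr 1
      ring
    · rw [flip_innerₗ]
      rfl
  exact key.comp ((tendsto_atTop_add_const_right _ 1 tendsto_natCast_atTop_atTop))

end HarmonicAnalysis

end StationarySpectrum

namespace StationarySpectrum

/-! ### Bochner's theorem for a unitary representation -/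

section UnitaryRep

open Real FourierTransform Module
open scoped RealInnerProductSpace

variable {E : Type*} [NormedAddCommGroup E] [InnerProductSpace ℝ E]
variable {H : Type*} [NormedAddCommGroup H] [InnerProductSpace ℂ H]

/-- A strongly continuous isometric representation of the additive group `E`. -/
structure IsUnitaryRep (T : E → H →ₗᵢ[ℂ] H) : Prop where
  zero : ∀ φ, T 0 φ = φ
  add : ∀ x y φ, T (x + y) φ = T x (T y φ)
  continuous : ∀ φ, Continuous fun x => T x φ

namespace IsUnitaryRep

variable {T : E → H →ₗᵢ[ℂ] H}

theorem inner_apply (hT : IsUnitaryRep T) (x y : E) (φ ψ : H) :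
    inner ℂ (T x φ) (T y ψ) = inner ℂ φ (T (y - x) ψ) := by
  rw [show T y ψ = T x (T (y - x) ψ) by rw [← hT.add, add_sub_cancel], (T x).inner_map_map]

variable [FiniteDimensional ℝ E] [MeasurableSpace E] [BorelSpace E] [CompleteSpace H]

/-- The Gaussian-damped correlation function has a nonnegative Fourier transform. -/
theorem fourier_gaussian_mul_inner_nonneg (hT : IsUnitaryRep T) (φ : H) {b : ℝ} (hb : 0 < b)
    (w : E) : ∃ r : ℝ, 0 ≤ r ∧
      𝓕 (fun u : E => ((Real.exp (-b * ‖u‖ ^ 2) : ℝ) : ℂ) * inner ℂ φ (T u φ)) w = r := by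
  -- With `v = ∫ g(x) T_x φ dx`, the number `‖v‖²` is a positive multiple of the Fourier coefficient
  -- at `w`. This is where nonnegativity comes from.
  let g : E → ℂ := fun x => (Real.exp (-(2 * b) * ‖x‖ ^ 2) : ℝ)
    * Complex.exp (((-2 * π * ⟪x, w⟫ : ℝ) : ℂ) * Complex.I)
  let f : E → H := fun x => g x • T x φ
  have hgc : Continuous g := by fun_prop
  have hTc := hT.continuous φ
  have hfc : Continuous f := hgc.smul hTc
  have hgn : ∀ x, ‖g x‖ = Real.exp (-(2 * b) * ‖x‖ ^ 2) := fun x => by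
    simp only [g, norm_mul, Complex.norm_exp_ofReal_mul_I, mul_one, Complex.norm_real,
      Real.norm_of_nonneg (Real.exp_pos _).le]
  have hfi : Integrable f := by
    refine ((integrable_exp_neg_mul_norm_sq (E := E) (b := 2 * b) (by positivity)).mul_const
      ‖φ‖).mono' hfc.aestronglyMeasurable (.of_forall fun x => ?_)
    simp only [f, norm_smul, (T x).norm_map, hgn]
    rfl
  let K : E → ℂ := fun u => inner ℂ φ (T u φ)
  have hKc : Continuous K := continuous_const.inner hTc
  have hKb : ∀ u, ‖K u‖ ≤ ‖φ‖ * ‖φ‖ := fun u => by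
    simpa using norm_inner_le_norm (𝕜 := ℂ) φ (T u φ)
  let e : E → ℂ := fun u => Complex.exp (((-2 * π * ⟪u, w⟫ : ℝ) : ℂ) * Complex.I)
  let k : E → E → ℂ := fun y u =>
    ((Real.exp (-(2 * b) * (‖y‖ ^ 2 + ‖y + u‖ ^ 2)) : ℝ) : ℂ) * (e u * K u)
  have hk : ∀ y u, inner ℂ (f y) (f (y + u)) = k y u := fun y u => by
    simp only [f, inner_smul_left, inner_smul_right, hT.inner_apply, add_sub_cancel_left, k, g, K,
      e, map_mul, Complex.conj_ofReal, ← Complex.exp_conj, Complex.conj_I, inner_add_left]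
    rw [show -(2 * b) * (‖y‖ ^ 2 + ‖y + u‖ ^ 2) = -(2 * b) * ‖y‖ ^ 2 + -(2 * b) * ‖y + u‖ ^ 2 by
      ring, Real.exp_add]
    have : Complex.exp (((-2 * π * ⟪y, w⟫ : ℝ) : ℂ) * -Complex.I) *
        Complex.exp (((-2 * π * (⟪y, w⟫ + ⟪u, w⟫) : ℝ) : ℂ) * Complex.I) =
        Complex.exp (((-2 * π * ⟪u, w⟫ : ℝ) : ℂ) * Complex.I) := by
      rw [← Complex.exp_add]
      congr 1
      push_cast
      ring
    rw [← this]
    push_cast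
    ring
  have hkc : Continuous (Function.uncurry k) := by
    simp only [k, e, Function.uncurry_def]
    fun_prop
  have hki : Integrable (Function.uncurry k) (volume.prod volume) := by
    have h1 := ((integrable_exp_neg_mul_norm_sq (E := E) (b := b) hb).mul_prod
      (integrable_exp_neg_mul_norm_sq (E := E) (b := b / 2) (by positivity))).mul_const (‖φ‖ * ‖φ‖)
    refine h1.mono' hkc.aestronglyMeasurable (.of_forall fun ⟨y, u⟩ => ?_)
    simp only [k, e, Function.uncurry_apply_pair, norm_mul, Complex.norm_exp_ofReal_mul_I, one_mul,
      Complex.norm_real, Real.norm_of_nonneg (Real.exp_pos _).le]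
    rw [← Real.exp_add]
    refine mul_le_mul (Real.exp_le_exp.2 ?_) (hKb u) (norm_nonneg _) (Real.exp_pos _).le
    have h2 : ‖u‖ ≤ ‖y + u‖ + ‖y‖ := by
      simpa using norm_sub_le (y + u) y
    have h3 : ‖u‖ ^ 2 ≤ 2 * ‖y + u‖ ^ 2 + 2 * ‖y‖ ^ 2 := by
      nlinarith [norm_nonneg u, norm_nonneg y, norm_nonneg (y + u), sq_nonneg (‖y + u‖ - ‖y‖)]
    nlinarith
  have hin : ∀ u, ∫ y, k y u = ((∫ y : E, Real.exp (-(4 * b) * ‖y‖ ^ 2) : ℝ) : ℂ) *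
      (e u * (((Real.exp (-b * ‖u‖ ^ 2) : ℝ) : ℂ) * K u)) := fun u => by
    simp only [k]
    rw [integral_mul_const, integral_complex_ofReal]
    -- Completing the square about `-u/2` separates the two Gaussians, leaving exactly the damping
    -- `e^{-b|u|²}`; this is why `g` carries the exponent `2b`.
    have : ∀ y : E, Real.exp (-(2 * b) * (‖y‖ ^ 2 + ‖y + u‖ ^ 2)) =
        Real.exp (-(4 * b) * ‖y + (2 : ℝ)⁻¹ • u‖ ^ 2) * Real.exp (-b * ‖u‖ ^ 2) := fun y => by
      rw [← Real.exp_add]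
      congr 1
      have h4 := parallelogram_law_with_norm ℝ (y + (2 : ℝ)⁻¹ • u) ((2 : ℝ)⁻¹ • u)
      rw [show y + (2 : ℝ)⁻¹ • u + (2 : ℝ)⁻¹ • u = y + u by
          rw [add_assoc, ← add_smul]; norm_num, add_sub_cancel_right, norm_smul] at h4
      norm_num at h4
      nlinarith
    have h5 : ∫ y : E, Real.exp (-(2 * b) * (‖y‖ ^ 2 + ‖y + u‖ ^ 2)) =
        (∫ y : E, Real.exp (-(4 * b) * ‖y‖ ^ 2)) * Real.exp (-b * ‖u‖ ^ 2) := by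
      rw [← integral_add_right_eq_self (fun y : E => Real.exp (-(4 * b) * ‖y‖ ^ 2))
        ((2 : ℝ)⁻¹ • u), ← integral_mul_const]
      exact integral_congr_ae (.of_forall this)
    rw [h5]
    push_cast
    ring
  set v : H := ∫ x, f x with hv
  set c : ℝ := ∫ y : E, Real.exp (-(4 * b) * ‖y‖ ^ 2) with hc
  have hcpos : 0 < c := by
    rw [hc, GaussianFourier.integral_rexp_neg_mul_sq_norm (by positivity)]
    positivity
  have hvv : inner ℂ v v = (c : ℂ) *
      𝓕 (fun u : E => ((Real.exp (-b * ‖u‖ ^ 2) : ℝ) : ℂ) * inner ℂ φ (T u φ)) w := by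
    rw [Real.fourier_eq']
    calc inner ℂ v v = ∫ y, inner ℂ (f y) v := by
          have h6 := integral_inner (𝕜 := ℂ) hfi v
          rw [← hv] at h6
          rw [← inner_conj_symm, ← h6, ← integral_conj]
          exact integral_congr_ae (.of_forall fun y => inner_conj_symm _ _)
      _ = ∫ y, ∫ u, k y u := by
          refine integral_congr_ae (.of_forall fun y => ?_)
          simp only [hv]
          rw [← integral_inner hfi, ← integral_add_left_eq_self _ y]
          exact integral_congr_ae (.of_forall fun u => hk y u)
      _ = ∫ u, ∫ y, k y u := integral_integral_swap hki
      _ = _ := by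
          simp_rw [hin]
          rw [integral_const_mul]
          rfl
  refine ⟨c⁻¹ * ‖v‖ ^ 2, by positivity, ?_⟩
  rw [inner_self_eq_norm_sq_to_K] at hvv
  have : (c : ℂ) ≠ 0 := by exact_mod_cast hcpos.ne'
  rw [← mul_right_inj' this, ← hvv]
  push_cast
  field_simp
  rfl

/-- Bochner's theorem for the correlation function of a vector. -/
theorem exists_charFun_eq_inner (hT : IsUnitaryRep T) (φ : H) :
    ∃ m : Measure E, IsFiniteMeasure m ∧ ∀ x, charFun m x = inner ℂ φ (T x φ) := by
  have hKc : Continuous fun u => inner ℂ φ (T u φ) := continuous_const.inner (hT.continuous φ)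
  have hKb : ∀ u, ‖inner ℂ φ (T u φ)‖ ≤ ‖φ‖ * ‖φ‖ := fun u => by
    simpa using norm_inner_le_norm (𝕜 := ℂ) φ (T u φ)
  -- The damped correlation is integrable, so it is a characteristic function; the damping is then
  -- removed by letting `n → ∞`, the limit being continuous by strong continuity.
  have step : ∀ n : ℕ, ∃ m : Measure E, IsFiniteMeasure m ∧ ∀ x, charFun m x =
      ((Real.exp (-((n : ℝ) + 1)⁻¹ * ‖x‖ ^ 2) : ℝ) : ℂ) * inner ℂ φ (T x φ) := fun n => by
    have hb : (0 : ℝ) < ((n : ℝ) + 1)⁻¹ := by positivity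
    choose r hr0 hr using hT.fourier_gaussian_mul_inner_nonneg φ hb
    refine exists_charFun_eq_of_fourier_nonneg ?_ (by fun_prop) hr0 hr
    exact (integrable_exp_neg_mul_norm_sq (E := E) hb).ofReal.mul_bdd
      hKc.aestronglyMeasurable (.of_forall hKb)
  choose m hm hmc using step
  refine exists_charFun_eq_of_tendsto (μ := m) hKc.continuousAt fun t => ?_
  simp_rw [hmc]
  have h1 : Tendsto (fun n : ℕ => ((Real.exp (-((n : ℝ) + 1)⁻¹ * ‖t‖ ^ 2) : ℝ) : ℂ)) atTop
      (𝓝 ((Real.exp (-0 * ‖t‖ ^ 2) : ℝ) : ℂ)) := by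
    refine (Complex.continuous_ofReal.tendsto _).comp ((Real.continuous_exp.tendsto _).comp ?_)
    refine Tendsto.mul_const _ (Tendsto.neg ?_)
    exact tendsto_inv_atTop_zero.comp
      (tendsto_atTop_add_const_right _ 1 tendsto_natCast_atTop_atTop)
  simpa using h1.mul_const (inner ℂ φ (T t φ))

end IsUnitaryRep

end UnitaryRep

end StationarySpectrum

namespace StationarySpectrum

/-! ### Uniqueness, absolute continuity and full support from characteristic functions -/

section CharacteristicFunctions

open Real FourierTransform Module
open scoped RealInnerProductSpace

variable {E : Type*} [NormedAddCommGroup E] [InnerProductSpace ℝ E] [FiniteDimensional ℝ E]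
  [MeasurableSpace E] [BorelSpace E]

/-- The positive and negative parts of `g`, taken as densities and pushed forward by `X`, are finite
measures with the same characteristic function, hence equal. -/
theorem setIntegral_preimage_eq_zero_of_forall_integral_exp_real {Ω : Type*} [MeasurableSpace Ω]
    {P : Measure Ω} {X : Ω → E} (hX : Measurable X) {g : Ω → ℝ} (hg : Integrable g P)
    (h : ∀ t, ∫ ω, (g ω : ℂ) * Complex.exp (⟪X ω, t⟫ * Complex.I) ∂P = 0)
    {B : Set E} (hB : MeasurableSet B) : ∫ ω in X ⁻¹' B, g ω ∂P = 0 := by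
  have hchar : ∀ f : Ω → ℝ, Integrable f P → ∀ t,
      charFun ((P.withDensity fun ω => ENNReal.ofReal (f ω)).map X) t =
        ∫ ω, ((max (f ω) 0 : ℝ) : ℂ) * Complex.exp (⟪X ω, t⟫ * Complex.I) ∂P := fun f hf t => by
    rw [charFun_apply, integral_map (by fun_prop) (by fun_prop),
      integral_withDensity_eq_integral_toReal_smul₀ hf.1.aemeasurable.ennreal_ofReal (by simp)]
    simp only [ENNReal.toReal_ofReal', Complex.real_smul]
  have hfin : ∀ f : Ω → ℝ, Integrable f P →
      IsFiniteMeasure ((P.withDensity fun ω => ENNReal.ofReal (f ω)).map X) := fun f hf => by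
    have := isFiniteMeasure_withDensity_ofReal hf.2
    exact Measure.isFiniteMeasure_map _ _
  have hexp : ∀ f : Ω → ℝ, Integrable f P → ∀ t, Integrable
      (fun ω => ((max (f ω) 0 : ℝ) : ℂ) * Complex.exp (⟪X ω, t⟫ * Complex.I)) P := fun f hf t => by
    refine (Integrable.ofReal hf.pos_part).mul_bdd (c := 1) (by fun_prop) (.of_forall fun ω => ?_)
    rw [Complex.norm_exp_ofReal_mul_I]
  have heq : (P.withDensity fun ω => ENNReal.ofReal (g ω)).map X =
      (P.withDensity fun ω => ENNReal.ofReal (-g ω)).map X := by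
    have := hfin g hg
    have := hfin (fun ω => -g ω) hg.neg
    refine Measure.ext_of_charFun (funext fun t => ?_)
    rw [hchar g hg, hchar (fun ω => -g ω) hg.neg, ← sub_eq_zero,
      ← integral_sub (hexp g hg t) (hexp (fun ω => -g ω) hg.neg t), ← h t]
    refine integral_congr_ae (.of_forall fun ω => ?_)
    simp only [← sub_mul, ← Complex.ofReal_sub]
    rw [show max (g ω) 0 - max (-g ω) 0 = g ω by
      rcases le_total (g ω) 0 with h | h <;> simp [h]]
  rw [integral_eq_lintegral_pos_part_sub_lintegral_neg_part hg.integrableOn,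
    ← withDensity_apply _ (hX hB), ← withDensity_apply _ (hX hB), ← Measure.map_apply hX hB, heq,
    Measure.map_apply hX hB, sub_self]

/-- An integrable function whose Fourier coefficients against `X` vanish has vanishing integral
over every event determined by `X`. -/
theorem setIntegral_preimage_eq_zero_of_forall_integral_exp {Ω : Type*} [MeasurableSpace Ω]
    {P : Measure Ω} {X : Ω → E} (hX : Measurable X) {g : Ω → ℂ} (hg : Integrable g P)
    (h : ∀ t, ∫ ω, g ω * Complex.exp (⟪X ω, t⟫ * Complex.I) ∂P = 0)
    {B : Set E} (hB : MeasurableSet B) : ∫ ω in X ⁻¹' B, g ω ∂P = 0 := by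
  have hexp : ∀ t, Integrable (fun ω => g ω * Complex.exp (⟪X ω, t⟫ * Complex.I)) P := fun t => by
    refine hg.mul_bdd (c := 1) (by fun_prop) (.of_forall fun ω => ?_)
    rw [Complex.norm_exp_ofReal_mul_I]
  have hconj : ∀ t ω, (starRingEnd ℂ) (g ω * Complex.exp (⟪X ω, -t⟫ * Complex.I)) =
      (starRingEnd ℂ) (g ω) * Complex.exp (⟪X ω, t⟫ * Complex.I) := fun t ω => by
    simp [← Complex.exp_conj]
  have h' : ∀ t, ∫ ω, (starRingEnd ℂ) (g ω) * Complex.exp (⟪X ω, t⟫ * Complex.I) ∂P = 0 := by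
    intro t
    simp_rw [← hconj, integral_conj, h, map_zero]
  have hexp' : ∀ t, Integrable
      (fun ω => (starRingEnd ℂ) (g ω) * Complex.exp (⟪X ω, t⟫ * Complex.I)) P := fun t => by
    simp_rw [← hconj]
    exact (Complex.conjCLE : ℂ →L[ℝ] ℂ).integrable_comp (hexp (-t))
  have hre : ∫ ω in X ⁻¹' B, (g ω).re ∂P = 0 := by
    refine setIntegral_preimage_eq_zero_of_forall_integral_exp_real
      (g := fun ω => (g ω).re) hX hg.re (fun t => ?_) hB
    have h1 := integral_add (hexp t) (hexp' t)
    rw [h, h', add_zero] at h1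
    have h2 : ∀ ω, ((g ω).re : ℂ) * Complex.exp (⟪X ω, t⟫ * Complex.I) = (2 : ℂ)⁻¹ *
        (g ω * Complex.exp (⟪X ω, t⟫ * Complex.I)
          + (starRingEnd ℂ) (g ω) * Complex.exp (⟪X ω, t⟫ * Complex.I)) := fun ω => by
      rw [Complex.re_eq_add_conj]
      ring
    simp_rw [h2]
    rw [integral_const_mul, h1, mul_zero]
  have him : ∫ ω in X ⁻¹' B, (g ω).im ∂P = 0 := by
    refine setIntegral_preimage_eq_zero_of_forall_integral_exp_real
      (g := fun ω => (g ω).im) hX hg.im (fun t => ?_) hB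
    have h1 := integral_sub (hexp t) (hexp' t)
    rw [h, h', sub_zero] at h1
    have h2 : ∀ ω, ((g ω).im : ℂ) * Complex.exp (⟪X ω, t⟫ * Complex.I) = (2 * Complex.I)⁻¹ *
        (g ω * Complex.exp (⟪X ω, t⟫ * Complex.I)
          - (starRingEnd ℂ) (g ω) * Complex.exp (⟪X ω, t⟫ * Complex.I)) := fun ω => by
      rw [Complex.im_eq_sub_conj]
      field_simp
    simp_rw [h2]
    rw [integral_const_mul, h1, mul_zero]
  have h3 : (∫ ω in X ⁻¹' B, g ω ∂P).re = 0 := by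
    rw [← hre]
    exact (Complex.reCLM.integral_comp_comm hg.integrableOn).symm
  have h4 : (∫ ω in X ⁻¹' B, g ω ∂P).im = 0 := by
    rw [← him]
    exact (Complex.imCLM.integral_comp_comm hg.integrableOn).symm
  exact Complex.ext h3 h4

/-- Gaussian regularisation of a finite measure in terms of its characteristic function. -/
theorem integral_gaussian_mul_charFun (μ : Measure E) [IsFiniteMeasure μ] {b : ℝ} (hb : 0 < b)
    (ξ₀ : E) :
    ∫ x : E, Complex.exp (-(b : ℂ) * ‖x‖ ^ 2) •
        (Complex.exp (-⟪x, ξ₀⟫ * Complex.I) * charFun μ x) =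
      (((π / b) ^ (finrank ℝ E / 2 : ℝ) * ∫ ξ, Real.exp (-‖ξ - ξ₀‖ ^ 2 / (4 * b)) ∂μ : ℝ) : ℂ) := by
  have h1 : ∀ x : E, Complex.exp (-(b : ℂ) * ‖x‖ ^ 2) •
      (Complex.exp (-⟪x, ξ₀⟫ * Complex.I) * charFun μ x) =
      ∫ ξ, Complex.exp (-(b : ℂ) * ‖x‖ ^ 2 + Complex.I * ⟪ξ - ξ₀, x⟫) ∂μ := fun x => by
    rw [charFun_apply, smul_eq_mul, ← mul_assoc, ← integral_const_mul]
    refine integral_congr_ae (.of_forall fun ξ => ?_)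
    simp only [← Complex.exp_add]
    rw [show ⟪ξ - ξ₀, x⟫ = ⟪ξ, x⟫ - ⟪x, ξ₀⟫ by rw [inner_sub_left, real_inner_comm x ξ₀]]
    congr 1
    push_cast
    ring
  simp_rw [h1]
  rw [integral_integral_swap]
  · have h2 : ∀ ξ : E, ∫ x : E, Complex.exp (-(b : ℂ) * ‖x‖ ^ 2 + Complex.I * ⟪ξ - ξ₀, x⟫) =
        (((π / b) ^ (finrank ℝ E / 2 : ℝ) * Real.exp (-‖ξ - ξ₀‖ ^ 2 / (4 * b)) : ℝ) : ℂ) := by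
      intro ξ
      rw [GaussianFourier.integral_cexp_neg_mul_sq_norm_add (by simpa using hb)]
      rw [Complex.ofReal_mul, Complex.ofReal_cpow (by positivity), Complex.I_sq]
      push_cast
      ring_nf
    simp_rw [h2]
    rw [integral_complex_ofReal, integral_const_mul]
  · have h3 : Integrable (fun p : E × E => Real.exp (-b * ‖p.1‖ ^ 2) * 1)
        (volume.prod μ) := (integrable_exp_neg_mul_norm_sq hb).mul_prod (integrable_const 1)
    refine h3.mono' (by fun_prop) (.of_forall fun ⟨x, ξ⟩ => ?_)
    simp [Function.uncurry, Complex.norm_exp, ← Complex.ofReal_pow]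

/-- A finite measure with integrable characteristic function is absolutely continuous. -/
theorem absolutelyContinuous_of_integrable_charFun (μ : Measure E) [IsFiniteMeasure μ]
    (h : Integrable (charFun μ)) : μ ≪ (volume : Measure E) := by
  set n := finrank ℝ E with hn
  set L := ∫ x, ‖charFun μ x‖ with hL
  set C : ℝ := Real.exp 1 * ((4 * π) ^ (n / 2 : ℝ))⁻¹ * L with hC
  have hL0 : 0 ≤ L := integral_nonneg fun _ => norm_nonneg _
  have hC0 : 0 ≤ C := by positivity
  have hball : ∀ ξ₀ : E, ∀ r : ℝ, 0 < r → μ.real (Metric.closedBall ξ₀ r) ≤ C * r ^ n := by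
    intro ξ₀ r hr
    -- This width makes the Gaussian at least `e^{-1}` on the ball of radius `r`, while its
    -- normalisation is of order `r^{-n}`; the outcome is `μ(ball) ≤ C r^n`.
    have hb : 0 < r ^ 2 / 4 := by positivity
    have h1 := congrArg norm (integral_gaussian_mul_charFun μ hb ξ₀)
    have h2 : ‖∫ x : E, Complex.exp (-((r ^ 2 / 4 : ℝ) : ℂ) * ‖x‖ ^ 2) •
        (Complex.exp (-⟪x, ξ₀⟫ * Complex.I) * charFun μ x)‖ ≤ L := by
      refine (norm_integral_le_integral_norm _).trans (integral_mono_of_nonneg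
        (.of_forall fun _ => norm_nonneg _) h.norm (.of_forall fun x => ?_))
      simp only [norm_smul, norm_mul]
      rw [← Complex.ofReal_neg ⟪x, ξ₀⟫, Complex.norm_exp_ofReal_mul_I, one_mul]
      refine mul_le_of_le_one_left (norm_nonneg _) ?_
      rw [Complex.norm_exp, ← Complex.ofReal_pow, ← Complex.ofReal_neg, ← Complex.ofReal_mul,
        Complex.ofReal_re, Real.exp_le_one_iff]
      nlinarith [sq_nonneg ‖x‖]
    rw [h1, Complex.norm_real, norm_mul, Real.norm_of_nonneg (by positivity),
      Real.norm_of_nonneg (integral_nonneg fun _ => (Real.exp_pos _).le)] at h2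
    have h3 : Real.exp (-1) * μ.real (Metric.closedBall ξ₀ r) ≤
        ∫ ξ, Real.exp (-‖ξ - ξ₀‖ ^ 2 / (4 * (r ^ 2 / 4))) ∂μ := by
      rw [mul_comm, ← smul_eq_mul, ← integral_indicator_const _ measurableSet_closedBall]
      refine integral_mono_of_nonneg (.of_forall fun ξ => Set.indicator_nonneg
        (fun _ _ => (Real.exp_pos _).le) _) ?_ (.of_forall fun ξ => ?_)
      · refine (integrable_const (1 : ℝ)).mono' (by fun_prop) (.of_forall fun ξ => ?_)
        rw [Real.norm_of_nonneg (Real.exp_pos _).le, Real.exp_le_one_iff]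
        exact div_nonpos_of_nonpos_of_nonneg (by nlinarith [sq_nonneg ‖ξ - ξ₀‖]) (by positivity)
      · revert ξ
        refine Set.indicator_le' (fun ξ hξ => ?_) (fun ξ _ => (Real.exp_pos _).le)
        rw [Metric.mem_closedBall, dist_eq_norm] at hξ
        have h9 : ‖ξ - ξ₀‖ ^ 2 ≤ r ^ 2 := by gcongr
        refine Real.exp_le_exp.2 ?_
        rw [le_div_iff₀ (by positivity)]
        linarith
    have h4 : (π / (r ^ 2 / 4)) ^ (n / 2 : ℝ) = (4 * π) ^ (n / 2 : ℝ) * (r ^ n)⁻¹ := by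
      rw [show π / (r ^ 2 / 4) = 4 * π * (r ^ 2)⁻¹ by field_simp,
        Real.mul_rpow (by positivity) (by positivity), Real.inv_rpow (by positivity),
        ← Real.rpow_natCast r 2, ← Real.rpow_mul hr.le, ← Real.rpow_natCast r n]
      congr 3
      push_cast
      ring
    rw [h4] at h2
    have h5 : 0 < (4 * π) ^ (n / 2 : ℝ) := by positivity
    have h6 : 0 < r ^ n := by positivity
    have h7 := (mul_le_mul_of_nonneg_left h3 (by positivity : 0 ≤ (4 * π) ^ (n / 2 : ℝ) *
      (r ^ n)⁻¹)).trans h2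
    rw [Real.exp_neg] at h7
    rw [hC]
    have h8 := Real.exp_pos 1
    field_simp at h7 ⊢
    linarith
  set V : ℝ := (volume : Measure E).real (Metric.ball (0 : E) 1) with hV
  have hV0 : 0 < V := ENNReal.toReal_pos
    (Metric.measure_ball_pos _ _ one_pos).ne' measure_ball_lt_top.ne
  have hball' : ∀ ξ₀ : E, ∀ r : ℝ, 0 < r → μ (Metric.closedBall ξ₀ r) ≤
      ENNReal.ofReal (C / V) * volume (Metric.closedBall ξ₀ r) := by
    intro ξ₀ r hr
    rw [Measure.addHaar_closedBall volume _ hr.le,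
      ← ofReal_measureReal (μ := volume) (measure_ball_lt_top.ne), ← ofReal_measureReal (measure_ne_top μ _), ← ENNReal.ofReal_mul (by positivity),
      ← ENNReal.ofReal_mul (by positivity)]
    refine ENNReal.ofReal_le_ofReal ((hball ξ₀ r hr).trans (le_of_eq ?_))
    rw [← hV, ← hn]
    field_simp
  refine fun s hs => ?_
  by_contra hne
  -- A null set has a countable cover by closed balls of total volume at most `ε` (Besicovitch), so
  -- the bound on balls passes to it.
  have hε : ∀ ε : ℝ≥0∞, ε ≠ 0 → μ s ≤ ENNReal.ofReal (C / V) * ε := fun ε hε => by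
    obtain ⟨t, r, htc, -, hr, hcov, hsum⟩ := Besicovitch.exists_closedBall_covering_tsum_measure_le
      (volume : Measure E) hε (fun _ => Set.Ioi 0) s
      (fun x _ δ hδ => ⟨δ / 2, by simp [half_pos hδ], by simp [half_pos hδ], half_lt_self hδ⟩)
    have := htc.to_subtype
    calc μ s ≤ μ (⋃ x ∈ t, Metric.closedBall x (r x)) := measure_mono hcov
      _ ≤ ∑' x : t, μ (Metric.closedBall (x : E) (r x)) := measure_biUnion_le _ htc _
      _ ≤ ∑' x : t, ENNReal.ofReal (C / V) * volume (Metric.closedBall (x : E) (r x)) :=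
          ENNReal.tsum_le_tsum fun x => hball' _ _ (hr x x.2)
      _ ≤ _ := by
          rw [ENNReal.tsum_mul_left]
          refine mul_le_mul_right ?_ _
          rwa [hs, zero_add] at hsum
  have h9 : Tendsto (fun ε : ℝ≥0∞ => ENNReal.ofReal (C / V) * ε) (𝓝[≠] 0) (𝓝 0) := by
    have := ENNReal.Tendsto.const_mul (a := ENNReal.ofReal (C / V)) (tendsto_id (α := ℝ≥0∞)
      |>.mono_left (nhdsWithin_le_nhds (a := (0 : ℝ≥0∞)) (s := {0}ᶜ)))
      (Or.inr ENNReal.ofReal_ne_top)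
    simpa using this
  refine hne (le_antisymm (ge_of_tendsto h9 ?_) bot_le)
  filter_upwards [self_mem_nhdsWithin] with ε h using hε ε h

/-- A single term of the exponential series, of order one more than the dimension, already dominates
the integrable power of `1 + ‖x‖`. -/
theorem integrable_exp_neg_mul_norm {c : ℝ} (hc : 0 < c) :
    Integrable fun x : E => Real.exp (-c * ‖x‖) := by
  set m := finrank ℝ E + 1 with hm
  have h1 := (integrable_one_add_norm (E := E) (μ := volume) (r := m)
    (by rw [hm]; push_cast; linarith)).const_mul (m.factorial / c ^ m * Real.exp c)
  refine h1.mono' (by fun_prop) (.of_forall fun x => ?_)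
  have h2 := Real.pow_div_factorial_le_exp (c * (1 + ‖x‖)) (by positivity) m
  rw [Real.norm_of_nonneg (Real.exp_pos _).le, Real.rpow_neg (by positivity), Real.rpow_natCast,
    ← div_eq_mul_inv, le_div_iff₀ (by positivity), div_mul_eq_mul_div, le_div_iff₀ (by positivity)]
  rw [div_le_iff₀ (by positivity), mul_pow] at h2
  calc Real.exp (-c * ‖x‖) * (1 + ‖x‖) ^ m * c ^ m
      = Real.exp (-c * ‖x‖) * (c ^ m * (1 + ‖x‖) ^ m) := by ring
    _ ≤ Real.exp (-c * ‖x‖) * (Real.exp (c * (1 + ‖x‖)) * m.factorial) := by gcongr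
    _ = m.factorial * Real.exp c := by
        rw [← mul_assoc, ← Real.exp_add, mul_comm]
        congr 2
        ring

/-- Regularise by a Gaussian of parameter `1/c`: the integral becomes `c^{n/2}` times a Gaussian
average against `μ`. The mass of `μ` stays at distance `r` from `ξ₀`, so the average is `O(e^{-c
r²/4})`, which beats the power as `c → ∞`. -/
theorem fourierIntegral_charFun_eq_zero (μ : Measure E) [IsFiniteMeasure μ]
    (hi : Integrable (charFun μ)) {ξ₀ : E} {r : ℝ} (hr : 0 < r)
    (h : μ (Metric.ball ξ₀ r) = 0) :
    ∫ x : E, Complex.exp (-⟪x, ξ₀⟫ * Complex.I) * charFun μ x = 0 := by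
  have hi' : Integrable fun x : E => Complex.exp (-⟪x, ξ₀⟫ * Complex.I) * charFun μ x := by
    refine hi.bdd_mul (c := 1) (by fun_prop) (.of_forall fun x => ?_)
    rw [← Complex.ofReal_neg, Complex.norm_exp_ofReal_mul_I]
  refine tendsto_nhds_unique (Real.tendsto_integral_cexp_sq_smul hi') ?_
  set n := finrank ℝ E with hn
  have h0 : Tendsto (fun c : ℝ => π ^ (n / 2 : ℝ) * μ.real Set.univ *
      (c ^ (n / 2 : ℝ) * Real.exp (-(r ^ 2 / 4) * c))) atTop (𝓝 0) := by
    simpa using (tendsto_rpow_mul_exp_neg_mul_atTop_nhds_zero (n / 2 : ℝ) (r ^ 2 / 4)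
      (by positivity)).const_mul (π ^ (n / 2 : ℝ) * μ.real Set.univ)
  refine squeeze_zero_norm' ?_ h0
  filter_upwards [eventually_gt_atTop (0 : ℝ)] with c hc
  have h1 := integral_gaussian_mul_charFun μ (inv_pos.2 hc) ξ₀
  rw [h1, Complex.norm_real, norm_mul, Real.norm_of_nonneg (by positivity),
    Real.norm_of_nonneg (integral_nonneg fun _ => (Real.exp_pos _).le), div_inv_eq_mul,
    Real.mul_rpow (by positivity) hc.le, ← hn]
  have h2 : ∫ ξ, Real.exp (-‖ξ - ξ₀‖ ^ 2 / (4 * c⁻¹)) ∂μ ≤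
      ∫ ξ, Real.exp (-(r ^ 2 / 4) * c) ∂μ := by
    refine integral_mono_of_nonneg (.of_forall fun _ => (Real.exp_pos _).le)
      (integrable_const _) ?_
    have h3 : ∀ᵐ ξ ∂μ, ξ ∉ Metric.ball ξ₀ r := measure_eq_zero_iff_ae_notMem.1 h
    filter_upwards [h3] with ξ hξ
    rw [Metric.mem_ball, dist_eq_norm, not_lt] at hξ
    have h4 : r ^ 2 ≤ ‖ξ - ξ₀‖ ^ 2 := by gcongr
    refine Real.exp_le_exp.2 ?_
    rw [div_le_iff₀ (by positivity)]
    field_simp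
    linarith
  rw [integral_const, smul_eq_mul] at h2
  calc _ ≤ π ^ (n / 2 : ℝ) * c ^ (n / 2 : ℝ) * (μ.real Set.univ * Real.exp (-(r ^ 2 / 4) * c)) := by
        gcongr
    _ = _ := by ring

/-- A nonzero finite measure whose characteristic function decays exponentially charges every
ball. -/
theorem measure_ball_ne_zero_of_exponentialDecay (μ : Measure E) [IsFiniteMeasure μ] (hμ : μ ≠ 0)
    {K : ℝ} (hK : 0 < K) (hdec : ∀ x, ‖charFun μ x‖ ≤ K * Real.exp (-(1 / K) * ‖x‖))
    (ξ₀ : E) {r : ℝ} (hr : 0 < r) : μ (Metric.ball ξ₀ r) ≠ 0 := by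
  intro hz
  have hi : Integrable (charFun μ) :=
    ((integrable_exp_neg_mul_norm (E := E) (c := 1 / K) (by positivity)).const_mul K).mono'
      (measurable_charFun).aestronglyMeasurable (.of_forall hdec)
  have hball : ∀ ξ ∈ Metric.ball ξ₀ r,
      ∫ x : E, Complex.exp (-⟪x, ξ⟫ * Complex.I) * charFun μ x = 0 := fun ξ hξ => by
    refine fourierIntegral_charFun_eq_zero μ hi (sub_pos.2 (Metric.mem_ball.1 hξ)) ?_
    exact measure_mono_null (Metric.ball_subset_ball' (by linarith)) hz
  have hall : ∀ v : E, ∫ x : E, Complex.exp (-⟪x, ξ₀ + v⟫ * Complex.I) * charFun μ x = 0 := by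
    intro v
    -- In the strip `|Im z| < δ` the complexified character grows at most like `e^{‖x‖/(2K)}`, half
    -- the decay rate of the characteristic function. Hence the integral is holomorphic there.
    set δ : ℝ := 1 / (2 * K * (‖v‖ + 1)) with hδ
    have hδ0 : 0 < δ := by positivity
    let g : ℂ → E → ℂ := fun z x =>
      Complex.exp (-(⟪x, ξ₀⟫ + z * ⟪x, v⟫) * Complex.I) * charFun μ x
    let g' : ℂ → E → ℂ := fun z x =>
      (-⟪x, v⟫ * Complex.I) * (Complex.exp (-(⟪x, ξ₀⟫ + z * ⟪x, v⟫) * Complex.I) * charFun μ x)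
    let S : Set ℂ := {z | |z.im| < δ}
    have hSo : IsOpen S := isOpen_lt (by fun_prop) continuous_const
    have hSc : IsPreconnected S := by
      have : S = Complex.im ⁻¹' Set.Ioo (-δ) δ := by
        ext z
        simp [S, abs_lt]
      rw [this]
      exact ((convex_Ioo (-δ) δ).linear_preimage Complex.imLm).isPreconnected
    have hexp : ∀ z ∈ S, ∀ x : E, ‖Complex.exp (-(⟪x, ξ₀⟫ + z * ⟪x, v⟫) * Complex.I)‖ ≤
        Real.exp (1 / (2 * K) * ‖x‖) := fun z hz x => by
      rw [Complex.norm_exp]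
      refine Real.exp_le_exp.2 ?_
      have h1 : (-(⟪x, ξ₀⟫ + z * ⟪x, v⟫) * Complex.I : ℂ).re = z.im * ⟪x, v⟫ := by
        simp
      rw [h1]
      calc z.im * ⟪x, v⟫ ≤ |z.im| * |⟪x, v⟫| := by
            rw [← abs_mul]
            exact le_abs_self _
        _ ≤ δ * (‖x‖ * (‖v‖ + 1)) := by
            gcongr
            · exact (show |z.im| < δ from hz).le
            · refine (abs_real_inner_le_norm x v).trans ?_
              gcongr
              linarith
        _ = 1 / (2 * K) * ‖x‖ := by
            rw [hδ]
            have := norm_nonneg v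
            field_simp
    have hgb : ∀ z ∈ S, ∀ x, ‖g z x‖ ≤ K * Real.exp (-(1 / (2 * K)) * ‖x‖) := fun z hz x => by
      rw [norm_mul]
      calc _ ≤ Real.exp (1 / (2 * K) * ‖x‖) * (K * Real.exp (-(1 / K) * ‖x‖)) := by
            gcongr
            · exact hexp z hz x
            · exact hdec x
        _ = _ := by
            rw [mul_left_comm, ← Real.exp_add]
            congr 2
            field_simp
            ring
    have hgm : ∀ z, AEStronglyMeasurable (g z) := fun z => by
      refine AEStronglyMeasurable.mul (by fun_prop) ?_
      exact measurable_charFun.aestronglyMeasurable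
    have hderiv : ∀ z ∈ S, HasDerivAt (fun z => ∫ x, g z x) (∫ x, g' z x) z := fun z hz => by
      refine (hasDerivAt_integral_of_dominated_loc_of_deriv_le (F := g) (F' := g') (s := S)
        (bound := fun x => ‖v‖ * (4 * K * K) * Real.exp (-(1 / (4 * K)) * ‖x‖)) (hSo.mem_nhds hz)
        (.of_forall hgm) ?_ ?_ (.of_forall fun x z hz => ?_) ?_ (.of_forall fun x z _ => ?_)).2
      · exact ((integrable_exp_neg_mul_norm (E := E) (c := 1 / (2 * K)) (by positivity)).const_mul
          K).mono' (hgm z) (.of_forall (hgb z hz))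
      · exact AEStronglyMeasurable.mul (by fun_prop) (hgm z)
      · rw [norm_mul]
        have h1 : ‖(-⟪x, v⟫ * Complex.I : ℂ)‖ ≤ ‖x‖ * ‖v‖ := by
          rw [norm_mul, norm_neg, Complex.norm_I, mul_one, Complex.norm_real]
          exact abs_real_inner_le_norm x v
        have h2 : ‖x‖ ≤ 4 * K * Real.exp (1 / (4 * K) * ‖x‖) := by
          have := Real.add_one_le_exp (1 / (4 * K) * ‖x‖)
          have h3 : ‖x‖ = 4 * K * (1 / (4 * K) * ‖x‖) := by field_simp
          calc ‖x‖ = 4 * K * (1 / (4 * K) * ‖x‖) := h3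
            _ ≤ _ := by gcongr; linarith
        calc _ ≤ (4 * K * Real.exp (1 / (4 * K) * ‖x‖) * ‖v‖) *
              (K * Real.exp (-(1 / (2 * K)) * ‖x‖)) := by
              refine mul_le_mul (h1.trans ?_) (hgb z hz x) (norm_nonneg _) (by positivity)
              gcongr
          _ = ‖v‖ * (4 * K * K) * (Real.exp (1 / (4 * K) * ‖x‖)
              * Real.exp (-(1 / (2 * K)) * ‖x‖)) := by ring
          _ = _ := by
              rw [← Real.exp_add]
              congr 2
              field_simp
              ring
      · exact (integrable_exp_neg_mul_norm (E := E) (by positivity)).const_mul _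
      · have h1 : HasDerivAt (fun z : ℂ => -(⟪x, ξ₀⟫ + z * ⟪x, v⟫) * Complex.I)
            (-⟪x, v⟫ * Complex.I) z := by
          have := (((hasDerivAt_id z).mul_const (⟪x, v⟫ : ℂ)).const_add
            (⟪x, ξ₀⟫ : ℂ)).neg.mul_const Complex.I
          simpa using this
        have h2 := (h1.cexp).mul_const (charFun μ x)
        refine h2.congr_deriv ?_
        change _ = (-⟪x, v⟫ * Complex.I) * (_ * _)
        ring
    have han : AnalyticOnNhd ℂ (fun z => ∫ x, g z x) S :=
      DifferentiableOn.analyticOnNhd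
        (fun z hz => (hderiv z hz).differentiableAt.differentiableWithinAt) hSo
    have hreal : ∀ s : ℝ, ∫ x, g s x =
        ∫ x : E, Complex.exp (-⟪x, ξ₀ + s • v⟫ * Complex.I) * charFun μ x := fun s => by
      refine integral_congr_ae (.of_forall fun x => ?_)
      simp only [g, inner_add_right, inner_smul_right]
      push_cast
      rfl
    have hev : ∀ᶠ s : ℝ in 𝓝 0, ξ₀ + s • v ∈ Metric.ball ξ₀ r := by
      have : Tendsto (fun s : ℝ => ξ₀ + s • v) (𝓝 0) (𝓝 (ξ₀ + (0 : ℝ) • v)) :=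
        Continuous.tendsto (by fun_prop) 0
      rw [zero_smul, add_zero] at this
      exact this (Metric.ball_mem_nhds ξ₀ hr)
    -- Small real parameters stay inside the original ball, where the integral vanishes. The
    -- identity theorem carries this to parameter `1`, that is, to the arbitrary point `ξ₀ + v`.
    have hfreq : ∃ᶠ z in 𝓝[≠] (0 : ℂ), ∫ x, g z x = 0 := by
      have h1 : Tendsto (fun s : ℝ => (s : ℂ)) (𝓝[≠] 0) (𝓝[≠] (0 : ℂ)) := by
        refine tendsto_nhdsWithin_iff.2 ⟨?_, ?_⟩
        · exact (Complex.continuous_ofReal.tendsto' 0 0 (by simp)).mono_left nhdsWithin_le_nhds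
        · filter_upwards [self_mem_nhdsWithin] with s hs
          simpa using hs
      refine h1.frequently (Eventually.frequently ?_)
      filter_upwards [nhdsWithin_le_nhds hev] with s hs
      rw [hreal]
      exact hball _ hs
    have hzero := han.eqOn_zero_of_preconnected_of_frequently_eq_zero hSc
      (show (0 : ℂ) ∈ S by simpa [S] using hδ0) hfreq (show ((1 : ℝ) : ℂ) ∈ S by simpa [S] using hδ0)
    simp only [Pi.zero_apply] at hzero
    rw [hreal] at hzero
    simpa using hzero
  have hft : 𝓕 (charFun μ) = 0 := by
    ext w
    rw [Real.fourier_eq', Pi.zero_apply, ← hall ((2 * π) • w - ξ₀)]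
    refine integral_congr_ae (.of_forall fun x => ?_)
    simp only [add_sub_cancel, inner_smul_right, smul_eq_mul]
    push_cast
    ring_nf
  have hinv := Continuous.fourierInv_fourier_eq (f := charFun μ) continuous_charFun hi
    (by rw [hft]; exact integrable_zero _ _ _)
  have h0 : charFun μ 0 = 0 := by
    rw [← hinv, hft, Real.fourierInv_eq']
    simp
  rw [charFun_zero] at h0
  have := (measureReal_eq_zero_iff (measure_ne_top μ _)).1 (by exact_mod_cast h0)
  exact hμ (Measure.measure_univ_eq_zero.1 this)

end CharacteristicFunctions

end StationarySpectrum

namespace StationarySpectrum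

/-! ### Closed subgroups of Euclidean space and their annihilators -/

section ClosedSubgroups

open Module
open scoped RealInnerProductSpace

variable {E : Type*} [NormedAddCommGroup E] [InnerProductSpace ℝ E] [FiniteDimensional ℝ E]

/-- A closed subgroup containing arbitrarily short nonzero vectors contains a line. -/
theorem exists_line_of_not_discrete {L : AddSubgroup E} (hL : IsClosed (L : Set E))
    (h : ∀ ε > 0, ∃ x ∈ L, x ≠ 0 ∧ ‖x‖ < ε) : ∃ u : E, u ≠ 0 ∧ ∀ t : ℝ, t • u ∈ L := by
  choose! x hxL hx0 hxε using h
  let y : ℕ → E := fun n => x (1 / ((n : ℝ) + 1))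
  have hpos : ∀ n : ℕ, (0 : ℝ) < 1 / ((n : ℝ) + 1) := fun n => by positivity
  have hy0 : ∀ n, y n ≠ 0 := fun n => hx0 _ (hpos n)
  have hylim : Tendsto (fun n => ‖y n‖) atTop (𝓝 0) :=
    squeeze_zero (fun n => norm_nonneg _) (fun n => (hxε _ (hpos n)).le)
      tendsto_one_div_add_atTop_nhds_zero_nat
  obtain ⟨u, hu, φ, hφ, hlim⟩ := (isCompact_sphere (0 : E) 1).tendsto_subseq
    (x := fun n => ‖y n‖⁻¹ • y n) fun n => by
      simp [norm_smul, inv_mul_cancel₀ (norm_ne_zero_iff.2 (hy0 n))]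
  refine ⟨u, fun h0 => by simp [h0] at hu, fun t => ?_⟩
  -- Integer multiples of shorter and shorter vectors pointing nearly along `u` approximate `t • u`,
  -- with error at most the length of the vector used.
  have h1 : Tendsto (fun n => (⌊t / ‖y (φ n)‖⌋ : ℝ) * ‖y (φ n)‖) atTop (𝓝 t) := by
    rw [tendsto_iff_norm_sub_tendsto_zero]
    refine squeeze_zero (fun n => norm_nonneg _) (fun n => ?_) (hylim.comp hφ.tendsto_atTop)
    have hp : 0 < ‖y (φ n)‖ := norm_pos_iff.2 (hy0 _)
    have h2 := Int.floor_le (t / ‖y (φ n)‖)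
    have h3 := Int.lt_floor_add_one (t / ‖y (φ n)‖)
    rw [le_div_iff₀ hp] at h2
    rw [div_lt_iff₀ hp] at h3
    rw [Real.norm_eq_abs, abs_le]
    constructor <;> simp only [Function.comp_apply] <;> linarith
  refine hL.mem_of_tendsto (h1.smul hlim) (.of_forall fun n => ?_)
  have hp : ‖y (φ n)‖ ≠ 0 := norm_ne_zero_iff.2 (hy0 _)
  have : ((⌊t / ‖y (φ n)‖⌋ : ℝ) * ‖y (φ n)‖) • (fun n => ‖y n‖⁻¹ • y n) (φ n) =
      ⌊t / ‖y (φ n)‖⌋ • y (φ n) := by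
    simp only [smul_smul, mul_assoc, mul_inv_cancel₀ hp, mul_one, Int.cast_smul_eq_zsmul]
  simp only [Function.comp_apply]
  rw [this]
  exact L.zsmul_mem (hxL _ (hpos _)) _

/-- A closed proper subgroup of a Euclidean space has a nontrivial annihilator. -/
theorem exists_annihilator_of_closed_ne_top {L : AddSubgroup E} (hL : IsClosed (L : Set E))
    (hne : L ≠ ⊤) : ∃ v : E, v ≠ 0 ∧ ∀ x ∈ L, ∃ n : ℤ, ⟪v, x⟫ = n := by
  -- `W` is the largest linear subspace inside `L`. On its orthogonal complement the remaining part
  -- of `L` is discrete, because a line there would already lie in `W`.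
  let W : Submodule ℝ E :=
    { carrier := {w | ∀ t : ℝ, t • w ∈ L}
      add_mem' := fun {a b} ha hb t => by
        rw [smul_add]
        exact L.add_mem (ha t) (hb t)
      zero_mem' := fun t => by
        rw [smul_zero]
        exact L.zero_mem
      smul_mem' := fun c x hx t => by
        rw [smul_smul]
        exact hx _ }
  have hWL : ∀ w ∈ W, w ∈ L := fun w hw => by simpa using hw 1
  let M : AddSubgroup Wᗮ := L.comap (Wᗮ.subtype : Wᗮ →+ E)
  have hMc : IsClosed (M : Set Wᗮ) := hL.preimage continuous_subtype_val
  have hproj : ∀ x ∈ L, ∀ v : Wᗮ, ∃ m : Wᗮ, m ∈ M ∧ ⟪(v : E), x⟫ = ⟪v, m⟫ := fun x hx v => by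
    obtain ⟨a, ha, b, hb, rfl⟩ := W.exists_add_mem_mem_orthogonal x
    refine ⟨⟨b, hb⟩, ?_, ?_⟩
    · change b ∈ L
      have := L.sub_mem hx (hWL a ha)
      rwa [add_sub_cancel_left] at this
    · rw [inner_add_right, (Submodule.mem_orthogonal' W _).1 v.2 a ha, zero_add]
      rfl
  have hdisc : ∃ ε > 0, ∀ x ∈ M, ‖x‖ < ε → x = 0 := by
    by_contra! hcon
    obtain ⟨u, hu, hline⟩ := exists_line_of_not_discrete hMc
      (fun ε hε => let ⟨x, h1, h2, h3⟩ := hcon ε hε; ⟨x, h1, h3, h2⟩)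
    have h1 : (u : E) ∈ W := fun t => hline t
    refine hu (Subtype.ext ?_)
    exact inner_self_eq_zero.1 ((Submodule.mem_orthogonal W _).1 u.2 _ h1)
  let N : Submodule ℤ Wᗮ := M.toIntSubmodule
  have hNd : DiscreteTopology N := by
    obtain ⟨ε, hε, hdisc⟩ := hdisc
    refine DiscreteTopology.of_forall_le_dist hε fun x y hxy => ?_
    by_contra! hlt
    refine hxy (Subtype.ext (sub_eq_zero.1 (hdisc _ (M.sub_mem x.2 y.2) ?_)))
    rwa [← dist_eq_norm]
  -- If the discrete part spans, it is a lattice and a vector of the dual basis takes integer values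
  -- on it; if not, any nonzero vector orthogonal to its span works, with value `0`.
  by_cases hspan : Submodule.span ℝ (N : Set Wᗮ) = ⊤
  · have hZ : IsZLattice ℝ N := ⟨hspan⟩
    let b := (Module.Free.chooseBasis ℤ N).ofZLatticeBasis ℝ N
    have hWtop : W ≠ ⊤ := fun h => hne (by
      rw [eq_top_iff]
      exact fun x _ => hWL x (h ▸ Submodule.mem_top))
    have hnt : Nontrivial Wᗮ := by
      rw [Submodule.nontrivial_iff_ne_bot]
      exact fun h => hWtop (Submodule.orthogonal_eq_bot_iff.1 h)
    obtain ⟨i⟩ : Nonempty (Module.Free.ChooseBasisIndex ℤ N) := b.index_nonempty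
    let v : Wᗮ := (InnerProductSpace.toDual ℝ Wᗮ).symm (LinearMap.toContinuousLinearMap (b.coord i))
    have hv : ∀ x, ⟪v, x⟫ = b.repr x i := fun x => by
      rw [InnerProductSpace.toDual_symm_apply]
      rfl
    refine ⟨v, fun h0 => ?_, fun x hx => ?_⟩
    · have h1 := hv (b i)
      have h2 : v = 0 := Subtype.ext h0
      rw [h2, inner_zero_left] at h1
      simp at h1
    · obtain ⟨m, hm, hxm⟩ := hproj x hx v
      refine ⟨(Module.Free.chooseBasis ℤ N).repr ⟨m, hm⟩ i, ?_⟩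
      rw [hxm, hv]
      exact (Module.Free.chooseBasis ℤ N).ofZLatticeBasis_repr_apply ℝ N ⟨m, hm⟩ i
  · have h1 : (Submodule.span ℝ (N : Set Wᗮ))ᗮ ≠ ⊥ :=
      fun h => hspan (Submodule.orthogonal_eq_bot_iff.1 h)
    obtain ⟨v, hv, hv0⟩ := Submodule.exists_mem_ne_zero_of_ne_bot h1
    refine ⟨v, fun h => hv0 (Subtype.ext h), fun x hx => ⟨0, ?_⟩⟩
    obtain ⟨m, hm, hxm⟩ := hproj x hx v
    rw [hxm, (Submodule.mem_orthogonal' _ _).1 hv m (Submodule.subset_span hm), Int.cast_zero]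

end ClosedSubgroups

/-! ### The dispersion relation and Lebesgue-null sets -/

section PolynomialImage

open Module

variable {E : Type*} [NormedAddCommGroup E] [InnerProductSpace ℝ E] [FiniteDimensional ℝ E]
  [MeasurableSpace E] [BorelSpace E] [Nontrivial E]

/-- In polar coordinates the indicator of the preimage integrates to a radial integral over the null
set `N`. -/
theorem volume_preimage_norm_eq_zero {N : Set ℝ} (h : volume N = 0) :
    (volume : Measure E) ((fun x => ‖x‖) ⁻¹' N) = 0 := by
  let f : ℝ → ℝ := N.indicator 1
  have hf : f =ᵐ[volume] 0 := indicator_meas_zero h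
  have h1 : (fun y : ℝ => y ^ (finrank ℝ E - 1) • f y) =ᵐ[volume] 0 := by
    filter_upwards [hf] with y hy
    simp [hy]
  have h2 : Integrable (fun x : E => f ‖x‖) :=
    (integrable_fun_norm_addHaar (volume : Measure E)).2
      (((integrable_zero _ _ _).congr h1.symm).integrableOn)
  have h3 : ∫ x : E, f ‖x‖ = 0 := by
    rw [integral_fun_norm_addHaar, setIntegral_congr_ae (g := fun _ => (0 : ℝ)) measurableSet_Ioi]
    · simp
    · filter_upwards [h1] with y hy _ using hy
  have h4 := (integral_eq_zero_iff_of_nonneg_ae (.of_forall fun x =>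
    Set.indicator_nonneg (fun _ _ => zero_le_one) _) h2).1 h3
  rw [measure_eq_zero_iff_ae_notMem]
  filter_upwards [h4] with x hx hxN
  have h5 : f ‖x‖ = 1 := Set.indicator_of_mem (show ‖x‖ ∈ N from hxN) _
  exact one_ne_zero (h5.symm.trans hx)

/-- The dispersion relation `ξ ↦ |ξ + k|² - |k|²` pushes Lebesgue measure to an absolutely
continuous measure. -/
theorem volume_preimage_dispersion_eq_zero (k : E) {N : Set ℝ} (hN : MeasurableSet N)
    (h : volume N = 0) :
    (volume : Measure E) ((fun x => ‖x + k‖ ^ 2 - ‖k‖ ^ 2) ⁻¹' N) = 0 := by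
  let N' : Set ℝ := (fun r => r ^ 2 - ‖k‖ ^ 2) ⁻¹' N ∩ Set.Ici 0
  have hN' : MeasurableSet N' := (hN.preimage (by fun_prop)).inter measurableSet_Ici
  have h1 : volume N' = 0 := by
    -- The admissible radii are square roots of a translate of `N`; `√` is differentiable away from
    -- `0` and therefore preserves null sets, so the radius `0` is split off.
    have h2 : N' ⊆ {0} ∪ Real.sqrt '' (((fun s => s - ‖k‖ ^ 2) ⁻¹' N) ∩ Set.Ioi 0) := by
      rintro r ⟨hr, hr0 : 0 ≤ r⟩
      rcases hr0.eq_or_lt with rfl | hr0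
      · exact Or.inl rfl
      · exact Or.inr ⟨r ^ 2, ⟨hr, by simpa using pow_pos hr0 2⟩, Real.sqrt_sq hr0.le⟩
    refine measure_mono_null h2 (measure_union_null (by simp) ?_)
    refine addHaar_image_eq_zero_of_differentiableOn_of_addHaar_eq_zero volume
      (fun x hx => (Real.hasDerivAt_sqrt (ne_of_gt hx.2)).differentiableAt.differentiableWithinAt)
      (measure_mono_null Set.inter_subset_left ?_)
    have := (measurePreserving_sub_right (volume : Measure ℝ) (‖k‖ ^ 2)).measure_preimage
      hN.nullMeasurableSet
    rw [this, h]
  have h2 := volume_preimage_norm_eq_zero (E := E) h1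
  have h3 := (measurePreserving_add_right (volume : Measure E) k).measure_preimage
      (hN'.preimage (measurable_norm (α := E))).nullMeasurableSet
  refine measure_mono_null (fun x hx => ?_) (h3.trans h2)
  exact ⟨hx, norm_nonneg _⟩

end PolynomialImage

/-! ### Uniqueness for the Stieltjes transform -/

section Stieltjes

/-- A finite measure on the line is determined by its Stieltjes transform. -/
theorem Measure.ext_of_stieltjes {μ ν : Measure ℝ} [IsFiniteMeasure μ] [IsFiniteMeasure ν]
    (h : ∀ z : ℂ, z.im ≠ 0 → ∫ t : ℝ, ((t : ℂ) - z)⁻¹ ∂μ = ∫ t : ℝ, ((t : ℂ) - z)⁻¹ ∂ν) :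
    μ = ν := by
  have him : ∀ x y t : ℝ, (((t : ℂ) - (x + y * Complex.I))⁻¹).im = y * ((x - t) ^ 2 + y ^ 2)⁻¹ := by
    intro x y t
    rw [Complex.inv_im, Complex.normSq_apply]
    simp only [Complex.sub_im, Complex.ofReal_im, Complex.add_im, Complex.mul_im, Complex.I_im,
      Complex.I_re, Complex.sub_re, Complex.add_re, Complex.ofReal_re, Complex.mul_re]
    rw [div_eq_mul_inv]
    ring_nf
  -- The imaginary part of the transform at `x + iγ`, divided by `π`, is the density at `x` of the
  -- measure convolved with a Cauchy law of scale `γ`.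
  have hpdf : ∀ (γ : NNReal), γ ≠ 0 → ∀ (m : Measure ℝ) [IsFiniteMeasure m], ∀ x : ℝ,
      ∫⁻ t, cauchyPDF 0 γ (x - t) ∂m = ENNReal.ofReal
        (Real.pi⁻¹ * (∫ t : ℝ, ((t : ℂ) - (x + (γ : ℝ) * Complex.I))⁻¹ ∂m).im) := by
    intro γ hγ m _ x
    have hγ' : (0 : ℝ) < γ := by positivity
    have hint : Integrable (fun t : ℝ => ((t : ℂ) - (x + (γ : ℝ) * Complex.I))⁻¹) m := by
      refine (integrable_const ((γ : ℝ)⁻¹)).mono' (by fun_prop) (.of_forall fun t => ?_)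
      rw [norm_inv]
      refine inv_anti₀ hγ' ?_
      refine le_trans (le_of_eq ?_) (Complex.abs_im_le_norm _)
      simp
    have h1 : ∀ t, cauchyPDFReal 0 γ (x - t) =
        Real.pi⁻¹ * (((t : ℂ) - (x + (γ : ℝ) * Complex.I))⁻¹).im := fun t => by
      rw [him, cauchyPDFReal_def]
      ring_nf
    have h2 : (∫ t : ℝ, ((t : ℂ) - (x + (γ : ℝ) * Complex.I))⁻¹ ∂m).im =
        ∫ t : ℝ, (((t : ℂ) - (x + (γ : ℝ) * Complex.I))⁻¹).im ∂m :=
      (Complex.imCLM.integral_comp_comm hint).symm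
    rw [h2, ← integral_const_mul]
    simp_rw [← h1, cauchyPDF]
    rw [ofReal_integral_eq_lintegral_ofReal _
      (.of_forall fun t => (cauchyPDF_pos 0 hγ (x - t)).le)]
    simp_rw [h1]
    exact hint.im.const_mul _
  have hconv : ∀ (γ : NNReal), γ ≠ 0 → ∀ (m : Measure ℝ) [IsFiniteMeasure m], ∀ A : Set ℝ,
      MeasurableSet A → (m.conv (cauchyMeasure 0 γ)) A =
        ∫⁻ x, (∫⁻ t, cauchyPDF 0 γ (x - t) ∂m) * A.indicator 1 x := by
    intro γ hγ m _ A hA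
    have hm : Measurable (A.indicator (1 : ℝ → ℝ≥0∞)) := measurable_one.indicator hA
    rw [← lintegral_indicator_one hA, Measure.lintegral_conv hm,
      cauchyMeasure_of_scale_ne_zero 0 hγ]
    have h1 : ∀ x : ℝ, ∫⁻ y, A.indicator 1 (x + y) ∂(volume.withDensity (cauchyPDF 0 γ)) =
        ∫⁻ z, cauchyPDF 0 γ (z - x) * A.indicator 1 z := fun x => by
      rw [lintegral_withDensity_eq_lintegral_mul _ (measurable_cauchyPDF 0 γ)
        (show Measurable fun y => A.indicator 1 (x + y) from hm.comp (measurable_const_add x)),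
        ← lintegral_add_left_eq_self (fun z => cauchyPDF 0 γ (z - x) * A.indicator 1 z) x]
      simp
    simp_rw [h1]
    rw [lintegral_lintegral_swap]
    · refine lintegral_congr fun z => ?_
      rw [lintegral_mul_const _ (by fun_prop)]
    · exact Measurable.aemeasurable (by fun_prop)
  have heq : ∀ (γ : NNReal), γ ≠ 0 → μ.conv (cauchyMeasure 0 γ) = ν.conv (cauchyMeasure 0 γ) := by
    intro γ hγ
    refine Measure.ext fun A hA => ?_
    rw [hconv γ hγ μ A hA, hconv γ hγ ν A hA]
    refine lintegral_congr fun x => ?_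
    rw [hpdf γ hγ μ, hpdf γ hγ ν, h]
    simpa using hγ
  -- Scaling replaces the explicit characteristic function of the Cauchy law: for small `γ` its
  -- value at `t` is close to its value `1` at the origin, hence nonzero, and it can be cancelled.
  have hchar : ∀ (γ : NNReal), γ ≠ 0 → ∀ t : ℝ,
      charFun (cauchyMeasure 0 γ) t = charFun (cauchyMeasure 0 1) (γ * t) := by
    intro γ hγ t
    have h1 : ∀ (γ : NNReal), γ ≠ 0 → ∀ t : ℝ, charFun (cauchyMeasure 0 γ) t =
        ∫ s : ℝ, cauchyPDFReal 0 γ s • Complex.exp (t * s * Complex.I) := fun γ hγ t => by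
      rw [charFun_apply_real, cauchyMeasure_of_scale_ne_zero 0 hγ,
        integral_withDensity_eq_integral_toReal_smul (measurable_cauchyPDF 0 γ)
          (by simp [cauchyPDF])]
      refine integral_congr_ae (.of_forall fun s => ?_)
      simp only [cauchyPDF, ENNReal.toReal_ofReal (cauchyPDF_pos 0 hγ s).le]
    have hγ' : (γ : ℝ) ≠ 0 := by simpa using hγ
    rw [h1 γ hγ, h1 1 one_ne_zero]
    have h2 := Measure.integral_comp_mul_left
      (fun s : ℝ => cauchyPDFReal 0 1 s • Complex.exp (((γ : ℝ) * t : ℝ) * s * Complex.I)) (γ : ℝ)⁻¹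
    rw [inv_inv, abs_of_nonneg γ.coe_nonneg] at h2
    rw [← inv_smul_eq_iff₀ hγ', ← integral_smul] at h2
    rw [← h2]
    refine integral_congr_ae (.of_forall fun s => ?_)
    simp only [cauchyPDFReal_def', smul_smul]
    congr 1
    · simp
      ring
    · congr 2
      have : ((γ : ℝ) : ℂ) ≠ 0 := by exact_mod_cast hγ'
      push_cast
      field_simp
  refine Measure.ext_of_charFun (funext fun t => ?_)
  have h1 : Tendsto (fun s : ℝ => charFun (cauchyMeasure 0 1) (s * t)) (𝓝[>] 0) (𝓝 1) := by
    have h2 : Continuous fun s : ℝ => charFun (cauchyMeasure 0 1) (s * t) :=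
      continuous_charFun.comp (continuous_id.mul continuous_const)
    have h3 := h2.tendsto 0
    simp only [zero_mul, charFun_zero, probReal_univ, Complex.ofReal_one] at h3
    exact h3.mono_left nhdsWithin_le_nhds
  obtain ⟨s, hs, hs0⟩ := ((h1.eventually_ne one_ne_zero).and self_mem_nhdsWithin).exists
  obtain ⟨γ, rfl⟩ : ∃ γ : NNReal, (γ : ℝ) = s :=
    ⟨s.toNNReal, Real.coe_toNNReal s (le_of_lt hs0)⟩
  have hγ : γ ≠ 0 := by
    rintro rfl
    exact lt_irrefl _ hs0
  have h4 : charFun (μ.conv (cauchyMeasure 0 γ)) t = charFun (ν.conv (cauchyMeasure 0 γ)) t := by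
    rw [heq γ hγ]
  rw [charFun_conv, charFun_conv, hchar γ hγ] at h4
  exact mul_right_cancel₀ hs h4

end Stieltjes

/-! ### Exponentials of measures and their support -/

section ConvolutionSeries

open scoped RealInnerProductSpace Nat

variable {E : Type*} [NormedAddCommGroup E] [InnerProductSpace ℝ E] [FiniteDimensional ℝ E]
  [MeasurableSpace E] [BorelSpace E]

theorem conv_apply_ne_zero {μ ν : Measure E} [SFinite μ] [SFinite ν] {A B U : Set E}
    (hU : MeasurableSet U) (hA : μ A ≠ 0) (hB : ν B ≠ 0)
    (hAB : ∀ a ∈ A, ∀ b ∈ B, a + b ∈ U) : (μ.conv ν) U ≠ 0 := by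
  rw [Measure.conv, Measure.map_apply (by fun_prop) hU]
  intro h
  have h1 : (μ.prod ν) (A ×ˢ B) = 0 :=
    measure_mono_null (fun p hp => hAB _ hp.1 _ hp.2) h
  rw [Measure.prod_prod] at h1
  exact (mul_ne_zero hA hB) h1

/-- Convolution powers of a measure. -/
noncomputable def convPow (μ : Measure E) : ℕ → Measure E
  | 0 => Measure.dirac 0
  | n + 1 => (convPow μ n).conv μ

instance isFiniteMeasure_convPow (μ : Measure E) [IsFiniteMeasure μ] (n : ℕ) :
    IsFiniteMeasure (convPow μ n) := by
  induction n with
  | zero => exact inferInstanceAs (IsFiniteMeasure (Measure.dirac 0))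
  | succ n ih => exact inferInstanceAs (IsFiniteMeasure ((convPow μ n).conv μ))

theorem charFun_convPow (μ : Measure E) [IsFiniteMeasure μ] (n : ℕ) (t : E) :
    charFun (convPow μ n) t = charFun μ t ^ n := by
  induction n with
  | zero => simp [convPow]
  | succ n ih => rw [convPow, charFun_conv, ih, pow_succ]

theorem convPow_add (μ : Measure E) [IsFiniteMeasure μ] (m n : ℕ) :
    convPow μ (m + n) = (convPow μ m).conv (convPow μ n) := by
  refine Measure.ext_of_charFun (funext fun t => ?_)
  simp only [charFun_conv, charFun_convPow, pow_add]

/-- If the characteristic function of `ν` is a power series with nonnegative coefficients in the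
one of `μ`, then `ν` is the corresponding series of convolution powers of `μ`. -/
theorem eq_sum_convPow {μ ν : Measure E} [IsFiniteMeasure μ] [IsFiniteMeasure ν] {c : ℕ → ℝ}
    (hc : ∀ n, 0 ≤ c n) (hs : Summable fun n => c n * μ.real Set.univ ^ n)
    (h : ∀ t, HasSum (fun n => (c n : ℂ) * charFun μ t ^ n) (charFun ν t)) :
    ν = Measure.sum fun n => ENNReal.ofReal (c n) • convPow μ n := by
  have hmass : ∀ n, (convPow μ n) Set.univ = ENNReal.ofReal (μ.real Set.univ ^ n) := fun n => by
    have h1 := charFun_convPow μ n 0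
    rw [charFun_zero, charFun_zero] at h1
    rw [← ofReal_measureReal]
    congr 1
    exact_mod_cast h1
  have hfin : IsFiniteMeasure (Measure.sum fun n => ENNReal.ofReal (c n) • convPow μ n) := by
    refine ⟨?_⟩
    rw [Measure.sum_apply _ MeasurableSet.univ]
    simp only [Measure.smul_apply, hmass, smul_eq_mul]
    simp_rw [← ENNReal.ofReal_mul (hc _)]
    exact hs.tsum_ofReal_lt_top
  refine Measure.ext_of_charFun (funext fun t => ?_)
  refine (h t).unique ?_
  have h2 : Integrable (fun x : E => Complex.exp (⟪x, t⟫ * Complex.I))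
      (Measure.sum fun n => ENNReal.ofReal (c n) • convPow μ n) := by
    refine (integrable_const (1 : ℝ)).mono' (by fun_prop) (.of_forall fun x => ?_)
    rw [Complex.norm_exp_ofReal_mul_I]
  have h3 := hasSum_integral_measure h2
  simp_rw [← charFun_apply, charFun_smul_measure, charFun_convPow,
    ENNReal.toReal_ofReal (hc _)] at h3
  exact h3

/-- If `μ` is absolutely continuous, so is every measure with characteristic function
`a (exp μ̂ - 1)`. -/
theorem absolutelyContinuous_of_charFun_eq_exp_sub_one {μ ν : Measure E} [IsFiniteMeasure μ]
    [IsFiniteMeasure ν] (hμ : μ ≪ (volume : Measure E)) {a : ℝ} (ha : 0 ≤ a)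
    (h : ∀ t, charFun ν t = a * (Complex.exp (charFun μ t) - 1)) : ν ≪ (volume : Measure E) := by
  have hexp : ∀ z : ℂ, HasSum (fun n => ((if n = 0 then 0 else a / n ! : ℝ) : ℂ) * z ^ n)
      (a * (Complex.exp z - 1)) := fun z => by
    have h1 := (NormedSpace.expSeries_div_hasSum_exp z).mul_left (a : ℂ)
    rw [← Complex.exp_eq_exp_ℂ] at h1
    have h2 := h1.sub (hasSum_ite_eq (0 : ℕ) (a : ℂ))
    rw [show (a * (Complex.exp z - 1) : ℂ) = a * Complex.exp z - a by ring]
    refine h2.congr_fun fun n => ?_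
    by_cases hn : n = 0
    · simp [hn]
    · simp [hn]
      ring
  have hν := eq_sum_convPow (ν := ν) (μ := μ) (c := fun n => if n = 0 then 0 else a / n !)
    (fun n => by split_ifs <;> positivity) ?_ fun t => by rw [h]; exact hexp _
  · rw [hν]
    refine Measure.absolutelyContinuous_sum_left fun n => ?_
    -- Subtracting `1` from the exponential removes precisely the order-zero term, the Dirac mass;
    -- every other convolution power has the absolutely continuous factor `μ`.
    rcases n with - | n
    · simp
    · refine (Measure.smul_absolutelyContinuous).trans ?_
      exact Measure.conv_absolutelyContinuous hμ
  · have h1 := hexp (μ.real Set.univ : ℝ)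
    have h2 := h1.summable
    exact_mod_cast h2

/-- If `μ` is a symmetric measure whose characteristic function has no period, then a measure with
characteristic function `a exp μ̂` charges every nonempty open set. -/
theorem measure_ne_zero_of_charFun_eq_exp {μ ν : Measure E} [IsFiniteMeasure μ]
    [IsFiniteMeasure ν] (hsymm : ∀ t, charFun μ (-t) = charFun μ t)
    (hper : ∀ v : E, v ≠ 0 → ¬ Function.Periodic (charFun μ) v) {a : ℝ} (ha : 0 < a)
    (h : ∀ t, charFun ν t = a * Complex.exp (charFun μ t)) {U : Set E} (hU : IsOpen U)
    (hne : U.Nonempty) : ν U ≠ 0 := by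
  have hexp : ∀ z : ℂ, HasSum (fun n => ((a / n ! : ℝ) : ℂ) * z ^ n) (a * Complex.exp z) := by
    intro z
    have h1 := (NormedSpace.expSeries_div_hasSum_exp z).mul_left (a : ℂ)
    rw [← Complex.exp_eq_exp_ℂ] at h1
    refine h1.congr_fun fun n => ?_
    push_cast
    ring
  have hν := eq_sum_convPow (ν := ν) (μ := μ) (c := fun n => a / n !)
    (fun n => by positivity) (by exact_mod_cast (hexp (μ.real Set.univ : ℝ)).summable)
    fun t => by rw [h]; exact hexp _
  suffices hL : ∃ n, convPow μ n U ≠ 0 by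
    obtain ⟨n, hn⟩ := hL
    rw [hν, Measure.sum_apply _ hU.measurableSet]
    intro h0
    have h1 := ENNReal.tsum_eq_zero.1 h0 n
    simp only [Measure.smul_apply, smul_eq_mul, mul_eq_zero, ENNReal.ofReal_eq_zero, hn,
      or_false] at h1
    exact absurd h1 (not_le.2 (by positivity))
  have hneg : ∀ n, (convPow μ n).map (fun x => -x) = convPow μ n := fun n => by
    have := Measure.isFiniteMeasure_map (convPow μ n) (fun x : E => -x)
    refine Measure.ext_of_charFun (funext fun t => ?_)
    rw [charFun_convPow, ← hsymm, ← charFun_convPow, charFun_apply, integral_map (by fun_prop)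
      (by fun_prop), charFun_apply]
    simp only [inner_neg_left, inner_neg_right]
  -- The frequencies near which some convolution power has mass. Convolution gives closure under
  -- addition, and the symmetry of `μ` closure under negation.
  let L : AddSubgroup E :=
    { carrier := {ξ | ∀ U : Set E, IsOpen U → ξ ∈ U → ∃ n, convPow μ n U ≠ 0}
      add_mem' := fun {x y} hx hy U hU hxy => by
        have h1 : {p : E × E | p.1 + p.2 ∈ U} ∈ 𝓝 (x, y) :=
          (hU.preimage continuous_add).mem_nhds hxy
        obtain ⟨A, B, hA, hxA, hB, hyB, hAB⟩ := mem_nhds_prod_iff'.1 h1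
        obtain ⟨m, hm⟩ := hx A hA hxA
        obtain ⟨n, hn⟩ := hy B hB hyB
        refine ⟨m + n, ?_⟩
        rw [convPow_add]
        exact conv_apply_ne_zero hU.measurableSet hm hn fun a ha b hb =>
          (hAB ⟨ha, hb⟩ : (a, b) ∈ {p : E × E | p.1 + p.2 ∈ U})
      zero_mem' := fun U hU h0 => ⟨0, by
        rw [convPow, Measure.dirac_apply_of_mem h0]
        exact one_ne_zero⟩
      neg_mem' := fun {x} hx U hU hxU => by
        obtain ⟨n, hn⟩ := hx ((fun x => -x) ⁻¹' U) (hU.preimage continuous_neg) hxU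
        refine ⟨n, ?_⟩
        rwa [← hneg n, Measure.map_apply measurable_neg hU.measurableSet] }
  have hLc : IsClosed (L : Set E) := by
    refine isClosed_of_closure_subset fun x hx U hU hxU => ?_
    obtain ⟨y, hyU, hyL⟩ := mem_closure_iff.1 hx U hU hxU
    exact hyL U hU hyU
  have htop : L = ⊤ := by
    by_contra hLne
    obtain ⟨v, hv0, hv⟩ := exists_annihilator_of_closed_ne_top hLc hLne
    -- `μ` is concentrated on `L`, where `⟪v, ξ⟫` is an integer, so translating the argument by
    -- `2πv` multiplies each character by `1`.
    refine hper ((2 * Real.pi) • v) (smul_ne_zero (by positivity) hv0) fun t => ?_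
    have hsupp : ∀ᵐ ξ ∂μ, ξ ∈ L := by
      filter_upwards [Measure.support_mem_ae (μ := μ)] with ξ hξ U hU hξU
      refine ⟨1, ?_⟩
      have h1 : convPow μ 1 = μ := by
        refine Measure.ext_of_charFun (funext fun t => ?_)
        rw [charFun_convPow, pow_one]
      rw [h1]
      exact ((Measure.mem_support_iff_forall ξ).1 hξ U (hU.mem_nhds hξU)).ne'
    rw [charFun_apply, charFun_apply]
    refine integral_congr_ae ?_
    filter_upwards [hsupp] with ξ hξ
    obtain ⟨n, hn⟩ := hv ξ hξ
    rw [inner_add_right, inner_smul_right, real_inner_comm v ξ, hn]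
    push_cast
    rw [add_mul, Complex.exp_add, show (2 * Real.pi * n * Complex.I : ℂ) =
      n * (2 * Real.pi * Complex.I) by ring, Complex.exp_int_mul_two_pi_mul_I, mul_one]
  obtain ⟨x, hx⟩ := hne
  exact (htop ▸ AddSubgroup.mem_top x : x ∈ L) U hU hx

end ConvolutionSeries

end StationarySpectrum

namespace StationarySpectrum

/-! ### Cyclic subspaces and the functional calculus of the generators -/

section FunctionalCalculus

open scoped RealInnerProductSpace ComplexConjugate

variable {E : Type*} [NormedAddCommGroup E] [InnerProductSpace ℝ E] [FiniteDimensional ℝ E]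
  [MeasurableSpace E] [BorelSpace E]
variable {H : Type*} [NormedAddCommGroup H] [InnerProductSpace ℂ H] [CompleteSpace H]

/-- The character `ξ ↦ e^{i ξ·x}`. -/
noncomputable def char (x ξ : E) : ℂ := Complex.exp (⟪ξ, x⟫ * Complex.I)

omit [FiniteDimensional ℝ E] [MeasurableSpace E] [BorelSpace E] in
theorem norm_char (x ξ : E) : ‖char x ξ‖ = 1 := Complex.norm_exp_ofReal_mul_I _

omit [FiniteDimensional ℝ E] [MeasurableSpace E] [BorelSpace E] in
theorem char_mul_char (x y ξ : E) : char x ξ * char y ξ = char (x + y) ξ := by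
  simp only [char]
  rw [← Complex.exp_add, inner_add_right]
  push_cast
  ring_nf

omit [FiniteDimensional ℝ E] [MeasurableSpace E] [BorelSpace E] in
theorem conj_char (x ξ : E) : conj (char x ξ) = char (-x) ξ := by
  simp [char, ← Complex.exp_conj]

omit [FiniteDimensional ℝ E] [MeasurableSpace E] [BorelSpace E] in
@[fun_prop]
theorem continuous_char (x : E) : Continuous (char x) := by
  unfold char
  fun_prop

theorem memLp_char (μ : Measure E) [IsFiniteMeasure μ] (x : E) : MemLp (char x) 2 μ :=
  MemLp.of_bound (continuous_char x).aestronglyMeasurable 1 (.of_forall fun ξ => (norm_char x ξ).le)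

theorem memLp_char_mul {μ : Measure E} {f : E → ℂ} (hf : MemLp f 2 μ) (x : E) :
    MemLp (fun ξ => char x ξ * f ξ) 2 μ :=
  hf.of_le ((continuous_char x).aestronglyMeasurable.mul hf.1)
    (.of_forall fun ξ => by rw [norm_mul, norm_char, one_mul])

theorem inner_toLp {α : Type*} [MeasurableSpace α] {μ : Measure α} {f g : α → ℂ}
    (hf : MemLp f 2 μ) (hg : MemLp g 2 μ) :
    inner ℂ (hf.toLp f) (hg.toLp g) = ∫ x, conj (f x) * g x ∂μ := by
  rw [L2.inner_def]
  refine integral_congr_ae ?_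
  filter_upwards [hf.coeFn_toLp, hg.coeFn_toLp] with x hx hy
  rw [hx, hy, RCLike.inner_apply, mul_comm]

/-- The linear map from finitely supported functions to trigonometric polynomials. -/
noncomputable def trigPoly (μ : Measure E) [IsFiniteMeasure μ] : (E →₀ ℂ) →ₗ[ℂ] Lp ℂ 2 μ :=
  Finsupp.linearCombination ℂ fun x => (memLp_char μ x).toLp (char x)

theorem trigPoly_single (μ : Measure E) [IsFiniteMeasure μ] (x : E) :
    trigPoly μ (Finsupp.single x 1) = (memLp_char μ x).toLp (char x) := by
  simp [trigPoly]

theorem inner_char_char (μ : Measure E) [IsFiniteMeasure μ] (x y : E) :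
    inner ℂ ((memLp_char μ x).toLp (char x)) ((memLp_char μ y).toLp (char y)) =
      charFun μ (y - x) := by
  rw [inner_toLp, charFun_apply]
  refine integral_congr_ae (.of_forall fun ξ => ?_)
  simp only [conj_char, char_mul_char]
  rw [char, neg_add_eq_sub]

/-- A function orthogonal to all characters has vanishing Fourier coefficients, so its integral over
every Borel set is zero. -/
theorem denseRange_trigPoly (μ : Measure E) [IsFiniteMeasure μ] : DenseRange (trigPoly μ) := by
  have h : (LinearMap.range (trigPoly μ))ᗮ = ⊥ := by
    rw [Submodule.eq_bot_iff]
    intro g hg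
    have h1 : ∀ t : E, ∫ ξ, g ξ * Complex.exp (⟪ξ, t⟫ * Complex.I) ∂μ = 0 := fun t => by
      have h2 := (Submodule.mem_orthogonal _ _).1 hg _
        (LinearMap.mem_range_self (trigPoly μ) (Finsupp.single (-t) 1))
      have h3 : g = (Lp.memLp g).toLp g := (Lp.toLp_coeFn g _).symm
      rw [trigPoly_single, h3, inner_toLp] at h2
      rw [← h2]
      refine integral_congr_ae (.of_forall fun ξ => ?_)
      simp only [conj_char, neg_neg]
      rw [char, mul_comm]
    have hgi : Integrable g μ := (Lp.memLp g).integrable (by norm_num)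
    refine (Lp.eq_zero_iff_ae_eq_zero).2 ?_
    refine Integrable.ae_eq_zero_of_forall_setIntegral_eq_zero hgi fun s hs _ => ?_
    exact setIntegral_preimage_eq_zero_of_forall_integral_exp measurable_id hgi h1 hs
  have h2 := (Submodule.dense_iff_topologicalClosure_eq_top).2
    ((Submodule.topologicalClosure_eq_top_iff).2 h)
  exact h2

/-- Multiplication by a character, as an isometry of `L²(μ)`. -/
noncomputable def charMul (μ : Measure E) (x : E) : Lp ℂ 2 μ →ₗᵢ[ℂ] Lp ℂ 2 μ where
  toFun f := (memLp_char_mul (Lp.memLp f) x).toLp _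
  map_add' f g := by
    rw [← MemLp.toLp_add]
    refine MemLp.toLp_congr _ _ ?_
    filter_upwards [Lp.coeFn_add f g] with ξ h
    simp only [h, Pi.add_apply, mul_add]
  map_smul' c f := by
    rw [RingHom.id_apply, ← MemLp.toLp_const_smul]
    refine MemLp.toLp_congr _ _ ?_
    filter_upwards [Lp.coeFn_smul c f] with ξ h
    simp only [h, Pi.smul_apply, smul_eq_mul]
    ring
  norm_map' f := by
    change ‖(memLp_char_mul (Lp.memLp f) x).toLp _‖ = ‖f‖
    rw [Lp.norm_toLp, Lp.norm_def]
    congr 1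
    refine eLpNorm_congr_norm_ae (.of_forall fun ξ => ?_)
    rw [norm_mul, norm_char, one_mul]

theorem charMul_toLp (μ : Measure E) (x : E) {f : E → ℂ} (hf : MemLp f 2 μ) :
    charMul μ x (hf.toLp f) = (memLp_char_mul hf x).toLp _ := by
  change (memLp_char_mul (Lp.memLp (hf.toLp f)) x).toLp _ = _
  refine MemLp.toLp_congr _ _ ?_
  filter_upwards [hf.coeFn_toLp] with ξ h
  rw [h]

namespace IsUnitaryRep

variable {T : E → H →ₗᵢ[ℂ] H}

/-- The spectral measure of a vector with respect to a unitary representation. -/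
noncomputable def specMeasure (hT : IsUnitaryRep T) (φ : H) : Measure E :=
  (hT.exists_charFun_eq_inner φ).choose

instance (hT : IsUnitaryRep T) (φ : H) : IsFiniteMeasure (hT.specMeasure φ) :=
  (hT.exists_charFun_eq_inner φ).choose_spec.1

theorem charFun_specMeasure (hT : IsUnitaryRep T) (φ : H) (x : E) :
    charFun (hT.specMeasure φ) x = inner ℂ φ (T x φ) :=
  (hT.exists_charFun_eq_inner φ).choose_spec.2 x

/-- The orbit vectors `T x φ` and the characters in `L²(μ)` have the same Gram matrix, given by the
characteristic function at differences of points. Matching them is thus isometric on finite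
combinations, and density extends the map. -/
theorem exists_cyclic_isometry (hT : IsUnitaryRep T) (φ : H) :
    ∃ U : Lp ℂ 2 (hT.specMeasure φ) →ₗᵢ[ℂ] H,
      ∀ x, U ((memLp_char _ x).toLp (char x)) = T x φ := by
  set μ := hT.specMeasure φ with hμ
  let B : (E →₀ ℂ) →ₗ[ℂ] H := Finsupp.linearCombination ℂ fun x => T x φ
  have hnorm : ∀ a, ‖B a‖ = ‖trigPoly μ a‖ := fun a => by
    have h1 : inner ℂ (B a) (B a) = inner ℂ (trigPoly μ a) (trigPoly μ a) := by
      simp only [B, trigPoly, Finsupp.linearCombination_apply, Finsupp.sum, sum_inner, inner_sum,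
        inner_smul_left, inner_smul_right, inner_char_char, hT.inner_apply]
      simp only [hμ, charFun_specMeasure]
    rw [inner_self_eq_norm_sq_to_K, inner_self_eq_norm_sq_to_K] at h1
    have h2 : ‖B a‖ ^ 2 = ‖trigPoly μ a‖ ^ 2 := by exact_mod_cast h1
    exact (sq_eq_sq₀ (norm_nonneg _) (norm_nonneg _)).1 h2
  have hext : ∀ a, B.extendOfNorm (trigPoly μ) (trigPoly μ a) = B a := fun a =>
    LinearMap.extendOfNorm_eq (denseRange_trigPoly μ)
      ⟨1, fun a => by rw [one_mul, hnorm]⟩ a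
  refine ⟨⟨(B.extendOfNorm (trigPoly μ)).toLinearMap, fun f => ?_⟩, fun x => ?_⟩
  · refine (denseRange_trigPoly μ).induction_on (p := fun f =>
      ‖(B.extendOfNorm (trigPoly μ)) f‖ = ‖f‖) f (isClosed_eq (by fun_prop) (by fun_prop))
      fun a => ?_
    rw [hext, hnorm]
  · change B.extendOfNorm (trigPoly μ) _ = _
    rw [← trigPoly_single, hext]
    simp [B]

/-- The isometry from `L²` of the spectral measure onto the cyclic subspace. -/
noncomputable def cyclic (hT : IsUnitaryRep T) (φ : H) : Lp ℂ 2 (hT.specMeasure φ) →ₗᵢ[ℂ] H :=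
  (hT.exists_cyclic_isometry φ).choose

theorem cyclic_char (hT : IsUnitaryRep T) (φ : H) (x : E) :
    hT.cyclic φ ((memLp_char _ x).toLp (char x)) = T x φ :=
  (hT.exists_cyclic_isometry φ).choose_spec x

theorem apply_cyclic (hT : IsUnitaryRep T) (φ : H) (x : E) (f : Lp ℂ 2 (hT.specMeasure φ)) :
    T x (hT.cyclic φ f) = hT.cyclic φ (charMul _ x f) := by
  have h1 : ((T x).toLinearMap ∘ₗ (hT.cyclic φ).toLinearMap) ∘ₗ trigPoly (hT.specMeasure φ) =
      ((hT.cyclic φ).toLinearMap ∘ₗ (charMul (hT.specMeasure φ) x).toLinearMap) ∘ₗ trigPoly (hT.specMeasure φ) := by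
    refine Finsupp.lhom_ext' fun y => LinearMap.ext_ring ?_
    change T x (hT.cyclic φ (trigPoly (hT.specMeasure φ) (Finsupp.single y 1))) =
      hT.cyclic φ (charMul (hT.specMeasure φ) x (trigPoly (hT.specMeasure φ) (Finsupp.single y 1)))
    rw [trigPoly_single, cyclic_char, charMul_toLp, ← hT.add, ← cyclic_char]
    congr 1
    refine MemLp.toLp_congr _ _ (.of_forall fun ξ => ?_)
    exact (char_mul_char x y ξ).symm
  refine (denseRange_trigPoly (hT.specMeasure φ)).induction_on (p := fun f =>
    T x (hT.cyclic φ f) = hT.cyclic φ (charMul (hT.specMeasure φ) x f)) f (isClosed_eq ?_ ?_)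
    fun a => LinearMap.congr_fun h1 a
  · exact (T x).continuous.comp (hT.cyclic φ).continuous
  · exact (hT.cyclic φ).continuous.comp (charMul (hT.specMeasure φ) x).continuous

/-- The functional calculus of the generators, applied to the vector `φ`. -/
noncomputable def funCalc (hT : IsUnitaryRep T) (φ : H) {f : E → ℂ}
    (hf : MemLp f 2 (hT.specMeasure φ)) : H :=
  hT.cyclic φ (hf.toLp f)

section Calc

variable (hT : IsUnitaryRep T) (φ : H) {f g : E → ℂ} (hf : MemLp f 2 (hT.specMeasure φ))
  (hg : MemLp g 2 (hT.specMeasure φ))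

theorem funCalc_congr (h : f = g) : hT.funCalc φ hf = hT.funCalc φ hg := by
  subst h
  rfl

theorem funCalc_one : hT.funCalc φ (memLp_const (1 : ℂ)) = φ := by
  have h := hT.cyclic_char φ 0
  rw [hT.zero] at h
  refine Eq.trans (congrArg (hT.cyclic φ) (MemLp.toLp_congr _ _ (.of_forall fun ξ => ?_))) h
  simp [StationarySpectrum.char]

theorem funCalc_add : hT.funCalc φ (hf.add hg) = hT.funCalc φ hf + hT.funCalc φ hg := by
  rw [funCalc, MemLp.toLp_add, map_add]
  rfl

theorem funCalc_sub : hT.funCalc φ (hf.sub hg) = hT.funCalc φ hf - hT.funCalc φ hg := by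
  rw [funCalc, MemLp.toLp_sub, map_sub]
  rfl

theorem funCalc_smul (c : ℂ) : hT.funCalc φ (hf.const_smul c) = c • hT.funCalc φ hf := by
  rw [funCalc, MemLp.toLp_const_smul, map_smul]
  rfl

theorem inner_funCalc :
    inner ℂ (hT.funCalc φ hf) (hT.funCalc φ hg) = ∫ ξ, conj (f ξ) * g ξ ∂(hT.specMeasure φ) := by
  rw [funCalc, funCalc, LinearIsometry.inner_map_map, inner_toLp]

theorem norm_funCalc : ‖hT.funCalc φ hf‖ = (eLpNorm f 2 (hT.specMeasure φ)).toReal := by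
  rw [funCalc, LinearIsometry.norm_map, Lp.norm_toLp]

theorem norm_sq_funCalc : ‖hT.funCalc φ hf‖ ^ 2 = ∫ ξ, ‖f ξ‖ ^ 2 ∂(hT.specMeasure φ) := by
  have h := hT.inner_funCalc φ hf hf
  rw [inner_self_eq_norm_sq_to_K] at h
  simp_rw [Complex.conj_mul'] at h
  have h2 : ∫ ξ, ((‖f ξ‖ : ℂ) ^ 2) ∂(hT.specMeasure φ) =
      ((∫ ξ, ‖f ξ‖ ^ 2 ∂(hT.specMeasure φ) : ℝ) : ℂ) := by
    rw [← integral_complex_ofReal]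
    simp
  rw [h2, ← RCLike.ofReal_pow] at h
  exact Complex.ofReal_injective h

theorem apply_funCalc (x : E) : T x (hT.funCalc φ hf) = hT.funCalc φ (memLp_char_mul hf x) := by
  rw [funCalc, apply_cyclic, charMul_toLp]
  rfl

end Calc

section Derivative

variable (hT : IsUnitaryRep T) (φ : H) {f : E → ℂ}

theorem memLp_slope {μ : Measure E} {f : E → ℂ} (hf : MemLp f 2 μ) (v : E) (t : ℝ) :
    MemLp (fun ξ => (t : ℂ)⁻¹ * (char (t • v) ξ - 1) * f ξ) 2 μ := by
  have h := ((memLp_char_mul hf (t • v)).sub hf).const_mul (t : ℂ)⁻¹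
  refine (memLp_congr_ae (.of_forall fun ξ => ?_)).1 h
  simp only [Pi.sub_apply]
  ring

theorem slope_funCalc (hf : MemLp f 2 (hT.specMeasure φ)) (v : E) (t : ℝ) :
    t⁻¹ • (T (t • v) (hT.funCalc φ hf) - hT.funCalc φ hf) = hT.funCalc φ (memLp_slope hf v t) := by
  rw [apply_funCalc, ← funCalc_sub, ← Complex.coe_smul, ← funCalc_smul]
  refine funCalc_congr _ _ _ _ (funext fun ξ => ?_)
  simp only [Pi.sub_apply, Pi.smul_apply, smul_eq_mul, Complex.ofReal_inv]
  ring

-- The bound `|e^{is} - 1| ≤ |s|` is uniform in `t`, which supplies the dominating function for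
-- differentiating under the integral.
omit [FiniteDimensional ℝ E] [MeasurableSpace E] [BorelSpace E] in
theorem norm_slope_le (v ξ : E) (t : ℝ) (z : ℂ) :
    ‖(t : ℂ)⁻¹ * (char (t • v) ξ - 1) * z‖ ≤ ‖(⟪ξ, v⟫ : ℂ) * z‖ := by
  rw [norm_mul _ z, norm_mul _ z]
  refine mul_le_mul_of_nonneg_right ?_ (norm_nonneg _)
  rw [norm_mul, norm_inv, Complex.norm_real, Complex.norm_real]
  rcases eq_or_ne t 0 with rfl | ht
  · simp
  rw [inv_mul_le_iff₀ (norm_pos_iff.2 ht), char, mul_comm _ Complex.I]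
  refine Real.norm_exp_I_mul_ofReal_sub_one_le.trans (le_of_eq ?_)
  rw [inner_smul_right, norm_mul]

omit [FiniteDimensional ℝ E] [MeasurableSpace E] [BorelSpace E] in
theorem tendsto_slope_char (v ξ : E) (z : ℂ) :
    Tendsto (fun t : ℝ => (t : ℂ)⁻¹ * (char (t • v) ξ - 1) * z) (𝓝[≠] 0)
      (𝓝 (Complex.I * ⟪ξ, v⟫ * z)) := by
  have h1 : HasDerivAt (fun t : ℝ => char (t • v) ξ) (Complex.I * ⟪ξ, v⟫) 0 := by
    have h2 : HasDerivAt (fun t : ℝ => ((t : ℂ) * ⟪ξ, v⟫ * Complex.I)) (⟪ξ, v⟫ * Complex.I) 0 := by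
      simpa using ((Complex.ofRealCLM.hasDerivAt (x := (0 : ℝ))).mul_const
        (⟪ξ, v⟫ : ℂ)).mul_const Complex.I
    have h3 := h2.cexp
    simp only [Complex.ofReal_zero, zero_mul, Complex.exp_zero, one_mul] at h3
    rw [mul_comm]
    refine h3.congr_of_eventuallyEq (.of_forall fun t => ?_)
    simp [StationarySpectrum.char, inner_smul_right]
  have h4 := (hasDerivAt_iff_tendsto_slope_zero.1 h1).mul_const z
  refine h4.congr fun t => ?_
  simp [char]

theorem memLp_I_mul {μ : Measure E} {f : E → ℂ} {v : E}
    (hv : MemLp (fun ξ => (⟪ξ, v⟫ : ℂ) * f ξ) 2 μ) :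
    MemLp (fun ξ => Complex.I * ⟪ξ, v⟫ * f ξ) 2 μ := by
  simpa [mul_assoc] using hv.const_mul Complex.I

theorem hasDerivAt_funCalc {v : E} (hf : MemLp f 2 (hT.specMeasure φ))
    (hv : MemLp (fun ξ => (⟪ξ, v⟫ : ℂ) * f ξ) 2 (hT.specMeasure φ)) :
    HasDerivAt (fun t : ℝ => T (t • v) (hT.funCalc φ hf)) (hT.funCalc φ (memLp_I_mul hv)) 0 := by
  rw [hasDerivAt_iff_tendsto_slope_zero]
  simp only [zero_add, zero_smul, hT.zero, slope_funCalc]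
  rw [tendsto_iff_norm_sub_tendsto_zero]
  simp_rw [← funCalc_sub]
  have h1 : Tendsto (fun t : ℝ => ‖hT.funCalc φ ((memLp_slope hf v t).sub (memLp_I_mul hv))‖ ^ 2)
      (𝓝[≠] 0) (𝓝 0) := by
    simp_rw [norm_sq_funCalc]
    have h2 : ∫ ξ : E, (0 : ℝ) ∂(hT.specMeasure φ) = 0 := by simp
    rw [← h2]
    refine tendsto_integral_filter_of_dominated_convergence
      (fun ξ => (2 * ‖(⟪ξ, v⟫ : ℂ) * f ξ‖) ^ 2) (.of_forall fun t => ?_)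
      (.of_forall fun t => .of_forall fun ξ => ?_) ?_ (.of_forall fun ξ => ?_)
    · exact (((memLp_slope hf v t).sub (memLp_I_mul hv)).1.norm.pow 2)
    · rw [Real.norm_of_nonneg (by positivity)]
      refine pow_le_pow_left₀ (norm_nonneg _) ?_ 2
      rw [two_mul]
      refine (norm_sub_le _ _).trans (add_le_add (norm_slope_le v ξ t (f ξ)) (le_of_eq ?_))
      change ‖Complex.I * ⟪ξ, v⟫ * f ξ‖ = _
      rw [mul_assoc, norm_mul, Complex.norm_I, one_mul]
    · simp_rw [mul_pow]
      exact (hv.integrable_norm_pow (by norm_num)).const_mul _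
    · have h3 := ((tendsto_slope_char v ξ (f ξ)).sub_const (Complex.I * ⟪ξ, v⟫ * f ξ)).norm.pow 2
      simpa using h3
  have h4 := h1.sqrt
  simpa [Real.sqrt_sq] using h4

/-- Convergent difference quotients have bounded norms, and Fatou's lemma along `t = 1/(n+1)`
transfers the bound to their pointwise limit. Together with `hasDerivAt_funCalc`, this identifies
the domain of each generator exactly. -/
theorem memLp_of_differentiableAt {v : E} (hf : MemLp f 2 (hT.specMeasure φ))
    (hd : DifferentiableAt ℝ (fun t : ℝ => T (t • v) (hT.funCalc φ hf)) 0) :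
    MemLp (fun ξ => (⟪ξ, v⟫ : ℂ) * f ξ) 2 (hT.specMeasure φ) := by
  have h1 := hasDerivAt_iff_tendsto_slope_zero.1 hd.hasDerivAt
  simp only [zero_add, zero_smul, hT.zero, slope_funCalc] at h1
  have hseq : Tendsto (fun n : ℕ => 1 / ((n : ℝ) + 1)) atTop (𝓝[≠] 0) := by
    refine tendsto_nhdsWithin_iff.2 ⟨tendsto_one_div_add_atTop_nhds_zero_nat, ?_⟩
    exact .of_forall fun n => by
      simp only [Set.mem_compl_iff, Set.mem_singleton_iff]
      positivity
  have hm : MemLp (fun ξ => Complex.I * ⟪ξ, v⟫ * f ξ) 2 (hT.specMeasure φ) := by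
    refine ⟨AEStronglyMeasurable.mul (by fun_prop) hf.1, ?_⟩
    refine (Lp.eLpNorm_lim_le_liminf_eLpNorm
      (f := fun (n : ℕ) ξ => ((1 / ((n : ℝ) + 1) : ℝ) : ℂ)⁻¹ *
        (char ((1 / ((n : ℝ) + 1)) • v) ξ - 1) * f ξ)
      (fun n => (memLp_slope hf v _).1) _
      (.of_forall fun ξ => (tendsto_slope_char v ξ (f ξ)).comp hseq)).trans_lt ?_
    have h2 := (ENNReal.continuous_ofReal.tendsto _).comp (h1.comp hseq).norm
    have h3 : ∀ n : ℕ, eLpNorm (fun ξ => ((1 / ((n : ℝ) + 1) : ℝ) : ℂ)⁻¹ *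
        (char ((1 / ((n : ℝ) + 1)) • v) ξ - 1) * f ξ) 2 (hT.specMeasure φ) =
        ENNReal.ofReal ‖hT.funCalc φ (memLp_slope hf v (1 / ((n : ℝ) + 1)))‖ := fun n => by
      rw [norm_funCalc, ENNReal.ofReal_toReal (memLp_slope hf v _).2.ne]
    simp_rw [h3]
    exact (Tendsto.liminf_eq h2).trans_lt ENNReal.ofReal_lt_top
  have h5 := hm.const_mul (-Complex.I)
  refine (memLp_congr_ae (.of_forall fun ξ => ?_)).1 h5
  change -Complex.I * (Complex.I * ⟪ξ, v⟫ * f ξ) = ⟪ξ, v⟫ * f ξ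
  rw [← mul_assoc, ← mul_assoc, neg_mul, Complex.I_mul_I, neg_neg, one_mul]

end Derivative

end IsUnitaryRep

end FunctionalCalculus

end StationarySpectrum

namespace StationarySpectrum

/-! ### Strong continuity of the shifts -/

section ShiftContinuity

theorem tendsto_lintegral_translate_sub {E : Type*} [NormedAddCommGroup E] [InnerProductSpace ℝ E]
    [FiniteDimensional ℝ E] [MeasurableSpace E] [BorelSpace E] {g : E → ℂ}
    (hg : MemLp g 2 (volume : Measure E)) :
    Tendsto (fun h : E => ∫⁻ x, ‖g (h + x) - g x‖ₑ ^ 2) (𝓝 0) (𝓝 0) := by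
  have : Fact ((2 : ℝ≥0∞) ≠ ∞) := ⟨ENNReal.ofNat_ne_top⟩
  have h1 : Continuous fun h : E => DomAddAct.mk h +ᵥ hg.toLp g :=
    Continuous.vadd (DomAddAct.mkHomeomorph.continuous) continuous_const
  have h2 := (ENNReal.continuous_pow 2).tendsto _ |>.comp
    ((h1.sub (continuous_const (y := hg.toLp g))).enorm.tendsto 0)
  have h3 : ∀ h : E, ‖(DomAddAct.mk h +ᵥ hg.toLp g) - hg.toLp g‖ₑ ^ 2 =
      ∫⁻ x, ‖g (h + x) - g x‖ₑ ^ 2 := fun h => by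
    rw [Lp.enorm_def, eLpNorm_eq_lintegral_rpow_enorm_toReal (by norm_num) (by norm_num)]
    rw [← ENNReal.rpow_natCast, ← ENNReal.rpow_mul,
      show 1 / (2 : ℝ≥0∞).toReal * ((2 : ℕ) : ℝ) = 1 by norm_num, ENNReal.rpow_one]
    simp only [ENNReal.toReal_ofNat, ENNReal.rpow_ofNat]
    refine lintegral_congr_ae ?_
    filter_upwards [Lp.coeFn_sub (DomAddAct.mk h +ᵥ hg.toLp g) (hg.toLp g), hg.coeFn_toLp,
      DomAddAct.vadd_Lp_ae_eq (DomAddAct.mk h) (hg.toLp g),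
      (measurePreserving_add_left volume h).quasiMeasurePreserving.ae hg.coeFn_toLp] with x a b c e
    rw [a, Pi.sub_apply, c, b]
    congr 3
  simp only [Function.comp_def, Pi.sub_apply, h3] at h2
  simpa using h2

variable {d : ℕ} {Ω : Type*} [MeasurableSpace Ω] {P : Measure Ω} {τ : Space d → Ω → Ω}

theorem IsMeasurableAction.aestronglyMeasurable_field [IsFiniteMeasure P]
    (hτ : IsMeasurableAction P τ) {u : Ω → ℂ} (hu : Measurable u) :
    AEStronglyMeasurable (fun p : Space d × Ω => field τ u p.1 p.2) (volume.prod P) := by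
  have h1 : MeasurePreserving (fun p : Space d × Ω => (-p.1, p.2)) (volume.prod P)
      (volume.prod P) :=
    (Measure.measurePreserving_neg volume).prod (MeasurePreserving.id P)
  have h2 : NullMeasurable (fun p : Space d × Ω => field τ u p.1 p.2) (volume.prod P) :=
    hu.comp_nullMeasurable (hτ.nullMeasurable.comp_quasiMeasurePreserving h1.quasiMeasurePreserving)
  exact h2.aemeasurable.aestronglyMeasurable

/-- By stationarity the norm of the increment is the same at every base point, so it can be averaged
over a ball of base points. Fubini then reduces the claim to continuity of translations in `L²(ℝ^d)`
for almost every realisation. -/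
theorem IsMeasurableAction.tendsto_lintegral_field_sub [IsFiniteMeasure P]
    (hτ : IsMeasurableAction P τ) {u : Ω → ℂ} (hu : Measurable u) {M : ℝ}
    (hM : ∀ ω, ‖u ω‖ ≤ M) :
    Tendsto (fun h => ∫⁻ ω, ‖field τ u h ω - u ω‖ₑ ^ 2 ∂P) (𝓝 0) (𝓝 0) := by
  -- For `x` in the unit ball and `‖h‖ ≤ 1`, both `x` and `h + x` lie in the ball of radius `2`, so
  -- the cutoff is invisible there; the cut-off increment is supported in the ball of radius `3`.
  let B (r : ℝ) : Set (Space d) := Metric.closedBall 0 r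
  let G : Space d → Ω → ℂ := fun x ω => (B 2).indicator (fun x => field τ u x ω) x
  have hB (r : ℝ) : MeasurableSet (B r) := measurableSet_closedBall
  have hG : AEStronglyMeasurable (fun p : Space d × Ω => G p.1 p.2) (volume.prod P) := by
    have h := (hτ.aestronglyMeasurable_field hu).indicator (measurable_fst (hB 2))
    exact h
  have hGM : ∀ x ω, ‖G x ω‖ ≤ M := fun x ω => by
    simp only [G]
    exact (norm_indicator_le_norm_self _ _).trans (hM _)
  have hGs : ∀ x ω, x ∉ B 2 → G x ω = 0 := fun x ω hx => Set.indicator_of_notMem hx _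
  have hGh : ∀ h : Space d, AEMeasurable
      (fun p : Space d × Ω => ‖G (h + p.1) p.2 - G p.1 p.2‖ₑ ^ 2) (volume.prod P) := fun h => by
    have h1 : MeasurePreserving (fun p : Space d × Ω => (h + p.1, p.2)) (volume.prod P)
        (volume.prod P) := (measurePreserving_add_left volume h).prod (MeasurePreserving.id P)
    exact ((hG.comp_measurePreserving h1).sub hG).enorm.pow_const 2
  have hle : ∀ᶠ h in 𝓝 (0 : Space d), volume (B 1) * ∫⁻ ω, ‖field τ u h ω - u ω‖ₑ ^ 2 ∂P ≤
      ∫⁻ ω, ∫⁻ x, ‖G (h + x) ω - G x ω‖ₑ ^ 2 ∂volume ∂P := by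
    filter_upwards [Metric.closedBall_mem_nhds (0 : Space d) one_pos] with h hh
    rw [← lintegral_lintegral_swap (μ := volume) (ν := P)
      (f := fun x ω => ‖G (h + x) ω - G x ω‖ₑ ^ 2) (hGh h), mul_comm, ← setLIntegral_const]
    refine (setLIntegral_mono' (hB 1) fun x hx => le_of_eq ?_).trans (setLIntegral_le_lintegral _ _)
    simp only [B, mem_closedBall_zero_iff] at hx hh
    have e1 : x ∈ B 2 := by simp only [B, mem_closedBall_zero_iff]; linarith
    have e2 : h + x ∈ B 2 := by
      simp only [B, mem_closedBall_zero_iff]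
      linarith [norm_add_le h x]
    simp only [G, Set.indicator_of_mem e1, Set.indicator_of_mem e2]
    have hm : Measurable fun ω => ‖field τ u h ω - u ω‖ₑ ^ 2 :=
      ((hu.comp (hτ.measurePreserving (-h)).measurable).sub hu).enorm.pow_const 2
    rw [← (hτ.measurePreserving (-x)).lintegral_comp hm]
    refine lintegral_congr fun ω => ?_
    simp only [field]
    rw [hτ.add, neg_add]
  have hlim : Tendsto (fun h => ∫⁻ ω, ∫⁻ x, ‖G (h + x) ω - G x ω‖ₑ ^ 2 ∂volume ∂P) (𝓝 0) (𝓝 0) := by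
    rw [← lintegral_zero (μ := P)]
    refine tendsto_lintegral_filter_of_dominated_convergence'
      (fun _ => ∫⁻ x, (B 3).indicator (fun _ => ENNReal.ofReal (2 * M) ^ 2) x ∂(volume : Measure (Space d)))
      ?_ ?_ ?_ ?_
    · exact .of_forall fun h => (hGh h).lintegral_prod_left'
    · filter_upwards [Metric.closedBall_mem_nhds (0 : Space d) one_pos] with h hh
      simp only [mem_closedBall_zero_iff] at hh
      refine .of_forall fun ω => lintegral_mono fun x => ?_
      by_cases hx : x ∈ B 3
      · rw [Set.indicator_of_mem hx]
        gcongr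
        rw [← ofReal_norm]
        refine ENNReal.ofReal_le_ofReal ((norm_sub_le _ _).trans ?_)
        linarith [hGM (h + x) ω, hGM x ω]
      · simp only [B, mem_closedBall_zero_iff, not_le] at hx
        rw [hGs, hGs]
        · simp
        · simp only [B, mem_closedBall_zero_iff, not_le]; linarith
        · simp only [B, mem_closedBall_zero_iff, not_le]
          have := norm_sub_le (h + x) h
          rw [add_sub_cancel_left] at this
          linarith
    · rw [lintegral_const]
      refine ENNReal.mul_ne_top ?_ (measure_ne_top _ _)
      rw [lintegral_indicator (hB 3), setLIntegral_const]
      exact ENNReal.mul_ne_top (ENNReal.pow_ne_top ENNReal.ofReal_ne_top) measure_closedBall_lt_top.ne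
    · have h1 : ∀ᵐ ω ∂P, AEStronglyMeasurable (fun x => G x ω) volume := hG.prodMk_right
      filter_upwards [h1] with ω hω
      refine tendsto_lintegral_translate_sub (g := fun x => G x ω) ?_
      have h2 : MemLp (fun x => (B 2).indicator (fun _ => (M : ℂ)) x) 2
          (volume : Measure (Space d)) :=
        memLp_indicator_const 2 (hB 2) _ (.inr measure_closedBall_lt_top.ne)
      refine h2.of_le hω (.of_forall fun x => ?_)
      by_cases hx : x ∈ B 2
      · rw [Set.indicator_of_mem hx, Complex.norm_real, Real.norm_eq_abs]
        exact (hGM x ω).trans (le_abs_self M)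
      · rw [hGs x ω hx]
        simp
  have hB1 : volume (B 1) ≠ 0 := (Metric.measure_closedBall_pos volume _ one_pos).ne'
  have hB1' : volume (B 1) ≠ ∞ := measure_closedBall_lt_top.ne
  have h5 := tendsto_of_tendsto_of_tendsto_of_le_of_le' tendsto_const_nhds hlim
    (.of_forall fun h => zero_le) hle
  have h6 := ENNReal.Tendsto.const_mul (a := (volume (B 1))⁻¹) h5 (.inr (ENNReal.inv_ne_top.2 hB1))
  simpa [← mul_assoc, ENNReal.inv_mul_cancel hB1 hB1'] using h6

theorem memLp_field {α : Type*} [NormedAddCommGroup α] (hτ : IsMeasurableAction P τ) (x : Space d)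
    {u : Ω → α} {p : ℝ≥0∞} (hu : MemLp u p P) : MemLp (field τ u x) p P :=
  hu.comp_measurePreserving (hτ.measurePreserving (-x))

theorem shift_toLp (hτ : IsMeasurableAction P τ) (x : Space d) {u : Ω → ℂ} (hu : MemLp u 2 P) :
    shift hτ x (hu.toLp u) =
      (memLp_field hτ x hu).toLp (field τ u x) :=
  Lp.toLp_compMeasurePreserving hu (hτ.measurePreserving (-x))

theorem coeFn_shift (hτ : IsMeasurableAction P τ) (x : Space d) (φ : Lp ℂ 2 P) :
    shift hτ x φ =ᵐ[P] field τ φ x :=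
  Lp.coeFn_compMeasurePreserving φ (hτ.measurePreserving (-x))

theorem shift_zero (hτ : IsMeasurableAction P τ) (φ : Lp ℂ 2 P) : shift hτ 0 φ = φ := by
  refine Lp.ext ((coeFn_shift hτ 0 φ).trans (.of_forall fun ω => ?_))
  simp [field, hτ.zero]

theorem shift_add (hτ : IsMeasurableAction P τ) (x y : Space d) (φ : Lp ℂ 2 P) :
    shift hτ (x + y) φ = shift hτ x (shift hτ y φ) := by
  refine Lp.ext ?_
  filter_upwards [coeFn_shift hτ (x + y) φ, coeFn_shift hτ x (shift hτ y φ),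
    (hτ.measurePreserving (-x)).quasiMeasurePreserving.ae (coeFn_shift hτ y φ)] with ω a b c
  rw [a, b]
  simp only [field] at c ⊢
  rw [c, hτ.add, neg_add_rev]

theorem tendsto_shift_zero [IsFiniteMeasure P] (hτ : IsMeasurableAction P τ) (φ : Lp ℂ 2 P) :
    Tendsto (fun x => shift hτ x φ) (𝓝 0) (𝓝 φ) := by
  refine Lp.induction (p := 2) (by norm_num)
    (motive := fun φ => Tendsto (fun x => shift hτ x φ) (𝓝 0) (𝓝 φ)) ?_ ?_ ?_ φ
  · intro c s hs hμs
    set u : Ω → ℂ := s.indicator fun _ => c with hu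
    have hm : MemLp u 2 P := memLp_indicator_const 2 hs c (.inr hμs.ne)
    have h1 := hτ.tendsto_lintegral_field_sub (u := u) (measurable_const.indicator hs) (M := ‖c‖)
      fun ω => norm_indicator_le_norm_self _ _
    change Tendsto (fun x => shift hτ x (hm.toLp u)) (𝓝 0) (𝓝 (hm.toLp u))
    rw [tendsto_iff_edist_tendsto_0]
    have h2 := (ENNReal.continuous_rpow_const (y := 1 / 2)).tendsto 0 |>.comp h1
    rw [ENNReal.zero_rpow_of_pos (by norm_num)] at h2
    refine h2.congr fun x => ?_
    rw [shift_toLp, Lp.edist_toLp_toLp, eLpNorm_eq_lintegral_rpow_enorm_toReal (by norm_num)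
      (by norm_num)]
    simp
  · intro f g hf hg _ h1 h2
    simpa only [map_add] using h1.add h2
  · refine isClosed_of_closure_subset fun φ hφ => ?_
    refine Metric.tendsto_nhds.2 fun ε hε => ?_
    obtain ⟨ψ, hψ, hψε⟩ := Metric.mem_closure_iff.1 hφ (ε / 3) (by positivity)
    filter_upwards [Metric.tendsto_nhds.1 hψ (ε / 3) (by positivity)] with x hx
    have h1 : dist (shift hτ x φ) (shift hτ x ψ) = dist φ ψ := (shift hτ x).dist_map φ ψ
    have h2 := dist_triangle4 (shift hτ x φ) (shift hτ x ψ) ψ φ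
    rw [dist_comm ψ φ] at h2
    linarith

theorem isUnitaryRep_shift [IsFiniteMeasure P] (hτ : IsMeasurableAction P τ) :
    IsUnitaryRep (shift hτ) where
  zero := shift_zero hτ
  add := shift_add hτ
  continuous φ := by
    refine continuous_iff_continuousAt.2 fun x => ?_
    have h1 := tendsto_shift_zero hτ φ
    have h2 : Tendsto (fun y => y - x) (𝓝 x) (𝓝 0) := by
      have : Continuous fun y : Space d => y - x := by fun_prop
      simpa using this.tendsto x
    have h3 := (shift hτ x).continuous.tendsto φ |>.comp (h1.comp h2)
    refine h3.congr fun y => ?_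
    simp only [Function.comp_apply]
    rw [← shift_add, add_sub_cancel]

end ShiftContinuity

end StationarySpectrum

namespace StationarySpectrum

/-! ### The fibered operator as a multiplication operator -/

section Fibered

open scoped RealInnerProductSpace ComplexConjugate

theorem IsUnitaryRep.funCalc_sum {E : Type*} [NormedAddCommGroup E] [InnerProductSpace ℝ E]
    [FiniteDimensional ℝ E] [MeasurableSpace E] [BorelSpace E] {H : Type*} [NormedAddCommGroup H]
    [InnerProductSpace ℂ H] [CompleteSpace H] {T : E → H →ₗᵢ[ℂ] H} (hT : IsUnitaryRep T) (φ : H)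
    {ι : Type*} (s : Finset ι) {f : ι → E → ℂ} (hf : ∀ i, MemLp (f i) 2 (hT.specMeasure φ)) :
    hT.funCalc φ (memLp_finsetSum' s fun i _ => hf i) = ∑ i ∈ s, hT.funCalc φ (hf i) := by
  classical
  induction s using Finset.induction_on with
  | empty =>
    refine norm_eq_zero.1 ((hT.norm_funCalc _ _).trans ?_)
    simp
  | insert i s hi ih =>
    refine (hT.funCalc_congr _ _ ((hf i).add (memLp_finsetSum' s fun i _ => hf i))
      (Finset.sum_insert hi)).trans ?_
    rw [Finset.sum_insert hi, ← ih, ← hT.funCalc_add]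

/-- The symbol `|ξ + k|² - |k|²` of the fibered operator. -/
noncomputable def dispersion {d : ℕ} (k ξ : Space d) : ℝ := ‖ξ + k‖ ^ 2 - ‖k‖ ^ 2

variable {d : ℕ}

theorem continuous_dispersion (k : Space d) : Continuous (dispersion k) := by
  unfold dispersion
  fun_prop

theorem dispersion_eq_sum (k ξ : Space d) :
    dispersion k ξ = ∑ j, ξ j ^ 2 + 2 * ∑ j, k j * ξ j := by
  simp only [dispersion, EuclideanSpace.real_norm_sq_eq, PiLp.add_apply, Finset.mul_sum]
  rw [← Finset.sum_sub_distrib, ← Finset.sum_add_distrib]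
  refine Finset.sum_congr rfl fun j _ => ?_
  ring

theorem neg_norm_sq_le_dispersion (k ξ : Space d) : -‖k‖ ^ 2 ≤ dispersion k ξ := by
  unfold dispersion
  nlinarith [sq_nonneg ‖ξ + k‖]

theorem norm_sq_le_dispersion (k ξ : Space d) : ‖ξ‖ ^ 2 ≤ 2 * dispersion k ξ + 4 * ‖k‖ ^ 2 := by
  unfold dispersion
  have h : ‖ξ‖ ≤ ‖ξ + k‖ + ‖k‖ := by
    simpa using norm_sub_le (ξ + k) k
  nlinarith [sq_nonneg (‖ξ + k‖ - ‖k‖), norm_nonneg ξ, norm_nonneg (ξ + k), norm_nonneg k]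

theorem abs_apply_le_norm (ξ : Space d) (j : Fin d) : |ξ j| ≤ ‖ξ‖ := by
  simpa using PiLp.norm_apply_le ξ j

theorem inner_single (ξ : Space d) (j : Fin d) :
    ⟪ξ, EuclideanSpace.single j (1 : ℝ)⟫ = ξ j := by
  simp [EuclideanSpace.inner_single_right]

variable {Ω : Type*} [MeasurableSpace Ω] {P : Measure Ω} [IsFiniteMeasure P]
  {τ : Space d → Ω → Ω} (hτ : IsMeasurableAction P τ)

/-- The measure on frequencies associated with a vector of `L²(Ω)`. -/
noncomputable abbrev freqMeasure (φ : Lp ℂ 2 P) : Measure (Space d) :=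
  (isUnitaryRep_shift hτ).specMeasure φ

/-- The vector `f(-i∇) φ`. -/
noncomputable abbrev symbolCalc (φ : Lp ℂ 2 P) {f : Space d → ℂ}
    (hf : MemLp f 2 (freqMeasure hτ φ)) : Lp ℂ 2 P :=
  (isUnitaryRep_shift hτ).funCalc φ hf

variable {hτ}
variable {φ : Lp ℂ 2 P} {f : Space d → ℂ}

theorem memLp_of_mem_domain_stGrad {j : Fin d} (hf : MemLp f 2 (freqMeasure hτ φ))
    (h : symbolCalc hτ φ hf ∈ (stGrad hτ j).domain) :
    MemLp (fun ξ => (ξ j : ℂ) * f ξ) 2 (freqMeasure hτ φ) := by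
  have h1 := IsUnitaryRep.memLp_of_differentiableAt (isUnitaryRep_shift hτ) φ hf h
  simpa only [inner_single] using h1

theorem memLp_I_mul_coord {μ : Measure (Space d)} {j : Fin d}
    (hj : MemLp (fun ξ => (ξ j : ℂ) * f ξ) 2 μ) :
    MemLp (fun ξ => Complex.I * (ξ j : ℂ) * f ξ) 2 μ := by
  simpa [mul_assoc] using hj.const_mul Complex.I

theorem hasDerivAt_symbolCalc {j : Fin d} (hf : MemLp f 2 (freqMeasure hτ φ))
    (hj : MemLp (fun ξ => (ξ j : ℂ) * f ξ) 2 (freqMeasure hτ φ)) :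
    HasDerivAt (fun t : ℝ => shift hτ (t • EuclideanSpace.single j (1 : ℝ)) (symbolCalc hτ φ hf))
      (symbolCalc hτ φ (memLp_I_mul_coord hj)) 0 := by
  have hv : MemLp (fun ξ => (⟪ξ, EuclideanSpace.single j (1 : ℝ)⟫ : ℂ) * f ξ) 2
      (freqMeasure hτ φ) := by
    simpa only [inner_single] using hj
  have h := IsUnitaryRep.hasDerivAt_funCalc (isUnitaryRep_shift hτ) φ hf hv
  exact h.congr_deriv (IsUnitaryRep.funCalc_congr _ _ _ (memLp_I_mul_coord hj)
    (funext fun ξ => by rw [inner_single]))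

theorem symbolCalc_mem_domain_stGrad {j : Fin d} (hf : MemLp f 2 (freqMeasure hτ φ))
    (hj : MemLp (fun ξ => (ξ j : ℂ) * f ξ) 2 (freqMeasure hτ φ)) :
    symbolCalc hτ φ hf ∈ (stGrad hτ j).domain :=
  (hasDerivAt_symbolCalc hf hj).differentiableAt

theorem stGrad_symbolCalc {j : Fin d} (hf : MemLp f 2 (freqMeasure hτ φ))
    (hj : MemLp (fun ξ => (ξ j : ℂ) * f ξ) 2 (freqMeasure hτ φ))
    (h : symbolCalc hτ φ hf ∈ (stGrad hτ j).domain) :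
    stGrad hτ j ⟨symbolCalc hτ φ hf, h⟩ = symbolCalc hτ φ (memLp_I_mul_coord hj) :=
  (hasDerivAt_symbolCalc hf hj).deriv

/-- All coordinate monomials of degree at most two are controlled by `1 + ‖ξ‖²`, so this one weight
suffices for membership in `H²(Ω)`. -/
theorem memLp_of_norm_le_add {μ : Measure (Space d)} {g : Space d → ℂ} (hf : MemLp f 2 μ)
    (h2 : MemLp (fun ξ => ((‖ξ‖ ^ 2 : ℝ) : ℂ) * f ξ) 2 μ) (hg : Continuous g)
    (hle : ∀ ξ, ‖g ξ‖ ≤ 1 + ‖ξ‖ ^ 2) : MemLp (fun ξ => g ξ * f ξ) 2 μ := by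
  refine (hf.norm.add h2.norm).of_le (hg.aestronglyMeasurable.mul hf.1) (.of_forall fun ξ => ?_)
  rw [norm_mul, Pi.add_apply, norm_mul, Complex.norm_real, Real.norm_of_nonneg (sq_nonneg ‖ξ‖),
    Real.norm_of_nonneg (by positivity)]
  nlinarith [hle ξ, norm_nonneg (f ξ)]

theorem symbolCalc_mem_sobolevTwo (hf : MemLp f 2 (freqMeasure hτ φ))
    (h2 : MemLp (fun ξ => ((‖ξ‖ ^ 2 : ℝ) : ℂ) * f ξ) 2 (freqMeasure hτ φ)) :
    symbolCalc hτ φ hf ∈ sobolevTwo hτ := by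
  intro j
  have hj : MemLp (fun ξ => (ξ j : ℂ) * f ξ) 2 (freqMeasure hτ φ) := by
    refine memLp_of_norm_le_add hf h2 (by fun_prop) fun ξ => ?_
    rw [Complex.norm_real, Real.norm_eq_abs]
    nlinarith [abs_apply_le_norm ξ j, sq_nonneg (‖ξ‖ - 1)]
  refine ⟨symbolCalc_mem_domain_stGrad hf hj, fun l => ?_⟩
  rw [stGrad_symbolCalc hf hj]
  refine symbolCalc_mem_domain_stGrad _ ?_
  have h3 : MemLp (fun ξ => (Complex.I * (ξ l : ℂ) * (ξ j : ℂ)) * f ξ) 2 (freqMeasure hτ φ) := by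
    refine memLp_of_norm_le_add hf h2 (by fun_prop) fun ξ => ?_
    rw [norm_mul, norm_mul, Complex.norm_I, one_mul, Complex.norm_real, Complex.norm_real,
      Real.norm_eq_abs, Real.norm_eq_abs]
    nlinarith [abs_apply_le_norm ξ j, abs_apply_le_norm ξ l, abs_nonneg (ξ j), abs_nonneg (ξ l),
      norm_nonneg ξ]
  refine (memLp_congr_ae (.of_forall fun ξ => ?_)).1 h3
  ring

/-- Each derivative contributes a factor `iξ_j`, and `-∑(iξ_j)² - 2i∑ k_j (iξ_j)` is the dispersion
relation. Taking `f = 1` covers the entire domain, since `symbolCalc` at `1` returns `φ`. -/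
theorem fiberedOp_symbolCalc (k : Space d) (hf : MemLp f 2 (freqMeasure hτ φ))
    (h : symbolCalc hτ φ hf ∈ (fiberedOp hτ k).domain) :
    ∃ hm : MemLp (fun ξ => (dispersion k ξ : ℂ) * f ξ) 2 (freqMeasure hτ φ),
      fiberedOp hτ k ⟨symbolCalc hτ φ hf, h⟩ = symbolCalc hτ φ hm := by
  have hj : ∀ j, MemLp (fun ξ => (ξ j : ℂ) * f ξ) 2 (freqMeasure hτ φ) := fun j =>
    memLp_of_mem_domain_stGrad hf (h j).1
  have hjj : ∀ j, MemLp (fun ξ => (ξ j : ℂ) * (Complex.I * (ξ j : ℂ) * f ξ)) 2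
      (freqMeasure hτ φ) := fun j => by
    have h1 := (h j).2 j
    rw [stGrad_symbolCalc hf (hj j)] at h1
    exact memLp_of_mem_domain_stGrad _ h1
  have e1 : ∀ j, stGrad hτ j ⟨stGrad hτ j ⟨symbolCalc hτ φ hf, (h j).1⟩, (h j).2 j⟩ =
      symbolCalc hτ φ (memLp_I_mul_coord (hjj j)) := fun j => by
    rw [← stGrad_symbolCalc (memLp_I_mul_coord (hj j)) (hjj j)
      (symbolCalc_mem_domain_stGrad _ (hjj j))]
    congr 1
    exact Subtype.ext (stGrad_symbolCalc hf (hj j) _)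
  have e2 : ∀ j, (k j : ℂ) • stGrad hτ j ⟨symbolCalc hτ φ hf, (h j).1⟩ =
      symbolCalc hτ φ ((memLp_I_mul_coord (hj j)).const_smul (k j : ℂ)) := fun j => by
    rw [stGrad_symbolCalc hf (hj j)]
    exact (IsUnitaryRep.funCalc_smul _ _ _ _).symm
  have h3 := memLp_finsetSum' Finset.univ fun j _ => memLp_I_mul_coord (hjj j)
  have h4 := memLp_finsetSum' Finset.univ fun j _ =>
    (memLp_I_mul_coord (hj j)).const_smul (k j : ℂ)
  have e3 : fiberedOp hτ k ⟨symbolCalc hτ φ hf, h⟩ =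
      symbolCalc hτ φ ((h3.const_smul (-1 : ℂ)).sub (h4.const_smul (2 * Complex.I))) := by
    refine (fiberedOp_apply hτ k ⟨_, h⟩).trans ?_
    refine Eq.trans ?_ (IsUnitaryRep.funCalc_sub _ _ (h3.const_smul (-1 : ℂ))
      (h4.const_smul (2 * Complex.I))).symm
    refine congrArg₂ _ ?_ ?_
    · refine Eq.trans ?_ (IsUnitaryRep.funCalc_smul _ _ h3 _).symm
      rw [neg_one_smul]
      refine congrArg _ ((Finset.sum_congr rfl fun j _ => e1 j).trans ?_)
      exact (IsUnitaryRep.funCalc_sum _ _ _ fun j => memLp_I_mul_coord (hjj j)).symm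
    · refine Eq.trans ?_ (IsUnitaryRep.funCalc_smul _ _ h4 _).symm
      refine congrArg _ ((Finset.sum_congr rfl fun j _ => e2 j).trans ?_)
      exact (IsUnitaryRep.funCalc_sum _ _ _ fun j =>
        (memLp_I_mul_coord (hj j)).const_smul (k j : ℂ)).symm
  have hF : (-1 : ℂ) • (∑ j : Fin d, fun ξ : Space d =>
        Complex.I * (ξ j : ℂ) * (Complex.I * (ξ j : ℂ) * f ξ)) -
      (2 * Complex.I) • (∑ j : Fin d, (k j : ℂ) • fun ξ : Space d =>
        Complex.I * (ξ j : ℂ) * f ξ) = fun ξ => (dispersion k ξ : ℂ) * f ξ := by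
    funext ξ
    simp only [Pi.sub_apply, Pi.smul_apply, Finset.sum_apply, smul_eq_mul, dispersion_eq_sum]
    push_cast
    simp only [add_mul, Finset.mul_sum, Finset.sum_mul]
    rw [← Finset.sum_sub_distrib, ← Finset.sum_add_distrib]
    refine Finset.sum_congr rfl fun j _ => ?_
    linear_combination (-(ξ j : ℂ) ^ 2 * f ξ - 2 * k j * ξ j * f ξ) * Complex.I_sq
  have hc := (h3.const_smul (-1 : ℂ)).sub (h4.const_smul (2 * Complex.I))
  have hm : MemLp (fun ξ => (dispersion k ξ : ℂ) * f ξ) 2 (freqMeasure hτ φ) := hF ▸ hc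
  exact ⟨hm, e3.trans (IsUnitaryRep.funCalc_congr _ _ _ _ hF)⟩

end Fibered

end StationarySpectrum

namespace StationarySpectrum

/-! ### Resolvent, spectral measures and spectrum -/

theorem IsUnitaryRep.norm_funCalc_le {E : Type*} [NormedAddCommGroup E] [InnerProductSpace ℝ E]
    [FiniteDimensional ℝ E] [MeasurableSpace E] [BorelSpace E] {H : Type*} [NormedAddCommGroup H]
    [InnerProductSpace ℂ H] [CompleteSpace H] {T : E → H →ₗᵢ[ℂ] H} (hT : IsUnitaryRep T) (φ : H)
    {f g : E → ℂ} (hf : MemLp f 2 (hT.specMeasure φ)) (hg : MemLp g 2 (hT.specMeasure φ)) {C : ℝ}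
    (hC : 0 ≤ C) (h : ∀ ξ, ‖f ξ‖ ≤ C * ‖g ξ‖) : ‖hT.funCalc φ hf‖ ≤ C * ‖hT.funCalc φ hg‖ := by
  rw [norm_funCalc, norm_funCalc]
  have h1 := eLpNorm_le_mul_eLpNorm_of_ae_le_mul (μ := hT.specMeasure φ) (.of_forall h) 2
  have h2 := ENNReal.toReal_mono (ENNReal.mul_ne_top ENNReal.ofReal_ne_top hg.2.ne) h1
  rwa [ENNReal.toReal_mul, ENNReal.toReal_ofReal hC] at h2

section Spectrum

open scoped ComplexConjugate

variable {d : ℕ} {Ω : Type*} [MeasurableSpace Ω] {P : Measure Ω} [IsFiniteMeasure P]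
  {τ : Space d → Ω → Ω} {hτ : IsMeasurableAction P τ} {φ : Lp ℂ 2 P} {f : Space d → ℂ}

theorem fiberedOp_sub_symbolCalc (k : Space d) (z : ℂ) (hf : MemLp f 2 (freqMeasure hτ φ))
    (h : symbolCalc hτ φ hf ∈ (fiberedOp hτ k).domain) :
    ∃ hm : MemLp (fun ξ => ((dispersion k ξ : ℂ) - z) * f ξ) 2 (freqMeasure hτ φ),
      fiberedOp hτ k ⟨symbolCalc hτ φ hf, h⟩ - z • symbolCalc hτ φ hf = symbolCalc hτ φ hm := by
  obtain ⟨h1, h2⟩ := fiberedOp_symbolCalc k hf h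
  have h3 := h1.sub (hf.const_smul z)
  have hF : (fun ξ => (dispersion k ξ : ℂ) * f ξ) - z • f =
      fun ξ => ((dispersion k ξ : ℂ) - z) * f ξ := by
    funext ξ
    simp only [Pi.sub_apply, Pi.smul_apply, smul_eq_mul, sub_mul]
  have hm : MemLp (fun ξ => ((dispersion k ξ : ℂ) - z) * f ξ) 2 (freqMeasure hτ φ) := hF ▸ h3
  refine ⟨hm, ?_⟩
  rw [h2]
  refine Eq.trans ?_ (IsUnitaryRep.funCalc_congr _ _ h3 _ hF)
  exact ((IsUnitaryRep.funCalc_sub _ _ h1 (hf.const_smul z)).trans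
    (congrArg _ (IsUnitaryRep.funCalc_smul _ _ hf z))).symm

theorem symbolCalc_one (φ : Lp ℂ 2 P) : symbolCalc hτ φ (memLp_const (1 : ℂ)) = φ :=
  IsUnitaryRep.funCalc_one _ _

theorem le_norm_fiberedOp_sub {k : Space d} {z : ℂ} {δ : ℝ} (hδ : 0 < δ)
    (h : ∀ ξ, δ ≤ ‖(dispersion k ξ : ℂ) - z‖) (φ : (fiberedOp hτ k).domain) :
    ‖(φ : Lp ℂ 2 P)‖ ≤ δ⁻¹ * ‖fiberedOp hτ k φ - z • (φ : Lp ℂ 2 P)‖ := by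
  obtain ⟨φ, hφ⟩ := φ
  have e := symbolCalc_one (hτ := hτ) φ
  have h1 : symbolCalc hτ φ (memLp_const (1 : ℂ)) ∈ (fiberedOp hτ k).domain := by rwa [e]
  obtain ⟨h2, h3⟩ := fiberedOp_sub_symbolCalc k z _ h1
  have e2 : (⟨φ, hφ⟩ : (fiberedOp hτ k).domain) = ⟨symbolCalc hτ φ (memLp_const (1 : ℂ)), h1⟩ :=
    Subtype.ext e.symm
  rw [e2]
  change ‖symbolCalc hτ φ (memLp_const (1 : ℂ))‖ ≤ _ * ‖_ - z • symbolCalc hτ φ _‖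
  rw [h3]
  refine IsUnitaryRep.norm_funCalc_le _ _ _ _ (inv_nonneg.2 hδ.le) fun ξ => ?_
  rw [norm_one, mul_one, ← div_eq_inv_mul, le_div_iff₀ hδ, one_mul]
  exact h ξ

theorem fiberedOp_sub_injective {k : Space d} {z : ℂ} {δ : ℝ} (hδ : 0 < δ)
    (h : ∀ ξ, δ ≤ ‖(dispersion k ξ : ℂ) - z‖) {φ ψ : (fiberedOp hτ k).domain}
    (he : fiberedOp hτ k φ - z • (φ : Lp ℂ 2 P) = fiberedOp hτ k ψ - z • (ψ : Lp ℂ 2 P)) :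
    φ = ψ := by
  have h1 := le_norm_fiberedOp_sub hδ h (φ - ψ)
  rw [LinearPMap.map_sub, Submodule.coe_sub, smul_sub, sub_sub_sub_comm, he, sub_self, norm_zero,
    mul_zero] at h1
  exact Subtype.ext (sub_eq_zero.1 (norm_le_zero_iff.1 h1))

/-- The solution is `(dispersion - z)⁻¹` applied through the functional calculus. It lies in `H²(Ω)`
because `‖ξ‖²` is bounded by a multiple of the symbol plus a constant, so `‖ξ‖²` times the inverse
stays bounded. -/
theorem exists_fiberedOp_sub_eq {k : Space d} {z : ℂ} {δ : ℝ} (hδ : 0 < δ)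
    (h : ∀ ξ, δ ≤ ‖(dispersion k ξ : ℂ) - z‖) (φ : Lp ℂ 2 P) :
    ∃ ψ : (fiberedOp hτ k).domain, fiberedOp hτ k ψ - z • (ψ : Lp ℂ 2 P) = φ ∧
      inner ℂ φ (ψ : Lp ℂ 2 P) = ∫ ξ, ((dispersion k ξ : ℂ) - z)⁻¹ ∂(freqMeasure hτ φ) := by
  have hne : ∀ ξ, (dispersion k ξ : ℂ) - z ≠ 0 := fun ξ h0 => by
    have := h ξ
    rw [h0, norm_zero] at this
    exact absurd this (not_le.2 hδ)
  have hc : Continuous fun ξ => ((dispersion k ξ : ℂ) - z)⁻¹ := by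
    refine Continuous.inv₀ ?_ hne
    exact (Complex.continuous_ofReal.comp (continuous_dispersion k)).sub continuous_const
  have hb : ∀ ξ, ‖((dispersion k ξ : ℂ) - z)⁻¹‖ ≤ δ⁻¹ := fun ξ => by
    rw [norm_inv]
    exact inv_anti₀ hδ (h ξ)
  have hf : MemLp (fun ξ => ((dispersion k ξ : ℂ) - z)⁻¹) 2 (freqMeasure hτ φ) :=
    MemLp.of_bound hc.aestronglyMeasurable _ (.of_forall hb)
  have h2 : MemLp (fun ξ => ((‖ξ‖ ^ 2 : ℝ) : ℂ) * ((dispersion k ξ : ℂ) - z)⁻¹) 2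
      (freqMeasure hτ φ) := by
    refine MemLp.of_bound (Continuous.aestronglyMeasurable (by fun_prop))
      (2 + (2 * ‖z‖ + 4 * ‖k‖ ^ 2) * δ⁻¹) (.of_forall fun ξ => ?_)
    have e1 : ‖ξ‖ ^ 2 ≤ 2 * ‖(dispersion k ξ : ℂ) - z‖ + (2 * ‖z‖ + 4 * ‖k‖ ^ 2) := by
      have e2 : dispersion k ξ ≤ ‖(dispersion k ξ : ℂ) - z‖ + ‖z‖ := by
        refine (le_abs_self _).trans ?_
        rw [← Real.norm_eq_abs, ← Complex.norm_real]
        simpa using norm_add_le ((dispersion k ξ : ℂ) - z) z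
      linarith [norm_sq_le_dispersion k ξ]
    rw [norm_mul, Complex.norm_real, Real.norm_of_nonneg (sq_nonneg ‖ξ‖)]
    refine (mul_le_mul_of_nonneg_right e1 (norm_nonneg _)).trans ?_
    rw [add_mul, mul_assoc, ← norm_mul, mul_inv_cancel₀ (hne ξ), norm_one, mul_one]
    gcongr
    exact hb ξ
  have hd : symbolCalc hτ φ hf ∈ (fiberedOp hτ k).domain := symbolCalc_mem_sobolevTwo hf h2
  obtain ⟨hm, h3⟩ := fiberedOp_sub_symbolCalc k z hf hd
  refine ⟨⟨_, hd⟩, h3.trans ?_, ?_⟩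
  · refine (IsUnitaryRep.funCalc_congr _ _ hm (memLp_const (1 : ℂ)) (funext fun ξ => ?_)).trans
      (symbolCalc_one φ)
    exact mul_inv_cancel₀ (hne ξ)
  · have h4 := IsUnitaryRep.inner_funCalc (isUnitaryRep_shift hτ) φ (memLp_const (1 : ℂ)) hf
    rw [IsUnitaryRep.funCalc_one] at h4
    simpa using h4

theorem mem_resolventSet_fiberedOp {k : Space d} {z : ℂ} {δ : ℝ} (hδ : 0 < δ)
    (h : ∀ ξ, δ ≤ ‖(dispersion k ξ : ℂ) - z‖) : z ∈ resolventSet (fiberedOp hτ k) := by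
  let B : (fiberedOp hτ k).domain →ₗ[ℂ] Lp ℂ 2 P :=
    (fiberedOp hτ k).toFun - z • (fiberedOp hτ k).domain.subtype
  have hB : ∀ φ, B φ = fiberedOp hτ k φ - z • (φ : Lp ℂ 2 P) := fun φ => rfl
  let e := LinearEquiv.ofBijective B ⟨fun φ ψ he => fiberedOp_sub_injective hδ h he, fun φ => by
    obtain ⟨ψ, hψ, -⟩ := exists_fiberedOp_sub_eq (hτ := hτ) hδ h φ
    exact ⟨ψ, hψ⟩⟩
  have he : ∀ φ, B (e.symm φ) = φ := fun φ => e.apply_symm_apply φ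
  let R : Lp ℂ 2 P →L[ℂ] Lp ℂ 2 P :=
    ((fiberedOp hτ k).domain.subtype ∘ₗ e.symm.toLinearMap).mkContinuous δ⁻¹ fun φ => by
      have h1 := le_norm_fiberedOp_sub hδ h (e.symm φ)
      rw [← hB, he] at h1
      exact h1
  refine ⟨R, fun ψ => ⟨(e.symm ψ).2, he ψ⟩, fun φ => ?_⟩
  exact congrArg Subtype.val (e.symm_apply_apply φ)

theorem exists_le_norm_dispersion_sub (k : Space d) {z : ℂ}
    (hz : z ∉ (fun t : ℝ => (t : ℂ)) '' Set.Ici (-‖k‖ ^ 2)) :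
    ∃ δ : ℝ, 0 < δ ∧ ∀ ξ, δ ≤ ‖(dispersion k ξ : ℂ) - z‖ := by
  have hcl : IsClosed ((fun t : ℝ => (t : ℂ)) '' Set.Ici (-‖k‖ ^ 2)) :=
    Complex.isometry_ofReal.isClosedEmbedding.isClosedMap _ isClosed_Ici
  obtain ⟨δ, hδ, h⟩ := Metric.isOpen_iff.1 hcl.isOpen_compl z hz
  refine ⟨δ, hδ, fun ξ => ?_⟩
  by_contra! hlt
  exact h (by rwa [Metric.mem_ball, dist_eq_norm])
    ⟨dispersion k ξ, neg_norm_sq_le_dispersion k ξ, rfl⟩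

theorem exists_dispersion_eq (hd : 0 < d) (k : Space d) {t : ℝ} (ht : -‖k‖ ^ 2 ≤ t) :
    ∃ ξ, dispersion k ξ = t := by
  refine ⟨EuclideanSpace.single ⟨0, hd⟩ (√(t + ‖k‖ ^ 2)) - k, ?_⟩
  rw [dispersion, sub_add_cancel, PiLp.norm_single,
    Real.norm_of_nonneg (Real.sqrt_nonneg _), Real.sq_sqrt (by linarith)]
  ring

/-- The spectral measure of the fibered operator is the image of the frequency measure under the
symbol. -/
theorem isSpectralMeasure_map_dispersion (k : Space d) (φ : Lp ℂ 2 P) :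
    IsSpectralMeasure (fiberedOp hτ k) φ ((freqMeasure hτ φ).map (dispersion k)) := by
  refine ⟨inferInstance, fun z hz => ?_⟩
  obtain ⟨δ, hδ, h⟩ := exists_le_norm_dispersion_sub k (z := z) (by
    rintro ⟨t, -, rfl⟩
    exact hz (Complex.ofReal_im t))
  obtain ⟨ψ, h1, h2⟩ := exists_fiberedOp_sub_eq (hτ := hτ) hδ h φ
  refine ⟨ψ, h1, h2.trans ?_⟩
  rw [integral_map (continuous_dispersion k).aemeasurable]
  exact Measurable.aestronglyMeasurable (by fun_prop)

/-- At nonreal `z` the resolvent equation has a unique solution, so any two spectral measures of `φ`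
have the same Stieltjes transform. -/
theorem IsSpectralMeasure.eq_map_dispersion {k : Space d} {μ : Measure ℝ}
    (hμ : IsSpectralMeasure (fiberedOp hτ k) φ μ) :
    μ = (freqMeasure hτ φ).map (dispersion k) := by
  have hν := isSpectralMeasure_map_dispersion (hτ := hτ) k φ
  have := hμ.1
  refine Measure.ext_of_stieltjes fun z hz => ?_
  obtain ⟨δ, hδ, h⟩ := exists_le_norm_dispersion_sub k (z := z) (by
    rintro ⟨t, -, rfl⟩
    exact hz (Complex.ofReal_im t))
  obtain ⟨ψ, h1, h2⟩ := hμ.2 z hz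
  obtain ⟨ψ', h1', h2'⟩ := hν.2 z hz
  rw [← h2, ← h2', fiberedOp_sub_injective hδ h (h1.trans h1'.symm)]

/-- Off the range of the symbol the resolvent is division by a function bounded away from zero. On
the range, cutting a charged vector to a small frequency ball produces an approximate eigenvector,
incompatible with a bounded resolvent. -/
theorem spectrumSet_fiberedOp (hd : 0 < d) (k : Space d)
    (hball : ∀ (ξ : Space d) (r : ℝ), 0 < r → ∃ φ : Lp ℂ 2 P,
      freqMeasure hτ φ (Metric.ball ξ r) ≠ 0) :
    spectrumSet (fiberedOp hτ k) = (fun t : ℝ => (t : ℂ)) '' Set.Ici (-‖k‖ ^ 2) := by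
  refine Set.Subset.antisymm (fun z hz => ?_) ?_
  · by_contra hz'
    obtain ⟨δ, hδ, h⟩ := exists_le_norm_dispersion_sub k hz'
    exact hz (mem_resolventSet_fiberedOp hδ h)
  · rintro _ ⟨t, ht, rfl⟩ ⟨R, -, hR⟩
    obtain ⟨ξ₀, hξ₀⟩ := exists_dispersion_eq hd k ht
    -- Chosen so that `‖R‖ * ε < 1`: the localised vector would satisfy `‖w‖ ≤ ‖R‖ ε ‖w‖` and be
    -- zero.
    set ε : ℝ := (‖R‖ + 1)⁻¹ with hε
    have hR0 : 0 < ‖R‖ + 1 := by positivity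
    obtain ⟨r, hr, hball'⟩ := Metric.continuous_iff.1 (continuous_dispersion k) ξ₀ ε (by positivity)
    obtain ⟨φ, hφ⟩ := hball ξ₀ r hr
    set U := Metric.ball ξ₀ r
    have hU : MeasurableSet U := measurableSet_ball
    have hbU : ∀ ξ ∈ U, ‖ξ‖ ^ 2 ≤ (‖ξ₀‖ + r) ^ 2 := fun ξ hξ => by
      refine pow_le_pow_left₀ (norm_nonneg _) ?_ 2
      have h1 : ‖ξ - ξ₀‖ < r := by rwa [← dist_eq_norm]
      have h2 := norm_add_le (ξ - ξ₀) ξ₀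
      rw [sub_add_cancel] at h2
      linarith
    have hf : MemLp (U.indicator fun _ => (1 : ℂ)) 2 (freqMeasure hτ φ) :=
      memLp_indicator_const 2 hU 1 (.inr (measure_ne_top _ _))
    have h2 : MemLp (fun ξ => ((‖ξ‖ ^ 2 : ℝ) : ℂ) * U.indicator (fun _ => (1 : ℂ)) ξ) 2
        (freqMeasure hτ φ) := by
      refine MemLp.of_bound (AEStronglyMeasurable.mul (by fun_prop) hf.1) ((‖ξ₀‖ + r) ^ 2)
        (.of_forall fun ξ => ?_)
      by_cases hξ : ξ ∈ U
      · rw [Set.indicator_of_mem hξ, mul_one, Complex.norm_real, Real.norm_of_nonneg (by positivity)]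
        exact hbU ξ hξ
      · rw [Set.indicator_of_notMem hξ, mul_zero, norm_zero]
        positivity
    have hdom : symbolCalc hτ φ hf ∈ (fiberedOp hτ k).domain := symbolCalc_mem_sobolevTwo hf h2
    obtain ⟨hm, h3⟩ := fiberedOp_sub_symbolCalc k t hf hdom
    have h4 := hR ⟨_, hdom⟩
    have h5 : ‖symbolCalc hτ φ hm‖ ≤ ε * ‖symbolCalc hτ φ hf‖ := by
      refine IsUnitaryRep.norm_funCalc_le _ _ _ _ (by positivity) fun ξ => ?_
      rw [norm_mul]
      by_cases hξ : ξ ∈ U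
      · refine mul_le_mul_of_nonneg_right ?_ (norm_nonneg _)
        rw [← Complex.ofReal_sub, Complex.norm_real, ← hξ₀, ← dist_eq_norm]
        exact (hball' ξ hξ).le
      · simp [Set.indicator_of_notMem hξ]
    have h6 : 0 < ‖symbolCalc hτ φ hf‖ := by
      refine norm_pos_iff.2 fun h0 => hφ ?_
      have h1 := IsUnitaryRep.norm_sq_funCalc (isUnitaryRep_shift hτ) φ hf
      rw [show IsUnitaryRep.funCalc _ φ hf = 0 from h0, norm_zero] at h1
      have h8 : ∀ ξ, ‖U.indicator (fun _ => (1 : ℂ)) ξ‖ ^ 2 = U.indicator (fun _ => (1 : ℝ)) ξ :=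
        fun ξ => by by_cases hξ : ξ ∈ U <;> simp [hξ]
      simp_rw [h8] at h1
      rw [integral_indicator_const _ hU] at h1
      simpa [measureReal_def, ENNReal.toReal_eq_zero_iff, measure_ne_top] using h1.symm
    have h7 : ‖symbolCalc hτ φ hf‖ ≤ ‖R‖ * (ε * ‖symbolCalc hτ φ hf‖) := by
      have h8 := R.le_opNorm (fiberedOp hτ k ⟨_, hdom⟩ - (t : ℂ) • symbolCalc hτ φ hf)
      rw [h3] at h8
      rw [h3] at h4
      rw [h4] at h8
      exact h8.trans (mul_le_mul_of_nonneg_left h5 (norm_nonneg _))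
    have h9 : ‖R‖ * ε < 1 := by
      rw [hε, ← div_eq_mul_inv, div_lt_one hR0]
      linarith
    nlinarith

end Spectrum

end StationarySpectrum

namespace StationarySpectrum

/-! ### The closed subspace of absolutely continuous vectors -/

section AbsolutelyContinuousVectors

open scoped RealInnerProductSpace ComplexConjugate FourierTransform

variable {E : Type*} [NormedAddCommGroup E] [InnerProductSpace ℝ E] [FiniteDimensional ℝ E]
  [MeasurableSpace E] [BorelSpace E]
variable {H : Type*} [NormedAddCommGroup H] [InnerProductSpace ℂ H] [CompleteSpace H]

theorem charFun_add_measure (μ ν : Measure E) [IsFiniteMeasure μ] [IsFiniteMeasure ν] (t : E) :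
    charFun (μ + ν) t = charFun μ t + charFun ν t := by
  have h : ∀ m : Measure E, IsFiniteMeasure m →
      Integrable (fun x => Complex.exp (⟪x, t⟫ * Complex.I)) m := fun m _ =>
    (memLp_char m t).integrable (by norm_num)
  simp only [charFun_apply]
  exact integral_add_measure (h μ inferInstance) (h ν inferInstance)

/-- The Riemann-Lebesgue lemma for absolutely continuous measures. -/
theorem tendsto_integral_char_mul_cocompact {μ : Measure E} [IsFiniteMeasure μ] (h : μ ≪ volume)
    (g : E → ℂ) : Tendsto (fun x => ∫ ξ, char x ξ * g ξ ∂μ) (cocompact E) (𝓝 0) := by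
  have h1 := tendsto_integral_exp_inner_smul_cocompact
    (fun ξ : E => (μ.rnDeriv volume ξ).toReal • g ξ)
  have hc : -(2 * Real.pi)⁻¹ ≠ 0 := by simp [Real.pi_ne_zero]
  have h2 : Tendsto (fun x : E => (-(2 * Real.pi)⁻¹) • x) (cocompact E) (cocompact E) :=
    (Homeomorph.smulOfNeZero (-(2 * Real.pi)⁻¹) hc).isClosedEmbedding.tendsto_cocompact
  refine (h1.comp h2).congr fun x => ?_
  rw [← integral_rnDeriv_smul h]
  refine integral_congr_ae (.of_forall fun ξ => ?_)
  simp only [Real.fourierChar_apply, Circle.smul_def, smul_eq_mul, Complex.real_smul,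
    inner_smul_right, char]
  rw [mul_left_comm]
  congr 4
  have := Real.pi_ne_zero
  push_cast
  field_simp

namespace IsUnitaryRep

variable {T : E → H →ₗᵢ[ℂ] H} (hT : IsUnitaryRep T)

theorem specMeasure_eq {φ : H} {m : Measure E} [IsFiniteMeasure m]
    (h : ∀ x, charFun m x = inner ℂ φ (T x φ)) : hT.specMeasure φ = m :=
  Measure.ext_of_charFun (funext fun x => by rw [charFun_specMeasure, h])

theorem specMeasure_univ (φ : H) : hT.specMeasure φ Set.univ = ENNReal.ofReal (‖φ‖ ^ 2) := by
  have h := hT.charFun_specMeasure φ 0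
  rw [charFun_zero, hT.zero, inner_self_eq_norm_sq_to_K, ← RCLike.ofReal_pow] at h
  have h2 : (hT.specMeasure φ).real Set.univ = ‖φ‖ ^ 2 := Complex.ofReal_injective h
  rw [← h2, ofReal_measureReal]

/-- Cross terms in the correlations cancel. Discarding one of the two positive measures on the left
bounds the spectral measure of a sum, which makes `acVectors` a closed subspace. -/
theorem specMeasure_parallelogram (φ ψ : H) :
    hT.specMeasure (φ + ψ) + hT.specMeasure (φ - ψ) =
      (2 : ℝ≥0∞) • hT.specMeasure φ + (2 : ℝ≥0∞) • hT.specMeasure ψ := by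
  have := (hT.specMeasure φ).smul_finite ENNReal.ofNat_ne_top (c := 2)
  have := (hT.specMeasure ψ).smul_finite ENNReal.ofNat_ne_top (c := 2)
  refine Measure.ext_of_charFun (funext fun x => ?_)
  rw [charFun_add_measure, charFun_add_measure, charFun_smul_measure, charFun_smul_measure]
  simp only [charFun_specMeasure, map_add, map_sub, inner_add_left, inner_add_right,
    inner_sub_left, inner_sub_right, ENNReal.toReal_ofNat]
  push_cast
  ring

theorem specMeasure_add_le (φ ψ : H) (A : Set E) : hT.specMeasure (φ + ψ) A ≤
    2 * hT.specMeasure φ A + 2 * hT.specMeasure ψ A := by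
  have h := congrArg (fun m : Measure E => m A) (hT.specMeasure_parallelogram φ ψ)
  simp only [Measure.add_apply, Measure.smul_apply, smul_eq_mul] at h
  rw [← h]
  exact le_self_add

theorem specMeasure_smul (c : ℂ) (φ : H) :
    hT.specMeasure (c • φ) = ENNReal.ofReal (‖c‖ ^ 2) • hT.specMeasure φ := by
  have := (hT.specMeasure φ).smul_finite (c := ENNReal.ofReal (‖c‖ ^ 2)) ENNReal.ofReal_ne_top
  refine hT.specMeasure_eq fun x => ?_
  rw [charFun_smul_measure, charFun_specMeasure, map_smul, inner_smul_left, inner_smul_right,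
    ENNReal.toReal_ofReal (by positivity), ← mul_assoc, Complex.conj_mul']
  push_cast
  rfl

/-- The vectors whose spectral measure is absolutely continuous. -/
noncomputable def acVectors : Submodule ℂ H where
  carrier := {φ | hT.specMeasure φ ≪ volume}
  add_mem' := fun {φ ψ} hφ hψ A hA => by
    have h := hT.specMeasure_add_le φ ψ A
    rw [hφ hA, hψ hA] at h
    simpa using h
  zero_mem' := fun A _ => by
    refine measure_mono_null (Set.subset_univ A) ?_
    simp [specMeasure_univ]
  smul_mem' := fun c φ hφ A hA => by
    rw [specMeasure_smul, Measure.smul_apply, hφ hA, smul_zero]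

theorem mem_acVectors {φ : H} : φ ∈ hT.acVectors ↔ hT.specMeasure φ ≪ volume := Iff.rfl

theorem isClosed_acVectors : IsClosed (hT.acVectors : Set H) := by
  refine isClosed_of_closure_subset fun φ hφ A hA => ?_
  rw [mem_closure_iff_seq_limit] at hφ
  obtain ⟨ψ, hψ, hlim⟩ := hφ
  have h1 : ∀ n, hT.specMeasure φ A ≤ 2 * ENNReal.ofReal (‖φ - ψ n‖ ^ 2) := fun n => by
    have h := hT.specMeasure_add_le (ψ n) (φ - ψ n) A
    rw [add_sub_cancel, hψ n hA, mul_zero, zero_add] at h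
    refine h.trans (mul_le_mul_right ?_ 2)
    rw [← hT.specMeasure_univ]
    exact measure_mono (Set.subset_univ A)
  have h2 : Tendsto (fun n => 2 * ENNReal.ofReal (‖φ - ψ n‖ ^ 2)) atTop (𝓝 0) := by
    have h3 : Tendsto (fun n => ‖φ - ψ n‖ ^ 2) atTop (𝓝 0) := by
      have := ((tendsto_const_nhds (x := φ)).sub hlim).norm.pow 2
      simpa using this
    have h4 := ENNReal.Tendsto.const_mul (a := 2) (ENNReal.tendsto_ofReal h3)
      (.inr ENNReal.ofNat_ne_top)
    simpa using h4
  exact le_antisymm (ge_of_tendsto' h2 h1) zero_le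

/-- The spectral measure of a vector splits along an invariant vector. -/
theorem specMeasure_add_of_fixed {e φ : H} (he : ∀ x, T x e = e) (hφ : inner ℂ e φ = 0) :
    hT.specMeasure (e + φ) = ENNReal.ofReal (‖e‖ ^ 2) • Measure.dirac 0 + hT.specMeasure φ := by
  have := (Measure.dirac (0 : E)).smul_finite (c := ENNReal.ofReal (‖e‖ ^ 2)) ENNReal.ofReal_ne_top
  refine hT.specMeasure_eq fun x => ?_
  have h1 : inner ℂ e (T x φ) = 0 := by
    rw [← he x, LinearIsometry.inner_map_map, hφ]
  rw [charFun_add_measure, charFun_smul_measure, charFun_specMeasure, map_add, he,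
    inner_add_left, inner_add_right, inner_add_right, h1, inner_eq_zero_symm.1 hφ,
    inner_self_eq_norm_sq_to_K, charFun_dirac, ENNReal.toReal_ofReal (by positivity)]
  simp

/-- The adjoint of the cyclic isometry moves `φ` into `L²` of the spectral measure of `ψ`, where the
inner product is a Fourier coefficient and Riemann-Lebesgue applies. -/
theorem tendsto_inner_cocompact_of_mem_acVectors (φ : H) {ψ : H}
    (hψ : ψ ∈ hT.acVectors) :
    Tendsto (fun x => inner ℂ φ (T x ψ)) (cocompact E) (𝓝 0) := by
  set g := ContinuousLinearMap.adjoint (hT.cyclic ψ).toContinuousLinearMap φ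
  refine (tendsto_integral_char_mul_cocompact hψ fun ξ => conj (g ξ)).congr fun x => ?_
  rw [← hT.cyclic_char ψ x]
  have h : inner ℂ g ((memLp_char _ x).toLp (char x)) =
      inner ℂ φ (hT.cyclic ψ ((memLp_char _ x).toLp (char x))) :=
    ContinuousLinearMap.adjoint_inner_left _ _ _
  rw [← h, ← Lp.toLp_coeFn g (Lp.memLp g), inner_toLp]
  refine integral_congr_ae ?_
  filter_upwards [(Lp.memLp g).coeFn_toLp] with ξ hξ
  rw [hξ, mul_comm]

end IsUnitaryRep

end AbsolutelyContinuousVectors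

end StationarySpectrum

namespace StationarySpectrum

/-! ### Mixing and full support of the frequency measures -/

section FullSupport

open scoped RealInnerProductSpace ComplexConjugate

variable {d : ℕ} {Ω : Type*} [MeasurableSpace Ω] {P : Measure Ω} [IsProbabilityMeasure P]
  {τ : Space d → Ω → Ω}

theorem inner_shift_toLp (hτ : IsMeasurableAction P τ) {u v : Ω → ℂ} (hu : MemLp u 2 P)
    (hv : MemLp v 2 P) (x : Space d) :
    inner ℂ (hu.toLp u) (shift hτ x (hv.toLp v)) = ∫ ω, conj (u ω) * field τ v x ω ∂P := by
  rw [shift_toLp, inner_toLp]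

variable (P) in
/-- The constant function `1`. -/
noncomputable def oneVec : Lp ℂ 2 P := (memLp_const (1 : ℂ)).toLp _

theorem shift_oneVec (hτ : IsMeasurableAction P τ) (x : Space d) :
    shift hτ x (oneVec P) = oneVec P := shift_toLp hτ x _

theorem inner_oneVec_toLp {u : Ω → ℂ} (hu : MemLp u 2 P) :
    inner ℂ (oneVec P) (hu.toLp u) = ∫ ω, u ω ∂P := by
  rw [oneVec, inner_toLp]
  simp

theorem norm_oneVec : ‖oneVec P‖ = 1 := by
  have h := inner_oneVec_toLp (P := P) (memLp_const (1 : ℂ))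
  rw [← oneVec, inner_self_eq_norm_sq_to_K, ← RCLike.ofReal_pow] at h
  simp only [integral_const, probReal_univ, one_smul] at h
  have h2 : ‖oneVec P‖ ^ 2 = 1 := Complex.ofReal_injective (h.trans Complex.ofReal_one.symm)
  exact (pow_eq_one_iff_of_nonneg (norm_nonneg _) two_ne_zero).1 h2

theorem toLp_const_eq_smul_oneVec (c : ℂ) :
    (memLp_const c : MemLp (fun _ : Ω => c) 2 P).toLp _ = c • oneVec P := by
  rw [oneVec, ← MemLp.toLp_const_smul]
  exact MemLp.toLp_congr _ _ (.of_forall fun ω => by simp)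

/-- The component of `φ` orthogonal to the constants. -/
noncomputable def centered (φ : Lp ℂ 2 P) : Lp ℂ 2 P := φ - inner ℂ (oneVec P) φ • oneVec P

theorem inner_oneVec_centered (φ : Lp ℂ 2 P) : inner ℂ (oneVec P) (centered φ) = 0 := by
  rw [centered, inner_sub_right, inner_smul_right, inner_self_eq_norm_sq_to_K, norm_oneVec]
  simp

theorem add_centered (φ : Lp ℂ 2 P) : inner ℂ (oneVec P) φ • oneVec P + centered φ = φ := by
  rw [centered, add_sub_cancel]

theorem freqMeasure_eq_add (hτ : IsMeasurableAction P τ) (φ : Lp ℂ 2 P) :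
    freqMeasure hτ φ = ENNReal.ofReal (‖inner ℂ (oneVec P) φ‖ ^ 2) • Measure.dirac 0 +
      freqMeasure hτ (centered φ) := by
  have h := IsUnitaryRep.specMeasure_add_of_fixed (isUnitaryRep_shift hτ)
    (e := inner ℂ (oneVec P) φ • oneVec P) (φ := centered φ)
    (fun x => by rw [map_smul, shift_oneVec]) (by
      rw [inner_smul_left, inner_oneVec_centered, mul_zero])
  rw [add_centered, norm_smul, norm_oneVec, mul_one] at h
  exact h

theorem charFun_freqMeasure_centered (hτ : IsMeasurableAction P τ) (φ : Lp ℂ 2 P) (x : Space d) :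
    charFun (freqMeasure hτ (centered φ)) x =
      charFun (freqMeasure hτ φ) x - ((‖inner ℂ (oneVec P) φ‖ ^ 2 : ℝ) : ℂ) := by
  have := (Measure.dirac (0 : Space d)).smul_finite
    (c := ENNReal.ofReal (‖inner ℂ (oneVec P) φ‖ ^ 2)) ENNReal.ofReal_ne_top
  rw [freqMeasure_eq_add hτ φ, charFun_add_measure, charFun_smul_measure, charFun_dirac,
    ENNReal.toReal_ofReal (by positivity), inner_zero_left, Complex.ofReal_zero, zero_mul,
    Complex.exp_zero, mul_one, add_sub_cancel_left]

/-- The orthogonal complement of the constants consists of vectors with absolutely continuous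
frequency measure. -/
def IsACOffConstants (hτ : IsMeasurableAction P τ) : Prop :=
  ∀ φ : Lp ℂ 2 P, inner ℂ (oneVec P) φ = 0 → freqMeasure hτ φ ≪ volume

variable {hτ : IsMeasurableAction P τ}

/-- Mixing of the action: the centered part of `ψ` decorrelates under far shifts, and the constant
part is invariant. -/
theorem IsACOffConstants.tendsto_inner (h : IsACOffConstants hτ) (φ ψ : Lp ℂ 2 P) :
    Tendsto (fun x => inner ℂ φ (shift hτ x ψ)) (cocompact (Space d))
      (𝓝 (inner ℂ φ (oneVec P) * inner ℂ (oneVec P) ψ)) := by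
  have h1 := IsUnitaryRep.tendsto_inner_cocompact_of_mem_acVectors (isUnitaryRep_shift hτ) φ
    (h _ (inner_oneVec_centered ψ))
  have h2 := h1.const_add (inner ℂ φ (oneVec P) * inner ℂ (oneVec P) ψ)
  rw [add_zero] at h2
  refine h2.congr fun x => ?_
  conv_rhs => rw [← add_centered ψ]
  rw [map_add, map_smul, shift_oneVec, inner_add_right, inner_smul_right, mul_comm]

/-- Bounded measurable functions. -/
def IsBddMeasurable (u : Ω → ℝ) : Prop := Measurable u ∧ ∃ M : ℝ, ∀ ω, |u ω| ≤ M

theorem IsBddMeasurable.memLp {u : Ω → ℝ} (hu : IsBddMeasurable u) : MemLp u 2 P := by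
  obtain ⟨M, hM⟩ := hu.2
  exact MemLp.of_bound hu.1.aestronglyMeasurable M (.of_forall hM)

theorem IsBddMeasurable.mul {u v : Ω → ℝ} (hu : IsBddMeasurable u) (hv : IsBddMeasurable v) :
    IsBddMeasurable fun ω => u ω * v ω := by
  obtain ⟨M, hM⟩ := hu.2
  obtain ⟨N, hN⟩ := hv.2
  refine ⟨hu.1.mul hv.1, M * N, fun ω => ?_⟩
  rw [abs_mul]
  exact mul_le_mul (hM ω) (hN ω) (abs_nonneg _) ((abs_nonneg _).trans (hM ω))

theorem IsBddMeasurable.field (hτ : IsMeasurableAction P τ) {u : Ω → ℝ} (hu : IsBddMeasurable u)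
    (x : Space d) : IsBddMeasurable (field τ u x) :=
  ⟨hu.1.comp (hτ.measurePreserving (-x)).measurable, hu.2.imp fun _ h _ => h _⟩

/-- A real square-integrable function as a vector of the complex space `L²(Ω)`. -/
noncomputable def toL2 {u : Ω → ℝ} (hu : MemLp u 2 P) : Lp ℂ 2 P :=
  (hu.ofReal (K := ℂ)).toLp _

theorem inner_toL2_shift (hτ : IsMeasurableAction P τ) {u v : Ω → ℝ} (hu : MemLp u 2 P)
    (hv : MemLp v 2 P) (x : Space d) :
    inner ℂ (toL2 hu) (shift hτ x (toL2 hv)) = ((∫ ω, u ω * field τ v x ω ∂P : ℝ) : ℂ) := by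
  rw [toL2, toL2, inner_shift_toLp, ← integral_complex_ofReal]
  refine integral_congr_ae (.of_forall fun ω => ?_)
  simp [field]

theorem inner_oneVec_toL2 {u : Ω → ℝ} (hu : MemLp u 2 P) :
    inner ℂ (oneVec P) (toL2 hu) = ((∫ ω, u ω ∂P : ℝ) : ℂ) := by
  rw [toL2, inner_oneVec_toLp, ← integral_complex_ofReal]
  rfl

theorem charFun_freqMeasure_toL2 {u : Ω → ℝ} (hu : MemLp u 2 P) (x : Space d) :
    charFun (freqMeasure hτ (toL2 hu)) x = ((∫ ω, u ω * field τ u x ω ∂P : ℝ) : ℂ) := by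
  rw [IsUnitaryRep.charFun_specMeasure, inner_toL2_shift]

theorem map_neg_freqMeasure_toL2 {u : Ω → ℝ} (hu : MemLp u 2 P) :
    (freqMeasure hτ (toL2 hu)).map (fun ξ => -ξ) = freqMeasure hτ (toL2 hu) := by
  refine Measure.ext_of_charFun (funext fun x => ?_)
  have h1 : charFun ((freqMeasure hτ (toL2 hu)).map (fun ξ => -ξ)) x =
      charFun (freqMeasure hτ (toL2 hu)) (-x) := by
    rw [charFun_apply, charFun_apply, integral_map (by fun_prop) (by fun_prop)]
    simp
  rw [h1, charFun_neg, charFun_freqMeasure_toL2, Complex.conj_ofReal]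

theorem eq_zero_of_freqMeasure_eq_zero {φ : Lp ℂ 2 P} (h : freqMeasure hτ φ = 0) : φ = 0 := by
  have h1 := IsUnitaryRep.specMeasure_univ (isUnitaryRep_shift hτ) φ
  rw [show IsUnitaryRep.specMeasure _ φ = 0 from h, Measure.coe_zero, Pi.zero_apply,
    eq_comm, ENNReal.ofReal_eq_zero] at h1
  exact norm_eq_zero.1 (by nlinarith [norm_nonneg φ])

theorem freqMeasure_toL2_ne_zero {u : Ω → ℝ} (hu : MemLp u 2 P) (hne : ¬ u =ᵐ[P] 0) :
    freqMeasure hτ (toL2 hu) ≠ 0 := by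
  intro h0
  have h2 := eq_zero_of_freqMeasure_eq_zero h0
  refine hne ?_
  filter_upwards [(hu.ofReal (K := ℂ)).coeFn_toLp, Lp.eq_zero_iff_ae_eq_zero.1 h2] with ω h3 h4
  rw [toL2, h3] at h4
  simpa using h4

variable (hτ) in
/-- The frequencies near which some bounded measurable function has spectral mass. -/
def chargedSet : Set (Space d) :=
  {ξ | ∀ r : ℝ, 0 < r → ∃ (u : Ω → ℝ) (hu : IsBddMeasurable u),
    freqMeasure hτ (toL2 (P := P) hu.memLp) (Metric.ball ξ r) ≠ 0}

theorem neg_mem_chargedSet {ξ : Space d} (hξ : ξ ∈ chargedSet hτ) : -ξ ∈ chargedSet hτ := by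
  intro r hr
  obtain ⟨u, hu, h⟩ := hξ r hr
  refine ⟨u, hu, ?_⟩
  rw [← map_neg_freqMeasure_toL2, Measure.map_apply (by fun_prop) measurableSet_ball]
  convert h using 2
  ext η
  simp only [Set.mem_preimage, Metric.mem_ball, dist_neg_neg]

/-- Multiply `u` by a translate of `v` going to infinity. Mixing factorises the limiting
correlation, so the frequency measures of the products approach the convolution of the two, which
charges the ball about `ξ + η`. Boundedness keeps the products square-integrable. -/
theorem IsACOffConstants.add_mem_chargedSet (hd : 0 < d) (h : IsACOffConstants hτ)
    {ξ η : Space d} (hξ : ξ ∈ chargedSet hτ) (hη : η ∈ chargedSet hτ) :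
    ξ + η ∈ chargedSet hτ := by
  intro r hr
  obtain ⟨u, hu, hu'⟩ := hξ (r / 2) (by positivity)
  obtain ⟨v, hv, hv'⟩ := hη (r / 2) (by positivity)
  let e : Space d := EuclideanSpace.single ⟨0, hd⟩ 1
  let y : ℕ → Space d := fun n => (n : ℝ) • e
  have hy : Tendsto y atTop (cocompact (Space d)) := by
    rw [← Metric.cobounded_eq_cocompact, ← tendsto_norm_atTop_iff_cobounded]
    have h1 : ∀ n, ‖y n‖ = n := fun n => by
      simp [y, e, norm_smul]
    simp_rw [h1]
    exact tendsto_natCast_atTop_atTop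
  have hw : ∀ n, IsBddMeasurable fun ω => u ω * field τ v (y n) ω := fun n =>
    hu.mul (hv.field hτ _)
  have hconv := conv_apply_ne_zero (U := Metric.ball (ξ + η) r) measurableSet_ball hu' hv'
    fun a ha b hb => by
      rw [Metric.mem_ball] at *
      linarith [dist_add_add_le a b ξ η]
  have hlim : ∀ x, Tendsto (fun n => charFun (freqMeasure hτ (toL2 (P := P) (hw n).memLp)) x) atTop
      (𝓝 (charFun ((freqMeasure hτ (toL2 (P := P) hu.memLp)).conv
        (freqMeasure hτ (toL2 (P := P) hv.memLp))) x)) := fun x => by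
    rw [charFun_conv]
    simp only [charFun_freqMeasure_toL2]
    have hg := hu.mul (hu.field hτ x)
    have hq := hv.mul (hv.field hτ x)
    have h1 := (h.tendsto_inner (toL2 hg.memLp) (toL2 hq.memLp)).comp hy
    rw [← inner_conj_symm (toL2 hg.memLp) (oneVec P), inner_oneVec_toL2, inner_oneVec_toL2,
      Complex.conj_ofReal] at h1
    refine h1.congr fun n => ?_
    rw [Function.comp_apply, inner_toL2_shift]
    congr 1
    refine integral_congr_ae (.of_forall fun ω => ?_)
    simp only [field, hτ.add]
    rw [add_comm (-x) (-y n)]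
    ring
  obtain ⟨n, hn⟩ := exists_measure_ne_zero_of_tendsto_charFun hlim Metric.isOpen_ball hconv
  exact ⟨_, hw n, hn⟩

/-- The support of a nonzero absolutely continuous measure has positive volume, so by Steinhaus its
differences fill a neighbourhood of `0`. The group of charged frequencies is then open, hence also
closed, in a connected space. -/
theorem IsACOffConstants.chargedSet_eq_univ (hd : 0 < d) (h : IsACOffConstants hτ)
    {u : Ω → ℝ} (hu : IsBddMeasurable u) (hu0 : ∫ ω, u ω ∂P = 0) (hne : ¬ u =ᵐ[P] 0) :
    chargedSet hτ = Set.univ := by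
  set m := freqMeasure hτ (toL2 (P := P) hu.memLp)
  have hm : m ≪ volume := h _ (by rw [inner_oneVec_toL2, hu0]; simp)
  have hS : m.support ⊆ chargedSet hτ := fun ξ hξ r hr =>
    ⟨u, hu, (Measure.mem_support_iff_forall ξ |>.1 hξ _ (Metric.ball_mem_nhds ξ hr)).ne'⟩
  have hm0 : m ≠ 0 := freqMeasure_toL2_ne_zero hu.memLp hne
  have hpos : 0 < volume m.support := by
    refine pos_iff_ne_zero.2 fun h0 => hm0 ?_
    have h1 := hm h0
    have h2 := m.measure_compl_support
    rw [← Measure.measure_univ_eq_zero, ← Set.union_compl_self m.support]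
    exact measure_union_null h1 h2
  obtain ⟨ξ₀, hξ₀⟩ := Measure.nonempty_support hm0
  let Γ : AddSubgroup (Space d) :=
    { carrier := chargedSet hτ
      add_mem' := fun h1 h2 => h.add_mem_chargedSet hd h1 h2
      zero_mem' := by
        have := h.add_mem_chargedSet hd (hS hξ₀) (neg_mem_chargedSet (hS hξ₀))
        rwa [add_neg_cancel] at this
      neg_mem' := neg_mem_chargedSet }
  have hΓ : (Γ : Set (Space d)) ∈ 𝓝 0 := by
    refine mem_of_superset (Measure.sub_mem_nhds_zero_of_addHaar_pos volume m.support
      Measure.isClosed_support.measurableSet hpos) ?_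
    rintro _ ⟨a, ha, b, hb, rfl⟩
    exact Γ.sub_mem (hS ha) (hS hb)
  have hopen : IsOpen (Γ : Set (Space d)) := Γ.isOpen_of_mem_nhds hΓ
  exact (IsClopen.eq_univ ⟨Γ.isClosed_of_isOpen hopen, hopen⟩ ⟨0, Γ.zero_mem⟩)

end FullSupport

end StationarySpectrum

namespace StationarySpectrum

/-! ### Lebesgue decomposition of a Dirac mass plus an absolutely continuous measure -/

section Parts

variable {ν : Measure ℝ} [IsFiniteMeasure ν] (hν : ν ≪ volume)

include hν

theorem acPart_smul_dirac_add (a : ℝ≥0∞) (t₀ : ℝ) :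
    acPart (a • Measure.dirac t₀ + ν) = ν := by
  have hs : a • Measure.dirac t₀ ⟂ₘ (volume : Measure ℝ) :=
    (mutuallySingular_dirac t₀ volume).smul a
  have h := Measure.eq_withDensity_rnDeriv (Measure.measurable_rnDeriv ν volume) hs
    (by rw [Measure.withDensity_rnDeriv_eq _ _ hν])
  rw [acPart, ← h, Measure.withDensity_rnDeriv_eq _ _ hν]

open scoped Classical in
theorem scPart_smul_dirac_add (a : ℝ≥0∞) (t₀ : ℝ) :
    scPart (a • Measure.dirac t₀ + ν) = 0 := by
  have hs : a • Measure.dirac t₀ ⟂ₘ (volume : Measure ℝ) :=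
    (mutuallySingular_dirac t₀ volume).smul a
  have h := Measure.eq_singularPart (Measure.measurable_rnDeriv ν volume) hs
    (by rw [Measure.withDensity_rnDeriv_eq _ _ hν])
  rw [scPart, ← h, Measure.restrict_smul]
  rcases eq_or_ne a 0 with rfl | ha
  · simp
  · rw [restrict_dirac, if_neg, smul_zero]
    simp [ha]

open scoped Classical in
theorem ppPart_smul_dirac_add (a : ℝ≥0∞) (t₀ : ℝ) :
    ppPart (a • Measure.dirac t₀ + ν) = a • Measure.dirac t₀ := by
  have h1 : ∀ t, ν {t} = 0 := fun t => hν (Real.volume_singleton)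
  rcases eq_or_ne a 0 with rfl | ha
  · simp [ppPart, h1]
  · have h2 : {t | (a • Measure.dirac t₀ + ν) {t} ≠ 0} = {t₀} := by
      ext t
      by_cases ht : t₀ = t <;> simp [h1, ha, ht, eq_comm]
    rw [ppPart, h2, Measure.restrict_add, Measure.restrict_smul, restrict_dirac,
      if_pos (Set.mem_singleton t₀), Measure.restrict_eq_zero.2 (h1 t₀), add_zero]

end Parts

/-! ### Eigenspace and spectral types from absolute continuity off the constants -/

section Consequences

variable {d : ℕ} {Ω : Type*} [MeasurableSpace Ω] {P : Measure Ω} [IsProbabilityMeasure P]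
  {τ : Space d → Ω → Ω} {hτ : IsMeasurableAction P τ}

theorem fixed_mem_domain_stGrad {φ : Lp ℂ 2 P} (hφ : ∀ x, shift hτ x φ = φ) (j : Fin d) :
    φ ∈ (stGrad hτ j).domain := by
  change DifferentiableAt ℝ _ _
  simp only [hφ]
  exact differentiableAt_const _

theorem stGrad_fixed {φ : Lp ℂ 2 P} (hφ : ∀ x, shift hτ x φ = φ) (j : Fin d)
    (h : φ ∈ (stGrad hτ j).domain) : stGrad hτ j ⟨φ, h⟩ = 0 := by
  change deriv _ _ = _
  simp only [hφ]
  exact deriv_const _ _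

theorem fixed_mem_eigenspaceSet {φ : Lp ℂ 2 P} (hφ : ∀ x, shift hτ x φ = φ) (k : Space d) :
    φ ∈ eigenspaceSet (fiberedOp hτ k) 0 := by
  have hdom : φ ∈ sobolevTwo hτ := fun j => by
    refine ⟨fixed_mem_domain_stGrad hφ j, fun l => ?_⟩
    rw [stGrad_fixed hφ]
    exact Submodule.zero_mem _
  refine ⟨hdom, (fiberedOp_apply hτ k ⟨φ, hdom⟩).trans ?_⟩
  have h1 : ∀ j, stGrad hτ j ⟨stGrad hτ j ⟨φ, (hdom j).1⟩, (hdom j).2 j⟩ = 0 := fun j => by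
    have h2 : (⟨stGrad hτ j ⟨φ, (hdom j).1⟩, (hdom j).2 j⟩ : (stGrad hτ j).domain) = 0 :=
      Subtype.ext (stGrad_fixed hφ j _)
    rw [h2, LinearPMap.map_zero]
  rw [Finset.sum_eq_zero fun j _ => h1 j]
  simp [stGrad_fixed hφ]

variable (h : IsACOffConstants hτ)

include h in
theorem IsACOffConstants.map_dispersion_centered (hd : 0 < d) (k : Space d) (φ : Lp ℂ 2 P) :
    (freqMeasure hτ (centered φ)).map (dispersion k) ≪ volume := by
  have : Nontrivial (Space d) := by
    have : Nonempty (Fin d) := ⟨⟨0, hd⟩⟩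
    infer_instance
  refine Measure.AbsolutelyContinuous.mk fun N hN h0 => ?_
  rw [Measure.map_apply (continuous_dispersion k).measurable hN]
  exact h _ (inner_oneVec_centered φ) (volume_preimage_dispersion_eq_zero k hN h0)

theorem dispersion_zero (k : Space d) : dispersion k 0 = 0 := by simp [dispersion]

theorem map_dispersion_freqMeasure (k : Space d) (φ : Lp ℂ 2 P) :
    (freqMeasure hτ φ).map (dispersion k) =
      ENNReal.ofReal (‖inner ℂ (oneVec P) φ‖ ^ 2) • Measure.dirac 0 +
        (freqMeasure hτ (centered φ)).map (dispersion k) := by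
  have hm := (continuous_dispersion k).measurable
  conv_lhs => rw [freqMeasure_eq_add]
  rw [Measure.map_add _ _ hm, Measure.map_smul, Measure.map_dirac' hm, dispersion_zero]

-- For a vector in the kernel, the symbol vanishes almost everywhere for its frequency measure. The
-- image of the centered part is then concentrated on `{0}` and also absolutely continuous, so the
-- centered part is zero.
include h in
theorem IsACOffConstants.eigenspaceSet_eq (hd : 0 < d) (k : Space d) :
    eigenspaceSet (fiberedOp hτ k) 0 = {φ : Lp ℂ 2 P | ∃ c : ℂ, φ =ᵐ[P] fun _ => c} := by
  ext φ
  constructor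
  · rintro ⟨hdom, he⟩
    have e := symbolCalc_one (hτ := hτ) φ
    have h1 : symbolCalc hτ φ (memLp_const (1 : ℂ)) ∈ (fiberedOp hτ k).domain := by rwa [e]
    obtain ⟨h2, h3⟩ := fiberedOp_symbolCalc k _ h1
    have e2 : (⟨φ, hdom⟩ : (fiberedOp hτ k).domain) =
      ⟨symbolCalc hτ φ (memLp_const (1 : ℂ)), h1⟩ := Subtype.ext e.symm
    rw [← e2, he, zero_smul] at h3
    have h4 := IsUnitaryRep.norm_sq_funCalc (isUnitaryRep_shift hτ) φ h2
    rw [show IsUnitaryRep.funCalc _ φ h2 = 0 from h3.symm, norm_zero, zero_pow two_ne_zero,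
      eq_comm, integral_eq_zero_iff_of_nonneg (fun ξ => by positivity)
      (h2.integrable_norm_pow (by norm_num))] at h4
    have h5 : freqMeasure hτ φ (dispersion k ⁻¹' {0}ᶜ) = 0 := by
      refine measure_mono_null (fun ξ hξ => ?_) h4
      simpa using hξ
    rw [← Measure.map_apply (continuous_dispersion k).measurable
      (measurableSet_singleton _).compl, map_dispersion_freqMeasure, Measure.add_apply,
      add_eq_zero] at h5
    have h6 := h.map_dispersion_centered hd k φ (Real.volume_singleton (a := 0))
    have h7 : (freqMeasure hτ (centered φ)).map (dispersion k) = 0 := by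
      rw [← Measure.measure_univ_eq_zero, ← Set.union_compl_self {(0 : ℝ)}]
      exact measure_union_null h6 h5.2
    rw [Measure.map_eq_zero_iff (continuous_dispersion k).aemeasurable] at h7
    have h8 := eq_zero_of_freqMeasure_eq_zero h7
    refine ⟨inner ℂ (oneVec P) φ, ?_⟩
    have h9 := add_centered φ
    rw [h8, add_zero, ← toLp_const_eq_smul_oneVec] at h9
    conv_lhs => rw [← h9]
    exact MemLp.coeFn_toLp _
  · rintro ⟨c, hc⟩
    refine fixed_mem_eigenspaceSet (fun x => ?_) k
    have h1 : φ = c • oneVec P := by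
      rw [← toLp_const_eq_smul_oneVec]
      exact Lp.ext (hc.trans (MemLp.coeFn_toLp _).symm)
    rw [h1, map_smul, shift_oneVec]

include h in
theorem IsACOffConstants.spectrumPP_eq (hd : 0 < d) (k : Space d) :
    spectrumPP (fiberedOp hτ k) = {0} := by
  have h1 : (⋃ (φ : Lp ℂ 2 P) (μ : Measure ℝ) (_ : IsSpectralMeasure (fiberedOp hτ k) φ μ),
      (ppPart μ).support) = {0} := by
    refine Set.Subset.antisymm ?_ ?_
    · refine Set.iUnion₂_subset fun φ μ => Set.iUnion_subset fun hμ => ?_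
      rw [hμ.eq_map_dispersion, map_dispersion_freqMeasure,
        ppPart_smul_dirac_add (h.map_dispersion_centered hd k φ)]
      refine Measure.support_subset_of_isClosed isClosed_singleton ?_
      rw [mem_ae_iff, Measure.smul_apply, Measure.dirac_apply' _ (measurableSet_singleton _).compl]
      simp
    · rintro _ rfl
      refine Set.mem_iUnion₂.2 ⟨oneVec P, _, Set.mem_iUnion.2
        ⟨isSpectralMeasure_map_dispersion (hτ := hτ) k _, ?_⟩⟩
      rw [map_dispersion_freqMeasure, ppPart_smul_dirac_add (h.map_dispersion_centered hd k _),
        Measure.mem_support_iff_forall]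
      intro U hU
      rw [inner_self_eq_norm_sq_to_K, norm_oneVec, Measure.smul_apply,
        Measure.dirac_apply_of_mem (mem_of_mem_nhds hU)]
      simp
  rw [spectrumPP, h1, closure_singleton]

include h in
theorem IsACOffConstants.spectrumSC_eq (hd : 0 < d) (k : Space d) :
    spectrumSC (fiberedOp hτ k) = ∅ := by
  rw [spectrumSC, closure_empty_iff]
  refine Set.subset_empty_iff.1 (Set.iUnion₂_subset fun φ μ => Set.iUnion_subset fun hμ => ?_)
  rw [hμ.eq_map_dispersion, map_dispersion_freqMeasure,
    scPart_smul_dirac_add (h.map_dispersion_centered hd k φ), Measure.support_zero]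

include h in
theorem IsACOffConstants.spectrumAC_eq (hd : 0 < d) (k : Space d)
    (hball : ∀ (ξ : Space d) (r : ℝ), 0 < r → ∃ φ : Lp ℂ 2 P,
      freqMeasure hτ φ (Metric.ball ξ r) ≠ 0) :
    spectrumAC (fiberedOp hτ k) = Set.Ici (-‖k‖ ^ 2) := by
  have h1 : (⋃ (φ : Lp ℂ 2 P) (μ : Measure ℝ) (_ : IsSpectralMeasure (fiberedOp hτ k) φ μ),
      (acPart μ).support) ⊆ Set.Ici (-‖k‖ ^ 2) := by
    refine Set.iUnion₂_subset fun φ μ => Set.iUnion_subset fun hμ => ?_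
    rw [hμ.eq_map_dispersion, map_dispersion_freqMeasure,
      acPart_smul_dirac_add (h.map_dispersion_centered hd k φ)]
    refine Measure.support_subset_of_isClosed isClosed_Ici ?_
    rw [mem_ae_map_iff (continuous_dispersion k).aemeasurable measurableSet_Ici]
    exact univ_mem' fun ξ => neg_norm_sq_le_dispersion k ξ
  refine Set.Subset.antisymm (closure_minimal h1 isClosed_Ici) fun t ht => ?_
  obtain ⟨ξ₀, hξ₀⟩ := exists_dispersion_eq hd k ht
  refine mem_closure_iff.2 fun U hU htU => ?_
  -- The frequency `0` is removed because mass there may come from the Dirac part; away from it,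
  -- charging a ball says something about the centered vector.
  have hV : IsOpen (dispersion k ⁻¹' U ∩ {0}ᶜ) :=
    (hU.preimage (continuous_dispersion k)).inter isOpen_compl_singleton
  obtain ⟨ξ₁, hξ₁⟩ : (dispersion k ⁻¹' U ∩ {0}ᶜ).Nonempty := by
    have : Nonempty (Fin d) := ⟨⟨0, hd⟩⟩
    exact (dense_compl_singleton (0 : Space d)).inter_open_nonempty _
      (hU.preimage (continuous_dispersion k)) ⟨ξ₀, by rwa [Set.mem_preimage, hξ₀]⟩
  obtain ⟨r, hr, hball'⟩ := Metric.isOpen_iff.1 hV ξ₁ hξ₁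
  obtain ⟨φ, hφ⟩ := hball ξ₁ r hr
  rw [freqMeasure_eq_add, Measure.add_apply, Measure.smul_apply,
    Measure.dirac_apply' _ measurableSet_ball, Set.indicator_of_notMem fun h0 => (hball' h0).2 rfl,
    smul_zero, zero_add] at hφ
  have h2 : (freqMeasure hτ (centered φ)).map (dispersion k) U ≠ 0 := by
    rw [Measure.map_apply (continuous_dispersion k).measurable hU.measurableSet]
    exact fun h0 => hφ (measure_mono_null (hball'.trans Set.inter_subset_left) h0)
  obtain ⟨s, hsU, hs⟩ := Measure.nonempty_inter_support_of_pos (pos_iff_ne_zero.2 h2)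
  refine ⟨s, hsU, Set.mem_iUnion₂.2 ⟨φ, _, Set.mem_iUnion.2
    ⟨isSpectralMeasure_map_dispersion (hτ := hτ) k _, ?_⟩⟩⟩
  rwa [map_dispersion_freqMeasure, acPart_smul_dirac_add (h.map_dispersion_centered hd k φ)]

end Consequences

end StationarySpectrum

namespace StationarySpectrum

/-! ### Reduction to total families; covariance and frequency measure -/

section Conditions

open scoped RealInnerProductSpace ComplexConjugate

variable {d : ℕ} {Ω : Type*} [MeasurableSpace Ω] {P : Measure Ω} [IsProbabilityMeasure P]
  {τ : Space d → Ω → Ω} {hτ : IsMeasurableAction P τ} {V : Ω → ℝ}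

/-! ### Totality of functions of finitely many values of the field -/

theorem continuous_centered : Continuous (centered (P := P)) := by
  unfold centered
  fun_prop

/-- Centering is linear and continuous, so the vectors with absolutely continuous centered part form
a closed subspace; totality of `D` makes its orthogonal complement trivial. -/
theorem isACOffConstants_of_total {D : Set (Lp ℂ 2 P)}
    (hD : ∀ φ ∈ D, freqMeasure hτ (centered φ) ≪ volume)
    (htot : ∀ g : Lp ℂ 2 P, (∀ φ ∈ D, inner ℂ φ g = 0) → g = 0) : IsACOffConstants hτ := by
  let L : Lp ℂ 2 P →ₗ[ℂ] Lp ℂ 2 P :=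
    { toFun := centered
      map_add' := fun φ ψ => by
        simp only [centered, inner_add_right, add_smul]
        abel
      map_smul' := fun c φ => by
        simp only [centered, inner_smul_right, RingHom.id_apply, smul_sub, smul_smul] }
  let W : Submodule ℂ (Lp ℂ 2 P) := (IsUnitaryRep.acVectors (isUnitaryRep_shift hτ)).comap L
  have hW : IsClosed (W : Set (Lp ℂ 2 P)) :=
    (IsUnitaryRep.isClosed_acVectors (isUnitaryRep_shift hτ)).preimage continuous_centered
  have hbot : Wᗮ = ⊥ := by
    rw [Submodule.eq_bot_iff]
    intro g hg
    exact htot g fun φ hφ => (Submodule.mem_orthogonal _ _).1 hg φ (hD φ hφ)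
  have htop : W = ⊤ := by
    rw [← hW.submodule_topologicalClosure_eq]
    exact Submodule.topologicalClosure_eq_top_iff.2 hbot
  intro φ hφ
  have h1 : φ ∈ W := htop ▸ Submodule.mem_top
  have h2 : centered φ = φ := by rw [centered, hφ, zero_smul, sub_zero]
  have h3 : freqMeasure hτ (centered φ) ≪ volume := h1
  rwa [h2] at h3

theorem measurable_field (hτ : IsMeasurableAction P τ) (hV : Measurable V) (x : Space d) :
    Measurable (field τ V x) := hV.comp (hτ.measurePreserving (-x)).measurable

theorem fieldSigma_le (hτ : IsMeasurableAction P τ) (hV : Measurable V) (S : Set (Space d)) :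
    fieldSigma τ V S ≤ ‹MeasurableSpace Ω› :=
  iSup₂_le fun x _ => (measurable_field hτ hV x).comap_le

theorem fieldSigma_mono {S S' : Set (Space d)} (h : S ⊆ S') :
    fieldSigma τ V S ≤ fieldSigma τ V S' := biSup_mono h

/-- A square-integrable function whose integrals over all events depending on finitely many values
of the field vanish is zero. -/
theorem eq_zero_of_forall_setIntegral_eq_zero (hτ : IsMeasurableAction P τ) (hV : Measurable V)
    (hgen : IsGeneratedBy P τ V) {g : Lp ℂ 2 P}
    (h : ∀ (S : Finset (Space d)) (A : Set Ω), MeasurableSet[fieldSigma τ V S] A →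
      ∫ ω in A, g ω ∂P = 0) : g = 0 := by
  have hg : Integrable g P := (Lp.memLp g).integrable (by norm_num)
  have hle := fieldSigma_le hτ hV Set.univ
  have hg0 : ∫ ω, g ω ∂P = 0 := by
    rw [← setIntegral_univ]
    exact h ∅ _ MeasurableSet.univ
  -- Events depending on finitely many field values are stable under intersection, by taking the
  -- union of the point sets, and generate the full `σ`-algebra of the field.
  set 𝒞 : Set (Set Ω) := {A | ∃ S : Finset (Space d), MeasurableSet[fieldSigma τ V S] A}
  have h𝒞 : fieldSigma τ V Set.univ = MeasurableSpace.generateFrom 𝒞 := by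
    refine le_antisymm (iSup₂_le fun x _ A hA => ?_) (MeasurableSpace.generateFrom_le ?_)
    · refine MeasurableSpace.measurableSet_generateFrom ⟨{x}, ?_⟩
      have h1 : MeasurableSpace.comap (field τ V x) inferInstance ≤
          fieldSigma τ V (({x} : Finset (Space d)) : Set (Space d)) :=
        le_iSup₂_of_le x (by simp) le_rfl
      exact h1 A hA
    · rintro A ⟨S, hA⟩
      exact fieldSigma_mono (Set.subset_univ _) A hA
  have hpi : IsPiSystem 𝒞 := by
    classical
    rintro A ⟨S, hA⟩ B ⟨S', hB⟩ -
    refine ⟨S ∪ S', ?_⟩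
    refine @MeasurableSet.inter _ (fieldSigma τ V ((S ∪ S' : Finset (Space d)) : Set (Space d)))
      _ _ ?_ ?_
    · exact fieldSigma_mono (by simp) A hA
    · exact fieldSigma_mono (by simp) B hB
  have key : ∀ A, MeasurableSet[fieldSigma τ V Set.univ] A → ∫ ω in A, g ω ∂P = 0 := by
    intro A hA
    induction A, hA using MeasurableSpace.induction_on_inter h𝒞 hpi with
    | empty => simp
    | basic A hA =>
      obtain ⟨S, hA⟩ := hA
      exact h S A hA
    | compl A hA ih =>
      have h1 := integral_add_compl (hle A hA) hg
      rwa [ih, zero_add, hg0] at h1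
    | iUnion f hd hf ih =>
      rw [integral_iUnion (fun i => hle _ (hf i)) hd hg.integrableOn]
      simp [ih]
  refine Lp.eq_zero_iff_ae_eq_zero.2
    (Integrable.ae_eq_zero_of_forall_setIntegral_eq_zero hg fun A hA _ => ?_)
  obtain ⟨B, hB, hAB⟩ := hgen A hA
  rw [setIntegral_congr_set hAB]
  exact key B hB

/-- The values of the field at the points of `S`. -/
noncomputable def fieldVec (τ : Space d → Ω → Ω) (V : Ω → ℝ) (S : Finset (Space d)) (ω : Ω) :
    EuclideanSpace ℝ S := WithLp.toLp 2 fun x => field τ V x ω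

theorem measurable_fieldVec (hτ : IsMeasurableAction P τ) (hV : Measurable V)
    (S : Finset (Space d)) : Measurable (fieldVec τ V S) := by
  refine (WithLp.measurable_toLp 2 _).comp (measurable_pi_lambda _ fun x => ?_)
  exact measurable_field hτ hV x

theorem fieldSigma_le_comap_fieldVec (S : Finset (Space d)) :
    fieldSigma τ V S ≤ MeasurableSpace.comap (fieldVec τ V S) inferInstance := by
  refine iSup₂_le fun x hx => ?_
  have h1 : field τ V x = (fun y : EuclideanSpace ℝ S => y ⟨x, hx⟩) ∘ fieldVec τ V S := rfl
  rw [h1, ← MeasurableSpace.comap_comp]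
  refine MeasurableSpace.comap_mono (Measurable.comap_le ?_)
  fun_prop

/-! ### The covariance function -/

theorem integral_field (hτ : IsMeasurableAction P τ) (hV : Measurable V) (x : Space d) :
    ∫ ω, field τ V x ω ∂P = ∫ ω, V ω ∂P := by
  have h := (hτ.measurePreserving (-x)).map_eq
  conv_rhs => rw [← h]
  exact (integral_map (hτ.measurePreserving (-x)).measurable.aemeasurable
    hV.aestronglyMeasurable).symm

theorem field_zero (hτ : IsMeasurableAction P τ) (V : Ω → ℝ) : field τ V 0 = V :=
  funext fun ω => by simp [field, hτ.zero]

theorem charFun_freqMeasure_field (hV : Measurable V) (hVL2 : MemLp V 2 P)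
    (h0 : ∫ ω, V ω ∂P = 0) (x : Space d) :
    charFun (freqMeasure hτ (toL2 hVL2)) x = covFun P τ V x := by
  rw [charFun_freqMeasure_toL2, covFun, covariance_eq_sub (memLp_field hτ x hVL2)
    (memLp_field hτ 0 hVL2), integral_field hτ hV, h0, zero_mul, sub_zero, field_zero hτ]
  congr 1
  exact integral_congr_ae (.of_forall fun ω => mul_comm _ _)

theorem charFun_ofReal_smul_freqMeasure (hV : Measurable V) (hVL2 : MemLp V 2 P)
    (h0 : ∫ ω, V ω ∂P = 0) : IsFourierTransform (covFun P τ V)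
      (ENNReal.ofReal ((2 * Real.pi) ^ d) • freqMeasure hτ (toL2 hVL2)) := by
  refine ⟨Measure.smul_finite _ ENNReal.ofReal_ne_top, fun x => ?_⟩
  rw [charFun_smul_measure, charFun_freqMeasure_field hV hVL2 h0,
    ENNReal.toReal_ofReal (by positivity)]
  have h : ((2 * Real.pi : ℝ) : ℂ) ≠ 0 := Complex.ofReal_ne_zero.2 Real.two_pi_pos.ne'
  rw [Complex.ofReal_pow, ← mul_assoc, ← mul_pow, inv_mul_cancel₀ h, one_pow, one_mul]

theorem hasACFourierTransform_of_integrable (hτ : IsMeasurableAction P τ) (hV : Measurable V)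
    (hVL2 : MemLp V 2 P) (h0 : ∫ ω, V ω ∂P = 0) (hC : Integrable (covFun P τ V) volume) :
    HasACFourierTransform (covFun P τ V) := by
  refine ⟨_, charFun_ofReal_smul_freqMeasure (hτ := hτ) hV hVL2 h0, ?_⟩
  refine Measure.AbsolutelyContinuous.smul_left ?_ _
  refine absolutelyContinuous_of_integrable_charFun _ ?_
  exact hC.ofReal.congr (.of_forall fun x => (charFun_freqMeasure_field hV hVL2 h0 x).symm)

theorem freqMeasure_absolutelyContinuous (hV : Measurable V) (hVL2 : MemLp V 2 P)
    (h0 : ∫ ω, V ω ∂P = 0) (hC : HasACFourierTransform (covFun P τ V)) :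
    freqMeasure hτ (toL2 hVL2) ≪ volume := by
  obtain ⟨m, ⟨hm, hCm⟩, hac⟩ := hC
  have hp : 0 < ((2 * Real.pi) ^ d)⁻¹ := by positivity
  have := m.smul_finite (c := ENNReal.ofReal ((2 * Real.pi) ^ d)⁻¹) ENNReal.ofReal_ne_top
  have h1 : freqMeasure hτ (toL2 hVL2) = ENNReal.ofReal ((2 * Real.pi) ^ d)⁻¹ • m := by
    refine Measure.ext_of_charFun (funext fun x => ?_)
    rw [charFun_smul_measure, charFun_freqMeasure_field hV hVL2 h0, hCm,
      ENNReal.toReal_ofReal hp.le]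
    push_cast
    rw [inv_pow]
  rw [h1]
  exact hac.smul_left _

theorem exists_charged_of_exponentialDecay (hV : Measurable V) (hVL2 : MemLp V 2 P)
    (h0 : ∫ ω, V ω ∂P = 0) (hne : ¬ V =ᵐ[P] 0) (hC : HasExponentialDecay (covFun P τ V))
    (ξ : Space d) {r : ℝ} (hr : 0 < r) :
    ∃ φ : Lp ℂ 2 P, freqMeasure hτ φ (Metric.ball ξ r) ≠ 0 := by
  obtain ⟨K, hK, hdec⟩ := hC
  refine ⟨toL2 hVL2, measure_ball_ne_zero_of_exponentialDecay _
    (freqMeasure_toL2_ne_zero hVL2 hne) hK (fun x => ?_) ξ hr⟩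
  rw [charFun_freqMeasure_field hV hVL2 h0, Complex.norm_real, Real.norm_eq_abs]
  exact hdec x

/-- Use `arctan V` minus its mean. If this vanished, `V` would be almost surely a constant, which
the zero mean forces to be `0`. -/
theorem exists_isBddMeasurable_of_ne_zero (hV : Measurable V)
    (h0 : ∫ ω, V ω ∂P = 0) (hne : ¬ V =ᵐ[P] 0) :
    ∃ u : Ω → ℝ, IsBddMeasurable u ∧ ∫ ω, u ω ∂P = 0 ∧ ¬ u =ᵐ[P] 0 := by
  set c := ∫ ω, Real.arctan (V ω) ∂P
  have hm : Measurable fun ω => Real.arctan (V ω) := Real.measurable_arctan.comp hV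
  have hb : ∀ ω, |Real.arctan (V ω)| ≤ Real.pi / 2 := fun ω =>
    abs_le.2 ⟨(Real.neg_pi_div_two_lt_arctan _).le, (Real.arctan_lt_pi_div_two _).le⟩
  have hi : Integrable (fun ω => Real.arctan (V ω)) P :=
    Integrable.of_bound hm.aestronglyMeasurable _ (.of_forall hb)
  refine ⟨fun ω => Real.arctan (V ω) - c, ⟨hm.sub_const c, Real.pi / 2 + |c|, fun ω => ?_⟩, ?_,
    fun h => hne ?_⟩
  · exact (abs_sub _ _).trans (add_le_add_left (hb ω) _)
  · rw [integral_sub hi (integrable_const c)]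
    simp [c]
  · have h1 : V =ᵐ[P] fun _ => Real.tan c := by
      filter_upwards [h] with ω hω
      rw [← sub_eq_zero.1 hω, Real.tan_arctan]
    have h2 : Real.tan c = 0 := by
      rw [integral_congr_ae h1] at h0
      simpa using h0
    rw [h2] at h1
    exact h1

end Conditions

end StationarySpectrum

namespace StationarySpectrum

/-! ### Gaussian fields -/

section Gaussian

open scoped RealInnerProductSpace ComplexConjugate

variable {d : ℕ} {Ω : Type*} [MeasurableSpace Ω] {P : Measure Ω} [IsProbabilityMeasure P]
  {τ : Space d → Ω → Ω} {hτ : IsMeasurableAction P τ} {V X : Ω → ℝ}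

theorem integral_cexp_of_hasGaussianLaw {Y : Ω → ℝ} (hY : HasGaussianLaw Y P)
    (h0 : ∫ ω, Y ω ∂P = 0) :
    ∫ ω, Complex.exp (Y ω * Complex.I) ∂P = Complex.exp (-((∫ ω, Y ω ^ 2 ∂P : ℝ) : ℂ) / 2) := by
  have h := hY.charFun_map_eq (1 : ℝ)
  rw [charFun_apply, integral_map hY.aemeasurable (by fun_prop)] at h
  simp only [RCLike.inner_apply, conj_trivial,
    one_mul, mul_one] at h
  rw [h, h0, variance_eq_sub hY.memLp_two, h0]
  simp
  ring_nf

theorem memLp_cexp (hX : Measurable X) :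
    MemLp (fun ω => Complex.exp (X ω * Complex.I)) 2 P :=
  MemLp.of_bound (by fun_prop) 1 (.of_forall fun ω => (Complex.norm_exp_ofReal_mul_I _).le)

/-- The function `e^{iX}` as a vector of `L²(Ω)`. -/
noncomputable def expVec (P : Measure Ω) [IsProbabilityMeasure P] {X : Ω → ℝ} (hX : Measurable X) :
    Lp ℂ 2 P := (memLp_cexp hX).toLp _

/-- The correlation of `e^{iX}` is the Gaussian characteristic function of the increment. By
stationarity half the variance of that increment is `E[X²]` minus the covariance, so the covariance
appears exponentiated. -/
theorem charFun_freqMeasure_expVec (hX : Measurable X) (hX2 : MemLp X 2 P)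
    (hXG : IsGaussianProcess (field τ X) P) (x : Space d) :
    charFun (freqMeasure hτ (expVec P hX)) x = (Real.exp (-∫ ω, X ω ^ 2 ∂P) : ℝ) *
      Complex.exp (charFun (freqMeasure hτ (toL2 hX2)) x) := by
  have hint : Integrable (fun ω => X ω * field τ X x ω) P :=
    hX2.integrable_mul (memLp_field hτ x hX2)
  have hG : HasGaussianLaw (fun ω => field τ X x ω - X ω) P := by
    have h := hXG.hasGaussianLaw_fun_sub (s := x) (t := 0)
    rwa [field_zero hτ] at h
  have hm : ∫ ω, (field τ X x ω - X ω) ∂P = 0 := by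
    rw [integral_sub ((memLp_field hτ x hX2).integrable (by norm_num))
      (hX2.integrable (by norm_num)), integral_field hτ hX, sub_self]
  have hsq : ∫ ω, field τ X x ω ^ 2 ∂P = ∫ ω, X ω ^ 2 ∂P :=
    integral_field hτ (hX.pow_const 2) x
  have hv : ∫ ω, (field τ X x ω - X ω) ^ 2 ∂P =
      2 * ∫ ω, X ω ^ 2 ∂P - 2 * ∫ ω, X ω * field τ X x ω ∂P := by
    have h1 : ∀ ω, (field τ X x ω - X ω) ^ 2 =
        field τ X x ω ^ 2 + X ω ^ 2 - 2 * (X ω * field τ X x ω) := fun ω => by ring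
    simp_rw [h1]
    have h2 := (memLp_field hτ x hX2).integrable_sq
    rw [integral_sub (f := fun ω => field τ X x ω ^ 2 + X ω ^ 2) (h2.add hX2.integrable_sq)
      (hint.const_mul 2), integral_add h2 hX2.integrable_sq, integral_const_mul, hsq]
    ring
  rw [IsUnitaryRep.charFun_specMeasure, expVec, inner_shift_toLp, charFun_freqMeasure_toL2]
  have h2 : ∀ ω, conj (Complex.exp (X ω * Complex.I)) *
      field τ (fun ω => Complex.exp (X ω * Complex.I)) x ω =
      Complex.exp (((field τ X x ω - X ω : ℝ) : ℂ) * Complex.I) := fun ω => by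
    rw [← Complex.exp_conj, field, ← Complex.exp_add]
    congr 1
    simp [field]
    ring
  simp_rw [h2]
  rw [integral_cexp_of_hasGaussianLaw hG hm, hv, Complex.ofReal_exp, ← Complex.exp_add]
  congr 1
  push_cast
  ring

/-- Centering subtracts `|E e^{iX}|²`, which equals the very prefactor `e^{-E[X²]}`; this produces
the `exp - 1` shape with no Dirac term. -/
theorem charFun_freqMeasure_centered_expVec (hX : Measurable X) (hX2 : MemLp X 2 P)
    (hXG : IsGaussianProcess (field τ X) P) (h0 : ∫ ω, X ω ∂P = 0) (x : Space d) :
    charFun (freqMeasure hτ (centered (expVec P hX))) x = (Real.exp (-∫ ω, X ω ^ 2 ∂P) : ℝ) *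
      (Complex.exp (charFun (freqMeasure hτ (toL2 hX2)) x) - 1) := by
  have hG : HasGaussianLaw X P := by
    have h := hXG.hasGaussianLaw_eval 0
    rwa [field_zero hτ] at h
  have h2 : ‖Complex.exp (-((∫ ω, X ω ^ 2 ∂P : ℝ) : ℂ) / 2)‖ ^ 2 =
      Real.exp (-∫ ω, X ω ^ 2 ∂P) := by
    rw [Complex.norm_exp, ← Real.exp_nat_mul]
    congr 1
    have : (-((∫ ω, X ω ^ 2 ∂P : ℝ) : ℂ) / 2) = ((-(∫ ω, X ω ^ 2 ∂P) / 2 : ℝ) : ℂ) := by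
      push_cast
      ring
    rw [this, Complex.ofReal_re]
    push_cast
    ring
  rw [charFun_freqMeasure_centered, charFun_freqMeasure_expVec hX hX2 hXG, expVec,
    inner_oneVec_toLp, integral_cexp_of_hasGaussianLaw hG h0, h2, mul_sub, mul_one]

theorem exists_charged_of_gaussian (hV : Measurable V) (hVL2 : MemLp V 2 P)
    (h0 : ∫ ω, V ω ∂P = 0) (hVG : IsGaussianProcess (field τ V) P)
    (hC : ¬ IsPeriodicInSomeDirection (covFun P τ V)) (ξ : Space d) {r : ℝ} (hr : 0 < r) :
    ∃ φ : Lp ℂ 2 P, freqMeasure hτ φ (Metric.ball ξ r) ≠ 0 := by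
  refine ⟨expVec P hV, measure_ne_zero_of_charFun_eq_exp (fun t => ?_) (fun v hv hper => ?_)
    (Real.exp_pos _) (charFun_freqMeasure_expVec hV hVL2 hVG) Metric.isOpen_ball
    (Metric.nonempty_ball.2 hr)⟩
  · rw [charFun_neg, charFun_freqMeasure_toL2, Complex.conj_ofReal]
  · refine hC ⟨v, hv, fun x => ?_⟩
    have h1 := hper x
    rw [charFun_freqMeasure_field hV hVL2 h0, charFun_freqMeasure_field hV hVL2 h0] at h1
    exact Complex.ofReal_injective h1

/-- A finite linear combination of values of the field. -/
noncomputable def fieldComb (τ : Space d → Ω → Ω) (V : Ω → ℝ) (S : Finset (Space d))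
    (t : EuclideanSpace ℝ S) (ω : Ω) : ℝ := ∑ x : S, t x * field τ V x ω

theorem field_fieldComb (hτ : IsMeasurableAction P τ) (S : Finset (Space d))
    (t : EuclideanSpace ℝ S) (y : Space d) (ω : Ω) :
    field τ (fieldComb τ V S t) y ω = ∑ x : S, t x * field τ V (y + x) ω := by
  simp only [field, fieldComb, hτ.add, neg_add_rev]

theorem measurable_fieldComb (hτ : IsMeasurableAction P τ) (hV : Measurable V)
    (S : Finset (Space d)) (t : EuclideanSpace ℝ S) : Measurable (fieldComb τ V S t) :=
  Finset.measurable_fun_sum _ fun x _ => (measurable_field hτ hV x).const_mul _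

theorem memLp_fieldComb (hτ : IsMeasurableAction P τ) (hVL2 : MemLp V 2 P)
    (S : Finset (Space d)) (t : EuclideanSpace ℝ S) : MemLp (fieldComb τ V S t) 2 P :=
  memLp_finsetSum _ fun x _ => (memLp_field hτ x hVL2).const_mul _

theorem integral_fieldComb (hτ : IsMeasurableAction P τ) (hV : Measurable V) (hVL2 : MemLp V 2 P)
    (h0 : ∫ ω, V ω ∂P = 0) (S : Finset (Space d)) (t : EuclideanSpace ℝ S) :
    ∫ ω, fieldComb τ V S t ω ∂P = 0 := by
  simp only [fieldComb]
  rw [integral_finsetSum (f := fun (x : S) ω => t x * field τ V x ω) _ fun x _ =>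
    ((memLp_field hτ (x : Space d) hVL2).integrable (by norm_num)).const_mul _]
  simp only [integral_const_mul, integral_field hτ hV, h0, mul_zero, Finset.sum_const_zero]

theorem isGaussianProcess_fieldComb (hτ : IsMeasurableAction P τ)
    (hVG : IsGaussianProcess (field τ V) P) (S : Finset (Space d)) (t : EuclideanSpace ℝ S) :
    IsGaussianProcess (field τ (fieldComb τ V S t)) P := by
  classical
  refine hVG.of_isGaussianProcess fun y => ⟨S.image fun x => y + x,
    ∑ x : S, t x • ContinuousLinearMap.proj (R := ℝ) (φ := fun _ => ℝ)
      (⟨y + x, Finset.mem_image_of_mem _ x.2⟩ : S.image fun x => y + x), fun ω => ?_⟩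
  rw [field_fieldComb hτ]
  simp

theorem toL2_fieldComb (hτ : IsMeasurableAction P τ) (hVL2 : MemLp V 2 P)
    (S : Finset (Space d)) (t : EuclideanSpace ℝ S) :
    toL2 (memLp_fieldComb hτ hVL2 S t) = ∑ x : S, (t x : ℂ) • shift hτ x (toL2 hVL2) := by
  have h1 : ∀ x : S, (t x : ℂ) • shift hτ x (toL2 hVL2) =
      (((memLp_field hτ (x : Space d) (hVL2.ofReal (K := ℂ))).const_smul (t x : ℂ)).toLp _) :=
    fun x => by
      rw [toL2, shift_toLp, ← MemLp.toLp_const_smul]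
  rw [Finset.sum_congr rfl fun x _ => h1 x]
  refine Lp.ext ?_
  have h2 := ae_all_iff.2 fun x : S => (((memLp_field hτ (x : Space d)
    (hVL2.ofReal (K := ℂ))).const_smul (t x : ℂ)).coeFn_toLp)
  filter_upwards [((memLp_fieldComb hτ hVL2 S t).ofReal (K := ℂ)).coeFn_toLp,
    Lp.coeFn_finsetSum Finset.univ fun x : S => (((memLp_field hτ (x : Space d)
      (hVL2.ofReal (K := ℂ))).const_smul (t x : ℂ)).toLp _), h2] with ω a b c
  rw [toL2, a, b, Finset.sum_apply]
  simp only [c]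
  simp [fieldComb, field]

theorem IsUnitaryRep.apply_mem_acVectors {E : Type*} [NormedAddCommGroup E] [InnerProductSpace ℝ E]
    [FiniteDimensional ℝ E] [MeasurableSpace E] [BorelSpace E] {H : Type*} [NormedAddCommGroup H]
    [InnerProductSpace ℂ H] [CompleteSpace H] {T : E → H →ₗᵢ[ℂ] H} (hT : IsUnitaryRep T) {φ : H}
    (hφ : φ ∈ hT.acVectors) (x : E) : T x φ ∈ hT.acVectors := by
  have h : hT.specMeasure (T x φ) = hT.specMeasure φ := hT.specMeasure_eq fun y => by
    rw [charFun_specMeasure, ← hT.add, hT.inner_apply, add_sub_cancel_right]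
  rw [mem_acVectors, h]
  exact hφ

/-- A finite combination of field values is again a stationary centered Gaussian field, and as a
combination of shifts of `V` it is an absolutely continuous vector. Exponentials of such
combinations are total by Fourier uniqueness for the finite-dimensional marginals. -/
theorem isACOffConstants_of_gaussian (hV : Measurable V) (hVL2 : MemLp V 2 P)
    (h0 : ∫ ω, V ω ∂P = 0) (hgen : IsGeneratedBy P τ V) (hVG : IsGaussianProcess (field τ V) P)
    (hC : HasACFourierTransform (covFun P τ V)) : IsACOffConstants hτ := by
  have hmeas := fun S t => measurable_fieldComb hτ hV S t
  refine isACOffConstants_of_total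
    (D := {φ | ∃ S t, φ = expVec P (hmeas S t)}) ?_ fun g hg => ?_
  · rintro _ ⟨S, t, rfl⟩
    refine absolutelyContinuous_of_charFun_eq_exp_sub_one ?_ (Real.exp_pos _).le
      (charFun_freqMeasure_centered_expVec (hmeas S t) (memLp_fieldComb hτ hVL2 S t)
        (isGaussianProcess_fieldComb hτ hVG S t) (integral_fieldComb hτ hV hVL2 h0 S t))
    have h1 : toL2 (memLp_fieldComb hτ hVL2 S t) ∈
        IsUnitaryRep.acVectors (isUnitaryRep_shift hτ) := by
      rw [toL2_fieldComb hτ hVL2]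
      exact Submodule.sum_mem _ fun x _ => Submodule.smul_mem _ _
        (IsUnitaryRep.apply_mem_acVectors _ (freqMeasure_absolutelyContinuous hV hVL2 h0 hC) _)
    exact h1
  · refine eq_zero_of_forall_setIntegral_eq_zero hτ hV hgen fun S A hA => ?_
    obtain ⟨B, hB, rfl⟩ := fieldSigma_le_comap_fieldVec S A hA
    refine setIntegral_preimage_eq_zero_of_forall_integral_exp (measurable_fieldVec hτ hV S)
      ((Lp.memLp g).integrable (by norm_num)) (fun t => ?_) hB
    -- The sign compensates for the conjugation in the first slot of the inner product.
    have h1 := hg _ ⟨S, -t, rfl⟩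
    rw [expVec, ← Lp.toLp_coeFn g (Lp.memLp g), inner_toLp] at h1
    rw [← h1]
    refine integral_congr_ae ?_
    refine .of_forall fun ω => ?_
    beta_reduce
    rw [← Complex.exp_conj, mul_comm]
    congr 2
    simp [fieldComb, fieldVec, PiLp.inner_apply]

end Gaussian

end StationarySpectrum

namespace StationarySpectrum

/-! ### Alpha-mixing fields -/

section Mixing

open scoped ComplexConjugate Pointwise

variable {d : ℕ} {Ω : Type*} [MeasurableSpace Ω] {P : Measure Ω} [IsProbabilityMeasure P]
  {τ : Space d → Ω → Ω} {hτ : IsMeasurableAction P τ} {V : Ω → ℝ}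

theorem measurableSet_preimage_fieldSigma (hτ : IsMeasurableAction P τ) {S : Set (Space d)}
    {A : Set Ω} (hA : MeasurableSet[fieldSigma τ V S] A) (x : Space d) :
    MeasurableSet[fieldSigma τ V (x +ᵥ S)] (τ (-x) ⁻¹' A) := by
  have h : Measurable[fieldSigma τ V (x +ᵥ S), fieldSigma τ V S] (τ (-x)) := by
    rw [measurable_iff_comap_le, MeasurableSpace.comap_iSup]
    refine iSup_le fun y => ?_
    rw [MeasurableSpace.comap_iSup]
    refine iSup_le fun hy => ?_
    rw [MeasurableSpace.comap_comp]
    have h1 : field τ V y ∘ τ (-x) = field τ V (x + y) := by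
      funext ω
      simp only [Function.comp_apply, field, hτ.add, neg_add_rev]
    rw [h1]
    exact le_iSup₂_of_le (x + y) (Set.vadd_mem_vadd_set hy) le_rfl
  exact h hA

theorem ofReal_abs_le_alphaMix {S₁ S₂ : Finset (Space d)} {R D : ℝ}
    (hR : ∀ x ∈ S₁, ∀ y ∈ S₂, R ≤ dist x y) (h₁ : ∀ x ∈ S₁, ∀ y ∈ S₁, dist x y ≤ D)
    (h₂ : ∀ x ∈ S₂, ∀ y ∈ S₂, dist x y ≤ D) {A B : Set Ω}
    (hA : MeasurableSet[fieldSigma τ V S₁] A) (hB : MeasurableSet[fieldSigma τ V S₂] B) :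
    ENNReal.ofReal |P.real (A ∩ B) - P.real A * P.real B| ≤ alphaMix P τ V R D := by
  have h3 : ENNReal.ofReal |P.real (A ∩ B) - P.real A * P.real B| ≤
      alphaCoeff P (fieldSigma τ V S₁) (fieldSigma τ V S₂) :=
    le_iSup₂_of_le A B (le_iSup₂_of_le hA hB le_rfl)
  refine h3.trans ?_
  exact le_iSup₂_of_le (S₁ : Set (Space d)) S₂ (le_iSup₂_of_le S₁.measurableSet S₂.measurableSet
    (le_iSup_of_le hR (le_iSup₂_of_le h₁ h₂ le_rfl)))

/-- The indicator function of an event as a vector of `L²(Ω)`. -/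
noncomputable def indVec (P : Measure Ω) [IsProbabilityMeasure P] {A : Set Ω}
    (hA : MeasurableSet A) : Lp ℂ 2 P :=
  indicatorConstLp 2 hA (measure_ne_top P A) 1

theorem charFun_freqMeasure_centered_indVec {A : Set Ω} (hA : MeasurableSet A) (x : Space d) :
    charFun (freqMeasure hτ (centered (indVec P hA))) x =
      ((P.real (A ∩ τ (-x) ⁻¹' A) - P.real A * P.real (τ (-x) ⁻¹' A) : ℝ) : ℂ) := by
  have hu : MemLp (A.indicator fun _ => (1 : ℝ)) 2 P :=
    memLp_indicator_const 2 hA 1 (.inr (measure_ne_top P A))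
  have hτx := hτ.measurePreserving (-x)
  have h1 : indVec P hA = toL2 hu := by
    refine MemLp.toLp_congr (memLp_indicator_const 2 hA 1 (.inr (measure_ne_top P A)))
      (hu.ofReal (K := ℂ)) (.of_forall fun ω => ?_)
    by_cases hω : ω ∈ A <;> simp [hω]
  have h2 : ∀ ω, A.indicator (fun _ => (1 : ℝ)) ω * field τ (A.indicator fun _ => (1 : ℝ)) x ω =
      (A ∩ τ (-x) ⁻¹' A).indicator (fun _ => (1 : ℝ)) ω := fun ω => by
    by_cases h3 : ω ∈ A <;> by_cases h4 : τ (-x) ω ∈ A <;> simp [field, h3, h4]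
  have h5 : P.real (τ (-x) ⁻¹' A) = P.real A := by
    rw [measureReal_def, measureReal_def, hτx.measure_preimage hA.nullMeasurableSet]
  rw [charFun_freqMeasure_centered, h1, charFun_freqMeasure_toL2, inner_oneVec_toL2,
    Complex.norm_real, Real.norm_eq_abs, sq_abs, h5]
  simp_rw [h2]
  rw [integral_indicator_const _ hA, integral_indicator_const _ (hA.inter (hτx.measurable hA))]
  simp [sq]

theorem lintegral_alphaMix_half (V : Ω → ℝ) {D : ℝ}
    (h : ∫⁻ x : Space d, alphaMix P τ V ‖x‖ D < ∞) :
    ∫⁻ x : Space d, alphaMix P τ V (‖x‖ / 2) D < ∞ := by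
  let e : Space d ≃ₜ Space d := Homeomorph.smulOfNeZero (2⁻¹ : ℝ) (by norm_num)
  -- Changing variables along an equivalence avoids any measurability requirement on the mixing
  -- coefficient.
  have h1 := lintegral_map_equiv (μ := (volume : Measure (Space d)))
    (fun x => alphaMix P τ V ‖x‖ D) e.toMeasurableEquiv
  have h2 : (volume : Measure (Space d)).map e.toMeasurableEquiv = ENNReal.ofReal
      |((2⁻¹ : ℝ) ^ Module.finrank ℝ (Space d))⁻¹| • volume :=
    Measure.map_addHaar_smul volume (by norm_num)
  rw [h2, lintegral_smul_measure] at h1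
  have h3 : ∀ x, alphaMix P τ V ‖e.toMeasurableEquiv x‖ D = alphaMix P τ V (‖x‖ / 2) D := fun x => by
    change alphaMix P τ V ‖(2⁻¹ : ℝ) • x‖ D = _
    rw [norm_smul, norm_inv, Real.norm_ofNat, div_eq_inv_mul]
  simp_rw [h3] at h1
  rw [← h1]
  exact ENNReal.mul_lt_top ENNReal.ofReal_lt_top h

/-- The correlation of a centered indicator with its shift is the quantity bounded by the mixing
coefficient. It is therefore integrable in the shift, and an integrable characteristic function
forces absolute continuity. -/
theorem freqMeasure_centered_indVec_absolutelyContinuous (hV : Measurable V)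
    (hmix : HasIntegrableAlphaMixing P τ V) {S : Finset (Space d)} {A : Set Ω}
    (hA : MeasurableSet[fieldSigma τ V S] A) :
    freqMeasure hτ (centered (indVec P (fieldSigma_le hτ hV S A hA))) ≪ volume := by
  classical
  obtain ⟨D, hD0, hD⟩ : ∃ D : ℝ, 0 < D ∧ ∀ x ∈ S, ∀ y ∈ S, dist x y ≤ D := by
    obtain ⟨C, hC⟩ := Metric.isBounded_iff.1 S.finite_toSet.isBounded
    exact ⟨max C 1, by positivity, fun x hx y hy => (hC hx hy).trans (le_max_left _ _)⟩
  refine absolutelyContinuous_of_integrable_charFun _ ⟨?_, ?_⟩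
  · exact (continuous_charFun).aestronglyMeasurable
  have hle : ∀ x : Space d, ‖charFun (freqMeasure hτ
      (centered (indVec P (fieldSigma_le hτ hV S A hA)))) x‖ₑ ≤
      alphaMix P τ V (‖x‖ / 2) D + (Metric.closedBall 0 (2 * D)).indicator (fun _ => 1) x := by
    intro x
    rw [charFun_freqMeasure_centered_indVec, ← ofReal_norm, Complex.norm_real, Real.norm_eq_abs]
    -- Beyond radius `2D` the point set and its translate are at distance at least `‖x‖ - D ≥
    -- ‖x‖/2`, whence the halved argument; inside, the trivial bound `1` on a ball of finite volume
    -- is enough.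
    by_cases hx : x ∈ Metric.closedBall 0 (2 * D)
    · rw [Set.indicator_of_mem hx]
      refine le_add_left (ENNReal.ofReal_le_one.2 (abs_le.2 ⟨?_, ?_⟩)) <;>
      nlinarith [measureReal_nonneg (μ := P) (s := A ∩ τ (-x) ⁻¹' A),
        measureReal_le_one (μ := P) (s := A ∩ τ (-x) ⁻¹' A),
        measureReal_nonneg (μ := P) (s := A), measureReal_le_one (μ := P) (s := A),
        measureReal_nonneg (μ := P) (s := τ (-x) ⁻¹' A),
        measureReal_le_one (μ := P) (s := τ (-x) ⁻¹' A)]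
    · rw [Set.indicator_of_notMem hx, add_zero]
      rw [mem_closedBall_zero_iff, not_le] at hx
      have hB := measurableSet_preimage_fieldSigma hτ hA x
      have hcoe : x +ᵥ (S : Set (Space d)) = ((S.image fun y => x + y : Finset (Space d)) :
          Set (Space d)) := by
        rw [Finset.coe_image]
        rfl
      rw [hcoe] at hB
      refine ofReal_abs_le_alphaMix ?_ hD ?_ hA hB
      · intro y hy z hz
        obtain ⟨w, hw, rfl⟩ := Finset.mem_image.1 hz
        have h1 := hD w hw y hy
        have h2 : ‖x‖ ≤ dist y (x + w) + dist w y := by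
          rw [dist_comm y, dist_eq_norm, dist_eq_norm, ]
          have := norm_sub_le (x + w - y) (w - y)
          rwa [sub_sub_sub_cancel_right, add_sub_cancel_right] at this
        linarith
      · intro y hy z hz
        obtain ⟨w, hw, rfl⟩ := Finset.mem_image.1 hy
        obtain ⟨w', hw', rfl⟩ := Finset.mem_image.1 hz
        rw [dist_add_left]
        exact hD w hw w' hw'
  refine (lintegral_mono hle).trans_lt ?_
  rw [lintegral_add_right _ (measurable_const.indicator measurableSet_closedBall),
    lintegral_indicator measurableSet_closedBall, setLIntegral_one]
  exact ENNReal.add_lt_top.2 ⟨lintegral_alphaMix_half V (hmix D hD0), measure_closedBall_lt_top⟩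

theorem isACOffConstants_of_mixing (hV : Measurable V) (hgen : IsGeneratedBy P τ V)
    (hmix : HasIntegrableAlphaMixing P τ V) : IsACOffConstants hτ := by
  refine isACOffConstants_of_total (D := {φ | ∃ (S : Finset (Space d)) (A : Set Ω)
    (hA : MeasurableSet[fieldSigma τ V S] A), φ = indVec P (fieldSigma_le hτ hV S A hA)}) ?_
    fun g hg => ?_
  · rintro _ ⟨S, A, hA, rfl⟩
    exact freqMeasure_centered_indVec_absolutelyContinuous hV hmix hA
  · refine eq_zero_of_forall_setIntegral_eq_zero hτ hV hgen fun S A hA => ?_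
    rw [← hg _ ⟨S, A, hA, rfl⟩, indVec, L2.inner_indicatorConstLp_one]

end Mixing

theorem IsACOffConstants.exists_charged {d : ℕ} (hd : 0 < d) {Ω : Type*} [MeasurableSpace Ω]
    {P : Measure Ω} [IsProbabilityMeasure P] {τ : Space d → Ω → Ω} {hτ : IsMeasurableAction P τ}
    (h : IsACOffConstants hτ) {V : Ω → ℝ} (hV : Measurable V) (h0 : ∫ ω, V ω ∂P = 0)
    (hne : ¬ V =ᵐ[P] 0) (ξ : Space d) {r : ℝ} (hr : 0 < r) :
    ∃ φ : Lp ℂ 2 P, freqMeasure hτ φ (Metric.ball ξ r) ≠ 0 := by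
  obtain ⟨u, hu, hu0, hune⟩ := exists_isBddMeasurable_of_ne_zero hV h0 hne
  have h1 : ξ ∈ chargedSet hτ := h.chargedSet_eq_univ hd hu hu0 hune ▸ Set.mem_univ ξ
  obtain ⟨v, hv, hv'⟩ := h1 r hr
  exact ⟨_, hv'⟩

end StationarySpectrum

/-! ### Assembly of the spectral statements -/

theorem mainTheorem3 {d : ℕ} (hd : 0 < d) {Ω : Type*} [MeasurableSpace Ω]
    (P : Measure Ω) [IsProbabilityMeasure P]
    (τ : StationarySpectrum.Space d → Ω → Ω)
    (hτ : StationarySpectrum.IsMeasurableAction P τ)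
    (V : Ω → ℝ) (hVmeas : Measurable V) (hVL2 : MemLp V 2 P)
    (hVcentered : ∫ ω, V ω ∂P = 0) (hVnonzero : ¬ V =ᵐ[P] 0)
    (hgen : StationarySpectrum.IsGeneratedBy P τ V)
    (k : StationarySpectrum.Space d) :
    (((IsGaussianProcess (StationarySpectrum.field τ V) P ∧
          ¬ StationarySpectrum.IsPeriodicInSomeDirection (StationarySpectrum.covFun P τ V)) ∨
        StationarySpectrum.HasExponentialDecay (StationarySpectrum.covFun P τ V)) →
      StationarySpectrum.spectrumSet (StationarySpectrum.fiberedOp hτ k) =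
        (fun t : ℝ => (t : ℂ)) '' Set.Ici (-‖k‖ ^ 2)) ∧
    (((IsGaussianProcess (StationarySpectrum.field τ V) P ∧
          StationarySpectrum.HasACFourierTransform (StationarySpectrum.covFun P τ V)) ∨
        (StationarySpectrum.IsAlphaMixing P τ V ∧
          StationarySpectrum.HasIntegrableAlphaMixing P τ V)) →
      StationarySpectrum.eigenspaceSet (StationarySpectrum.fiberedOp hτ k) 0 =
          {φ : Lp ℂ 2 P | ∃ c : ℂ, φ =ᵐ[P] fun _ => c} ∧
        StationarySpectrum.spectrumPP (StationarySpectrum.fiberedOp hτ k) = {0} ∧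
        StationarySpectrum.spectrumSC (StationarySpectrum.fiberedOp hτ k) = ∅ ∧
        StationarySpectrum.spectrumAC (StationarySpectrum.fiberedOp hτ k) = Set.Ici (-‖k‖ ^ 2) ∧
        StationarySpectrum.spectrumSet (StationarySpectrum.fiberedOp hτ k) =
          (fun t : ℝ => (t : ℂ)) '' Set.Ici (-‖k‖ ^ 2)) ∧
    (Integrable (StationarySpectrum.covFun P τ V) volume →
      StationarySpectrum.HasACFourierTransform (StationarySpectrum.covFun P τ V)) := by
  open StationarySpectrum in
  refine ⟨fun h => spectrumSet_fiberedOp hd k fun ξ r hr => ?_, fun h => ?_,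
    hasACFourierTransform_of_integrable hτ hVmeas hVL2 hVcentered⟩
  · rcases h with ⟨hG, hC⟩ | hC
    · exact exists_charged_of_gaussian hVmeas hVL2 hVcentered hG hC ξ hr
    · exact exists_charged_of_exponentialDecay hVmeas hVL2 hVcentered hVnonzero hC ξ hr
  · have hac : IsACOffConstants hτ := by
      rcases h with ⟨hG, hC⟩ | ⟨-, hmix⟩
      · exact isACOffConstants_of_gaussian hVmeas hVL2 hVcentered hgen hG hC
      · exact isACOffConstants_of_mixing hVmeas hgen hmix
    have hball : ∀ (ξ : Space d) (r : ℝ), 0 < r → ∃ φ : Lp ℂ 2 P,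
        freqMeasure hτ φ (Metric.ball ξ r) ≠ 0 := fun ξ r hr =>
      hac.exists_charged hd hVmeas hVcentered hVnonzero ξ hr
    exact ⟨hac.eigenspaceSet_eq hd k, hac.spectrumPP_eq hd k, hac.spectrumSC_eq hd k,
      hac.spectrumAC_eq hd k hball, spectrumSet_fiberedOp hd k hball⟩
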